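/- Let $\mathbf{k}$ be a field of characteristic $0$ and let $P$ be a (symmetric) linear operad over $\mathbf{k}$, regarded as a functor $S \mapsto P(S)$ on finite sets and bijections equipped with composition maps and an identity element in $P([1])$. Let $\mathbf{W}=\bigcup_{n\ge 1}\mathbf{k}^n$, with basis $x_1,x_2,\dots$, and let $\mathbf{V}=P\{\mathbf{W}\}=\bigoplus_{r\ge 0}P([r])\otimes_{\mathbf{k}[\mathfrak{S}_r]}\mathbf{W}^{\otimes r}$ be the free $P$-algebra on $\mathbf{W}$. Let $\mathfrak{h}=\bigcup_n\mathfrak{h}_n$, where $\mathfrak{h}_n$ is the Lie algebra of derivations of the free $P$-algebra $P\{\mathbf{k}^n\}$; equivalently, $\mathfrak{h}$ is the Lie algebra of those derivations of the $P$-algebra $\mathbf{V}$ that kill all but finitely many of the $x_i$. A representation of $\mathfrak{h}$ is called polynomial if it is a subquotient of a (possibly infinite) direct sum of tensor powers $\mathbf{V}^{\otimes d}$, $d \ge 0$, and $\mathrm{Rep}^{\mathrm{pol}}(\mathfrak{h})$ denotes the category of polynomial representations. Write $\mathbf{S}_\lambda$ for the Schur functor of a partition $\lambda$ (of any size, including the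 empty partition). Suppose that $P([0])=0$ and that $P([1])=\mathbf{k}$ is one-dimensional (this holds for example for the non-unital commutative operad $\mathrm{Com}^{\mathrm{nu}}$). Then $\mathfrak{h}$ is graded in non-negative degrees with degree $0$ part $\mathfrak{gl}=\bigcup_n\mathfrak{gl}_n$, so $\mathfrak{h}$ acts on $\mathbf{W}$, and hence on $\mathbf{S}_\lambda(\mathbf{W})$, through the quotient homomorphism $\mathfrak{h}\to\mathfrak{gl}$; and $\mathfrak{h}$ acts on $\mathbf{S}_\lambda(\mathbf{V})$ via its tautological action on $\mathbf{V}$. 1. For every partition $\lambda$ the representation $\mathbf{S}_\lambda(\mathbf{W})$ is a simple object of $\mathrm{Rep}^{\mathrm{pol}}(\mathfrak{h})$, and every simple object of $\mathrm{Rep}^{\mathrm{pol}}(\mathfrak{h})$ is isomorphic to $\mathbf{S}_\lambda(\mathbf{W})$ for some partition $\lambda$. 2. For every partition $\lambda$ the representation $\mathbf{S}_\lambda(\mathbf{V})$ is an indecomposable projective object of $\mathrm{Rep}^{\mathrm{pol}}(\mathfrak{h})$, and every indecomposable projective object of $\mathrm{Rep}^{\mathrm{pol}}(\mathfrak{h})$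 is isomorphic to $\mathbf{S}_\lambda(\mathbf{V})$ for some partition $\lambda$. -/

import Mathlib

open scoped TensorProduct DirectSum

universe u

namespace OperadRep

noncomputable section

/-! ### Multilinear maps determined on spanning families -/

/-- Induction over a finite family of vectors, from families of members of spanning families. -/
theorem pi_span_induction {k T : Type*} [CommRing k] [Finite T] [DecidableEq T]
    {κ N : T → Type*} [∀ t, Nonempty (κ t)] [∀ t, AddCommGroup (N t)] [∀ t, Module k (N t)]
    (g : ∀ t, κ t → N t) (hg : ∀ t, Submodule.span k (Set.range (g t)) = ⊤)
    (Q : (∀ t, N t) → Prop) (hgen : ∀ c : ∀ t, κ t, Q (fun t => g t (c t)))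
    (hadd : ∀ z t x y, Q (Function.update z t x) → Q (Function.update z t y) →
      Q (Function.update z t (x + y)))
    (hsmul : ∀ z t (c : k) x, Q (Function.update z t x) → Q (Function.update z t (c • x)))
    (z : ∀ t, N t) : Q z := by
  have := Fintype.ofFinite T
  have key : ∀ s : Finset T, ∀ z : ∀ t, N t, (∀ t ∉ s, ∃ j, z t = g t j) → Q z := by
    intro s
    induction s using Finset.induction_on with
    | empty =>
      intro z hz
      choose c hc using fun t => hz t (Finset.notMem_empty t)
      have : z = fun t => g t (c t) := funext hc
      rw [this]
      exact hgen c
    | insert t s hts ih =>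
      intro z hz
      have hx : ∀ x : N t, Q (Function.update z t x) := by
        intro x
        have hxm : x ∈ Submodule.span k (Set.range (g t)) := by rw [hg]; trivial
        induction hxm using Submodule.span_induction with
        | mem x hx =>
          obtain ⟨j, rfl⟩ := hx
          apply ih
          intro t' ht'
          by_cases h : t' = t
          · subst h; exact ⟨j, by simp⟩
          · obtain ⟨j', hj'⟩ := hz t' (by simp [h, ht'])
            exact ⟨j', by simp [h, hj']⟩
        | zero =>
          obtain ⟨j⟩ := (inferInstance : Nonempty (κ t))
          rw [← zero_smul k (g t j)]
          refine hsmul z t 0 _ (ih _ fun t' ht' => ?_)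
          by_cases h : t' = t
          · subst h; exact ⟨j, by simp⟩
          · obtain ⟨j', hj'⟩ := hz t' (by simp [h, ht'])
            exact ⟨j', by simp [h, hj']⟩
        | add x y _ _ hx hy => exact hadd z t x y hx hy
        | smul c x _ hx => exact hsmul z t c x hx
      simpa using hx (z t)
  exact key Finset.univ z (fun t ht => absurd (Finset.mem_univ t) ht)

/-- Two multilinear maps that agree on spanning families are equal. -/
theorem multilinear_ext_span {k T A : Type*} [CommRing k] [Finite T]
    {κ N : T → Type*} [∀ t, Nonempty (κ t)] [∀ t, AddCommGroup (N t)] [∀ t, Module k (N t)]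
    [AddCommGroup A] [Module k A]
    (g : ∀ t, κ t → N t) (hg : ∀ t, Submodule.span k (Set.range (g t)) = ⊤)
    (f f' : MultilinearMap k N A)
    (h : ∀ c : ∀ t, κ t, f (fun t => g t (c t)) = f' (fun t => g t (c t))) : f = f' := by
  classical
  ext z
  refine pi_span_induction g hg (fun z => f z = f' z) h ?_ ?_ z
  · intro z t x y hx hy; simp [MultilinearMap.map_update_add, hx, hy]
  · intro z t c x hx; simp [MultilinearMap.map_update_smul, hx]

/-- A function on members of spanning families which is linear in each slot extends to a
multilinear map. -/
theorem exists_multilinear_extension {k T A : Type*} [CommRing k] [Finite T] [iT : DecidableEq T]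
    {κ N : T → Type*} [∀ t, Nonempty (κ t)] [∀ t, AddCommGroup (N t)] [∀ t, Module k (N t)]
    [AddCommGroup A] [Module k A]
    (g : ∀ t, κ t → N t) (hg : ∀ t, Submodule.span k (Set.range (g t)) = ⊤)
    (φ : (∀ t, κ t) → A)
    (hφ : ∀ (c : ∀ t, κ t) (t : T), ∃ L : N t →ₗ[k] A, ∀ j, L (g t j) = φ (Function.update c t j)) :
    ∃ f : MultilinearMap k N A, ∀ c : ∀ t, κ t, f (fun t => g t (c t)) = φ c := by
  classical
  have := Fintype.ofFinite T
  let π : ∀ t, (κ t →₀ k) →ₗ[k] N t := fun t => Finsupp.linearCombination k (g t)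
  have hπ : ∀ t, Function.Surjective (π t) := fun t => by
    rw [← LinearMap.range_eq_top, Finsupp.range_linearCombination, hg]
  let Ψ : MultilinearMap k (fun t => κ t →₀ k) A :=
    ((Finsupp.linearCombination k φ) ∘ₗ
      (PiTensorProduct.ofFinsuppEquiv' (R := k) (κ := κ)).toLinearMap).compMultilinearMap
      (PiTensorProduct.tprod k)
  have hΨ : ∀ c : ∀ t, κ t, Ψ (fun t => Finsupp.single (c t) 1) = φ c := by
    intro c
    simp [Ψ]
  have hsp : ∀ t, Submodule.span k (Set.range (fun j : κ t => Finsupp.single j (1 : k))) = ⊤ :=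
    fun t => by
      have := (Finsupp.basisSingleOne (R := k) (ι := κ t)).span_eq
      simpa [Finsupp.coe_basisSingleOne] using this
  have h0 : ∀ (t : T) (x : κ t →₀ k), π t x = 0 → ∀ z, Ψ (Function.update z t x) = 0 := by
    intro t x hx z
    refine pi_span_induction (fun t (j : κ t) => Finsupp.single j (1 : k)) hsp
      (fun z => Ψ (Function.update z t x) = 0) ?_ ?_ ?_ z
    · intro c
      obtain ⟨L, hL⟩ := hφ c t
      have : Ψ.toLinearMap (fun t => Finsupp.single (c t) 1) t = L ∘ₗ π t := by
        apply Finsupp.lhom_ext'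
        intro j
        ext
        simp only [LinearMap.comp_apply, Finsupp.lsingle_apply, MultilinearMap.toLinearMap_apply, π,
          Finsupp.linearCombination_single, one_smul, hL]
        rw [← hΨ]
        congr 1
        ext t' : 1
        by_cases h : t' = t
        · subst h; simp
        · simp [h]
      have h2 := LinearMap.congr_fun this x
      simpa [hx] using h2
    · intro z t' a b ha hb
      by_cases h : t' = t
      · subst h; simpa using ha
      · rw [Function.update_comm h] at *; simp [MultilinearMap.map_update_add, ha, hb]
    · intro z t' c a ha
      by_cases h : t' = t
      · subst h; simpa using ha
      · rw [Function.update_comm h] at *; simp [MultilinearMap.map_update_smul, ha]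
  have h1 : ∀ z z' : ∀ t, κ t →₀ k, (∀ t, π t (z t) = π t (z' t)) → Ψ z = Ψ z' := by
    intro z z' hz
    have key : ∀ s : Finset T, Ψ (s.piecewise z' z) = Ψ z := by
      intro s
      induction s using Finset.induction_on with
      | empty => simp
      | insert t s hts ih =>
        rw [← ih, Finset.piecewise_insert]
        have hd := h0 t (z' t - z t) (by rw [map_sub, hz, sub_self]) (s.piecewise z' z)
        rw [MultilinearMap.map_update_sub, sub_eq_zero] at hd
        rw [hd]
        congr 1
        rw [Function.update_eq_self_iff]
        simp [hts]
    simpa using (key Finset.univ).symm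
  let σ : ∀ t, N t → (κ t →₀ k) := fun t => Function.surjInv (hπ t)
  have hσ : ∀ t x, π t (σ t x) = x := fun t x => Function.surjInv_eq (hπ t) x
  have hu : ∀ (z : ∀ t, N t) (t : T) (x : N t) (y : κ t →₀ k), π t y = x →
      Ψ (fun t' => σ t' (Function.update z t x t')) =
        Ψ (Function.update (fun t' => σ t' (z t')) t y) := by
    intro z t x y hy
    apply h1
    intro t'
    by_cases h : t' = t
    · subst h; simp [hσ, hy]
    · simp [h]
  refine ⟨⟨fun v => Ψ (fun t => σ t (v t)), ?_, ?_⟩, ?_⟩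
  · intro inst z t x y
    rw [Subsingleton.elim inst iT]
    rw [hu z t (x + y) (σ t x + σ t y) (by simp [hσ]), hu z t x _ (hσ t x), hu z t y _ (hσ t y),
      MultilinearMap.map_update_add]
  · intro inst z t c x
    rw [Subsingleton.elim inst iT]
    rw [hu z t (c • x) (c • σ t x) (by simp [hσ]), hu z t x _ (hσ t x),
      MultilinearMap.map_update_smul]
  · intro c
    show Ψ _ = _
    rw [← hΨ]
    exact h1 _ _ fun t => by simp [hσ, π]


/-! ### Linear operads and their algebras -/

/-- A (symmetric) linear operad over `k`: a representation `S ↦ P(S)` of the groupoid of finite sets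
and bijections, with an identity in `P([1])` and composition maps
`P(T) ⊗ ⨂_{t ∈ T} P(A t) → P(⨆_{t ∈ T} A t)`, natural in all finite sets involved, associative and
unital. A decomposition `S = ⨆_{t ∈ T} A t` is recorded by the disjoint union `Σ t, A t`. -/
structure Operad (k : Type u) [Field k] where
  /-- The space of operations whose inputs are labelled by `S`. -/
  obj : (S : Type) → [Finite S] → Type u
  [addCommGroup : ∀ (S : Type) [Finite S], AddCommGroup (obj S)]
  [module : ∀ (S : Type) [Finite S], Module k (obj S)]
  /-- Relabelling of the inputs. -/
  map : ∀ {S T : Type} [Finite S] [Finite T], S ≃ T → (obj S →ₗ[k] obj T)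
  map_refl : ∀ {S : Type} [Finite S] (p : obj S), map (Equiv.refl S) p = p
  map_trans : ∀ {S T U : Type} [Finite S] [Finite T] [Finite U] (e : S ≃ T) (f : T ≃ U) (p : obj S),
    map (e.trans f) p = map f (map e p)
  /-- The identity operation. -/
  unit : obj (Fin 1)
  /-- `comp A p q` plugs the operation `q t` into the input `t` of `p`. -/
  comp : ∀ {T : Type} [Finite T] (A : T → Type) [∀ t, Finite (A t)],
    obj T →ₗ[k] MultilinearMap k (fun t => obj (A t)) (obj (Σ t, A t))
  comp_map_left : ∀ {T T' : Type} [Finite T] [Finite T'] (e : T ≃ T') (A : T' → Type)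
    [∀ t, Finite (A t)] (p : obj T) (q : ∀ t, obj (A t)),
    comp A (map e p) q =
      map (Equiv.sigmaCongrLeft e) (comp (fun t => A (e t)) p (fun t => q (e t)))
  comp_map_right : ∀ {T : Type} [Finite T] (A B : T → Type) [∀ t, Finite (A t)] [∀ t, Finite (B t)]
    (e : ∀ t, A t ≃ B t) (p : obj T) (q : ∀ t, obj (A t)),
    comp B p (fun t => map (e t) (q t)) = map (Equiv.sigmaCongrRight e) (comp A p q)
  comp_assoc : ∀ {T : Type} [Finite T] (A : T → Type) [∀ t, Finite (A t)]
    (B : ∀ t, A t → Type) [∀ t s, Finite (B t s)]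
    (p : obj T) (q : ∀ t, obj (A t)) (r : ∀ t s, obj (B t s)),
    map (Equiv.sigmaAssoc B) (comp (fun x : Σ t, A t => B x.1 x.2) (comp A p q)
      (fun x => r x.1 x.2)) =
      comp (fun t => Σ s, B t s) p (fun t => comp (B t) (q t) (r t))
  unit_comp : ∀ {S : Type} [Finite S] (p : obj S),
    map (Equiv.uniqueSigma (fun _ : Fin 1 => S)) (comp (fun _ : Fin 1 => S) unit (fun _ => p)) = p
  comp_unit : ∀ {S : Type} [Finite S] (p : obj S),
    map (Equiv.sigmaUnique S (fun _ => Fin 1)) (comp (fun _ : S => Fin 1) p (fun _ => unit)) = p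

attribute [instance] Operad.addCommGroup Operad.module

namespace Operad

variable {k : Type u} [Field k] (P : Operad k)

/-- The structure of an algebra over the operad `P` on the vector space `A`: each `p ∈ P(T)` gives
a multilinear operation `p(a_t)_{t ∈ T}` on `A`. -/
structure Algebra (A : Type u) [AddCommGroup A] [Module k A] where
  /-- The action of operations. -/
  act : ∀ {T : Type} [Finite T], P.obj T →ₗ[k] MultilinearMap k (fun _ : T => A) A
  act_map : ∀ {T T' : Type} [Finite T] [Finite T'] (e : T ≃ T') (p : P.obj T) (a : T' → A),
    act (P.map e p) a = act p (fun t => a (e t))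
  act_unit : ∀ a : Fin 1 → A, act P.unit a = a 0
  act_comp : ∀ {T : Type} [Finite T] (A' : T → Type) [∀ t, Finite (A' t)] (p : P.obj T)
    (q : ∀ t, P.obj (A' t)) (a : (Σ t, A' t) → A),
    act (P.comp A' p q) a = act p (fun t => act (q t) (fun s => a ⟨t, s⟩))

/-! ### Free algebras -/

/-- The action of the symmetric group on `P([r])`. -/
def permRep (r : ℕ) : Representation k (Equiv.Perm (Fin r)) (P.obj (Fin r)) where
  toFun σ := P.map σ
  map_one' := LinearMap.ext fun p => P.map_refl p
  map_mul' σ τ := LinearMap.ext fun p => P.map_trans τ σ p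

variable (k) in
/-- The action of the permutations of `ι` on `⨂_{i ∈ ι} E` by permuting the tensor factors. -/
def tensorPermRep (ι E : Type*) [AddCommGroup E] [Module k E] :
    Representation k (Equiv.Perm ι) (⨂[k] _ : ι, E) where
  toFun σ := (PiTensorProduct.reindex k (fun _ : ι => E) σ).toLinearMap
  map_one' := by
    ext a
    simp only [LinearMap.compMultilinearMap_apply, LinearEquiv.coe_coe,
      PiTensorProduct.reindex_tprod]
    rfl
  map_mul' σ τ := by
    ext a
    simp only [LinearMap.compMultilinearMap_apply, LinearEquiv.coe_coe, Module.End.mul_apply,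
      PiTensorProduct.reindex_tprod]
    rfl

variable (E : Type u) [AddCommGroup E] [Module k E]

/-- `P([r]) ⊗_{k[S_r]} E^{⊗ r}`. -/
abbrev FreePart (r : ℕ) : Type u :=
  Representation.Coinvariants ((P.permRep r).tprod (tensorPermRep k (Fin r) E))

/-- The underlying space `P{E} = ⨁_r P([r]) ⊗_{k[S_r]} E^{⊗ r}` of the free `P`-algebra on `E`. -/
abbrev Free : Type u := ⨁ r : ℕ, P.FreePart E r

/-- The class of `p ⊗ a_1 ⊗ ⋯ ⊗ a_r` in `P([r]) ⊗_{k[S_r]} E^{⊗ r}`. -/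
def genPart (r : ℕ) : P.obj (Fin r) →ₗ[k] MultilinearMap k (fun _ : Fin r => E) (P.FreePart E r) where
  toFun p := ((Representation.Coinvariants.mk _) ∘ₗ
    (TensorProduct.mk k (P.obj (Fin r)) (⨂[k] _ : Fin r, E) p)).compMultilinearMap
      (PiTensorProduct.tprod k)
  map_add' p q := by ext; simp
  map_smul' c p := by ext; simp

theorem genPart_map {r : ℕ} (σ : Equiv.Perm (Fin r)) (p : P.obj (Fin r)) (a : Fin r → E) :
    P.genPart E r (P.map σ p) a = P.genPart E r p (fun i => a (σ i)) := by
  have := Representation.Coinvariants.mk_self_apply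
    ((P.permRep r).tprod (tensorPermRep k (Fin r) E)) σ
    (p ⊗ₜ[k] PiTensorProduct.tprod k (fun i => a (σ i)))
  rw [Representation.tprod_apply, TensorProduct.map_tmul] at this
  have h : tensorPermRep k (Fin r) E σ (PiTensorProduct.tprod k (fun i => a (σ i))) =
      PiTensorProduct.tprod k a := by
    refine (PiTensorProduct.reindex_tprod σ _).trans ?_
    simp
  rw [h] at this
  exact this

/-- A multilinear, symmetric family of maps factors through `P([r]) ⊗_{k[S_r]} E^{⊗ r}`. -/
theorem exists_lift_part {A : Type*} [AddCommGroup A] [Module k A] (r : ℕ)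
    (φ : P.obj (Fin r) →ₗ[k] MultilinearMap k (fun _ : Fin r => E) A)
    (hφ : ∀ (σ : Equiv.Perm (Fin r)) p a, φ (P.map σ p) a = φ p (fun i => a (σ i))) :
    ∃ L : P.FreePart E r →ₗ[k] A, ∀ p a, L (P.genPart E r p a) = φ p a := by
  refine ⟨Representation.Coinvariants.lift _
    (TensorProduct.lift ((PiTensorProduct.lift (R := k)).toLinearMap ∘ₗ φ)) ?_, ?_⟩
  · intro σ
    ext p a
    simp only [LinearMap.compMultilinearMap_apply, TensorProduct.AlgebraTensorModule.curry_apply,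
      TensorProduct.curry_apply, LinearMap.coe_restrictScalars, LinearMap.comp_apply,
      Representation.tprod_apply, TensorProduct.map_tmul, TensorProduct.lift.tmul,
      LinearEquiv.coe_coe, PiTensorProduct.lift.tprod]
    have h : tensorPermRep k (Fin r) E σ (PiTensorProduct.tprod k a) =
      PiTensorProduct.tprod k (fun i => a (σ.symm i)) := PiTensorProduct.reindex_tprod σ _
    rw [h, PiTensorProduct.lift.tprod]
    exact (hφ σ p _).trans (by simp)
  · intro p a
    exact (Representation.Coinvariants.lift_mk _ _ _ _).trans (by simp)

theorem span_genPart (r : ℕ) : Submodule.span k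
    (Set.range fun c : P.obj (Fin r) × (Fin r → E) => P.genPart E r c.1 c.2) = ⊤ := by
  rw [eq_top_iff]
  rintro x -
  obtain ⟨y, rfl⟩ := Representation.Coinvariants.mk_surjective _ x
  induction y using TensorProduct.induction_on with
  | zero => simp
  | add y z hy hz => rw [map_add]; exact Submodule.add_mem _ hy hz
  | tmul p t =>
    induction t using PiTensorProduct.induction_on with
    | smul_tprod c a =>
      rw [TensorProduct.tmul_smul, map_smul]
      exact Submodule.smul_mem _ _ (Submodule.subset_span ⟨(p, a), rfl⟩)
    | add y z hy hz => rw [TensorProduct.tmul_add, map_add]; exact Submodule.add_mem _ hy hz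

/-- The element `p(a_s)_{s ∈ S}` of the free algebra, for `p ∈ P(S)` and `a : S → E`, obtained by
numbering the elements of `S` (the result does not depend on the numbering, see `gen_map`). -/
def gen {S : Type} [Finite S] (p : P.obj S) : MultilinearMap k (fun _ : S => E) (P.Free E) :=
  ((DirectSum.lof k ℕ (P.FreePart E) (Nat.card S)).compMultilinearMap
    (P.genPart E (Nat.card S) (P.map (Finite.equivFin S) p))).domDomCongr (Finite.equivFin S).symm

theorem lof_genPart_map {m n : ℕ} (e : Fin m ≃ Fin n) (p : P.obj (Fin m)) (a : Fin n → E) :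
    DirectSum.lof k ℕ (P.FreePart E) n (P.genPart E n (P.map e p) a) =
      DirectSum.lof k ℕ (P.FreePart E) m (P.genPart E m p (fun i => a (e i))) := by
  obtain rfl : m = n := by simpa using Fintype.card_congr e
  rw [genPart_map]

theorem gen_apply {S : Type} [Finite S] (p : P.obj S) {n : ℕ} (e : S ≃ Fin n) (a : S → E) :
    P.gen E p a =
      DirectSum.lof k ℕ (P.FreePart E) n (P.genPart E n (P.map e p) (fun i => a (e.symm i))) := by
  have h : P.map e p = P.map ((Finite.equivFin S).symm.trans e) (P.map (Finite.equivFin S) p) := by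
    rw [← P.map_trans]
    congr 2
    ext; simp
  rw [h, lof_genPart_map]
  simp [gen]

theorem gen_map {S S' : Type} [Finite S] [Finite S'] (e : S ≃ S') (p : P.obj S) (a : S' → E) :
    P.gen E (P.map e p) a = P.gen E p (fun s => a (e s)) := by
  rw [P.gen_apply E _ (Finite.equivFin S'), P.gen_apply E p (e.trans (Finite.equivFin S')),
    P.map_trans]
  simp

theorem gen_fin {n : ℕ} (p : P.obj (Fin n)) (a : Fin n → E) :
    P.gen E p a = DirectSum.lof k ℕ (P.FreePart E) n (P.genPart E n p a) := by
  rw [P.gen_apply E p (Equiv.refl _), P.map_refl]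
  rfl

theorem gen_add {S : Type} [Finite S] (p q : P.obj S) (a : S → E) :
    P.gen E (p + q) a = P.gen E p a + P.gen E q a := by
  simp [gen]

theorem gen_smul {S : Type} [Finite S] (c : k) (p : P.obj S) (a : S → E) :
    P.gen E (c • p) a = c • P.gen E p a := by
  simp [gen]

/-- The data of a generator `p(a_1, …, a_r)` of the free algebra. -/
abbrev GenData : Type u := Σ r : ℕ, P.obj (Fin r) × (Fin r → E)

theorem span_gen : Submodule.span k
    (Set.range fun c : P.GenData E => P.gen E c.2.1 c.2.2) = ⊤ := by
  rw [eq_top_iff]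
  rintro x -
  induction x using DirectSum.induction_on with
  | zero => simp
  | add x y hx hy => exact Submodule.add_mem _ hx hy
  | of r x =>
    have hx : x ∈ Submodule.span k
        (Set.range fun c : P.obj (Fin r) × (Fin r → E) => P.genPart E r c.1 c.2) := by
      rw [span_genPart]; trivial
    have := Submodule.mem_map_of_mem (f := DirectSum.lof k ℕ (P.FreePart E) r) hx
    rw [Submodule.map_span] at this
    refine Submodule.span_mono ?_ this
    rintro _ ⟨_, ⟨c, rfl⟩, rfl⟩
    exact ⟨⟨r, c⟩, P.gen_fin E c.1 c.2⟩

instance : Nonempty (P.GenData E) := ⟨⟨0, 0, 0⟩⟩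

theorem exists_act_part {T : Type} [Finite T] (p : P.obj T) (r : T → ℕ) :
    ∃ f : MultilinearMap k (fun t => P.FreePart E (r t)) (P.Free E),
      ∀ (q : ∀ t, P.obj (Fin (r t))) (a : ∀ t, Fin (r t) → E),
        f (fun t => P.genPart E (r t) (q t) (a t)) =
          P.gen E (P.comp (fun t => Fin (r t)) p q) (fun x => a x.1 x.2) := by
  classical
  obtain ⟨f, hf⟩ := exists_multilinear_extension (k := k)
    (κ := fun t => P.obj (Fin (r t)) × (Fin (r t) → E))
    (fun t c => P.genPart E (r t) c.1 c.2) (fun t => P.span_genPart E (r t))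
    (fun c => P.gen E (P.comp (fun t => Fin (r t)) p (fun t => (c t).1))
      (fun x => (c x.1).2 x.2)) (by
    intro c t
    have hq : ∀ (q : P.obj (Fin (r t))) (a : Fin (r t) → E),
        (fun t' => (Function.update c t (q, a) t').1) =
          Function.update (fun t' => (c t').1) t q := by
      intro q a
      ext t'
      by_cases h : t' = t
      · subst h; simp
      · simp [h]
    let ext (a : Fin (r t) → E) : (Σ t, Fin (r t)) → E :=
      fun x => (Function.update (fun t' => (c t').2) t a x.1) x.2
    have ha : ∀ (q : P.obj (Fin (r t))) (a : Fin (r t) → E),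
        (fun x : Σ t, Fin (r t) => (Function.update c t (q, a) x.1).2 x.2) = ext a := by
      intro q a
      ext ⟨t', i⟩
      by_cases h : t' = t
      · subst h; simp [ext]
      · simp [h, ext]
    have hext : ∀ [DecidableEq (Fin (r t))] (a : Fin (r t) → E) i x, ext (Function.update a i x) =
        Function.update (ext a) ⟨t, i⟩ x := by
      intro _ a i x
      ext ⟨t', j⟩
      by_cases h : t' = t
      · subst h
        by_cases hj : j = i
        · subst hj; simp [ext]
        · simp [ext, hj]
      · simp [ext, h]
    let φ : P.obj (Fin (r t)) →ₗ[k] MultilinearMap k (fun _ : Fin (r t) => E) (P.Free E) :=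
      { toFun := fun q =>
          { toFun := fun a => P.gen E (P.comp (fun t => Fin (r t)) p
              (Function.update (fun t' => (c t').1) t q)) (ext a)
            map_update_add' := by intro _ a i x y; simp only [hext, MultilinearMap.map_update_add]
            map_update_smul' := by
              intro _ a i x y; simp only [hext, MultilinearMap.map_update_smul] }
        map_add' := by
          intro q q'; ext a
          simp [MultilinearMap.map_update_add, gen_add]
        map_smul' := by
          intro q q'; ext a
          simp [MultilinearMap.map_update_smul, gen_smul] }
    obtain ⟨L, hL⟩ := P.exists_lift_part E (r t) φ (by
      intro σ q a
      let e : ∀ t', Fin (r t') ≃ Fin (r t') :=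
        Function.update (fun t' => Equiv.refl (Fin (r t'))) t σ
      have h1 : Function.update (fun t' => (c t').1) t (P.map σ q) =
          fun t' => P.map (e t') (Function.update (fun t' => (c t').1) t q t') := by
        ext t'
        by_cases h : t' = t
        · subst h; simp [e]
        · simp [e, h, P.map_refl]
      change P.gen E (P.comp (fun t => Fin (r t)) p
              (Function.update (fun t' => (c t').1) t (P.map σ q))) (ext a) =
        P.gen E (P.comp (fun t => Fin (r t)) p
              (Function.update (fun t' => (c t').1) t q)) (ext fun i => a (σ i))
      rw [h1, P.comp_map_right, gen_map]
      congr 1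
      ext ⟨t', j⟩
      by_cases h : t' = t
      · subst h; simp [ext, e]
      · simp [ext, e, h])
    refine ⟨L, fun j => ?_⟩
    obtain ⟨q, a⟩ := j
    rw [hL, hq, ha]
    rfl)
  exact ⟨f, fun q a => hf (fun t => (q t, a t))⟩

theorem exists_act {T : Type} [Finite T] (p : P.obj T) :
    ∃ f : MultilinearMap k (fun _ : T => P.Free E) (P.Free E), ∀ c : T → P.GenData E,
      f (fun t => P.gen E (c t).2.1 (c t).2.2) =
        P.gen E (P.comp (fun t => Fin (c t).1) p (fun t => (c t).2.1))
          (fun x => (c x.1).2.2 x.2) := by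
  classical
  have := Fintype.ofFinite T
  choose f hf using P.exists_act_part E p
  refine ⟨MultilinearMap.fromDirectSumEquiv (R := k) (κ := fun _ : T => ℕ)
    (M := fun _ r => P.FreePart E r) f, fun c => ?_⟩
  have h : (fun t => P.gen E (c t).2.1 (c t).2.2) = fun t =>
      DirectSum.lof k ℕ (P.FreePart E) (c t).1 (P.genPart E (c t).1 (c t).2.1 (c t).2.2) :=
    funext fun t => P.gen_fin E _ _
  rw [h]
  have h2 := MultilinearMap.fromDirectSumEquiv_lof (R := k) (κ := fun _ : T => ℕ)
    (M := fun _ r => P.FreePart E r) (M' := P.Free E) f (fun t => (c t).1)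
    (fun t => P.genPart E (c t).1 (c t).2.1 (c t).2.2)
  exact h2.trans (hf _ (fun t => (c t).2.1) (fun t => (c t).2.2))

/-- The structure of `P`-algebra on `P{E}`; it is determined by `freeAct_gen`. -/
def freeAct {T : Type} [Finite T] :
    P.obj T →ₗ[k] MultilinearMap k (fun _ : T => P.Free E) (P.Free E) where
  toFun p := Classical.choose (P.exists_act E p)
  map_add' p q := by
    refine multilinear_ext_span (κ := fun _ => P.GenData E) (fun _ c => P.gen E c.2.1 c.2.2)
      (fun _ => P.span_gen E) _ _ fun c => ?_
    rw [add_apply, Classical.choose_spec (P.exists_act E _),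
      Classical.choose_spec (P.exists_act E _), Classical.choose_spec (P.exists_act E _)]
    simp [gen_add]
  map_smul' a p := by
    refine multilinear_ext_span (κ := fun _ => P.GenData E) (fun _ c => P.gen E c.2.1 c.2.2)
      (fun _ => P.span_gen E) _ _ fun c => ?_
    rw [RingHom.id_apply, smul_apply, Classical.choose_spec (P.exists_act E _),
      Classical.choose_spec (P.exists_act E _)]
    simp [gen_smul]

/-- The operations of the free algebra: `p(q_t(a_{t,s})_s)_t = (p ∘ (q_t)_t)(a_{t,s})_{t,s}`. -/
theorem freeAct_gen {T : Type} [Finite T] (S : T → Type) [∀ t, Finite (S t)] (p : P.obj T)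
    (q : ∀ t, P.obj (S t)) (a : ∀ t, S t → E) :
    P.freeAct E p (fun t => P.gen E (q t) (a t)) =
      P.gen E (P.comp S p q) (fun x => a x.1 x.2) := by
  let e : ∀ t, S t ≃ Fin (Nat.card (S t)) := fun t => Finite.equivFin (S t)
  have h := Classical.choose_spec (P.exists_act E p)
    (fun t => ⟨Nat.card (S t), P.map (e t) (q t), fun i => a t ((e t).symm i)⟩)
  simp only [gen_map, Equiv.symm_apply_apply] at h
  refine h.trans ?_
  rw [P.comp_map_right, gen_map]
  congr 1
  ext ⟨t, s⟩
  exact congrArg (a t) ((e t).symm_apply_apply s)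

/-- The free `P`-algebra on the vector space `E`. -/
def free : P.Algebra (P.Free E) where
  act := P.freeAct E
  act_map {T T'} _ _ e p a := by
    classical
    have hu : ∀ (z : T' → P.Free E) (t : T') (x : P.Free E),
        (fun s => Function.update z t x (e s)) =
          Function.update (fun s => z (e s)) (e.symm t) x := by
      intro z t x
      exact Function.update_comp_equiv z e t x
    refine pi_span_induction (k := k) (κ := fun _ => P.GenData E)
      (fun _ c => P.gen E c.2.1 c.2.2) (fun _ => P.span_gen E)
      (fun a => P.freeAct E (P.map e p) a = P.freeAct E p (fun t => a (e t))) ?_ ?_ ?_ a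
    · intro c
      rw [freeAct_gen, freeAct_gen, P.comp_map_left, gen_map]
      rfl
    · intro z t x y hx hy
      simp only [hu] at *
      rw [MultilinearMap.map_update_add, MultilinearMap.map_update_add, hx, hy]
    · intro z t b x hx
      simp only [hu] at *
      rw [MultilinearMap.map_update_smul, MultilinearMap.map_update_smul, hx]
  act_unit a := by
    classical
    refine pi_span_induction (k := k) (κ := fun _ => P.GenData E)
      (fun _ c => P.gen E c.2.1 c.2.2) (fun _ => P.span_gen E)
      (fun a => P.freeAct E P.unit a = a 0) ?_ ?_ ?_ a
    · intro c
      have h : c = fun _ => c 0 := funext fun i => by rw [Subsingleton.elim i 0]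
      rw [h]
      rw [P.freeAct_gen E (fun _ => Fin (c 0).1)]
      have h2 := P.gen_map E (Equiv.uniqueSigma (fun _ : Fin 1 => Fin (c 0).1))
        (P.comp (fun _ => Fin (c 0).1) P.unit (fun _ => (c 0).2.1)) (c 0).2.2
      rw [P.unit_comp] at h2
      refine Eq.trans ?_ h2.symm
      congr 1
      ext ⟨i, j⟩
      obtain rfl := Subsingleton.elim i 0
      rfl
    · intro z t x y hx hy
      rw [Subsingleton.elim t 0] at *
      rw [MultilinearMap.map_update_add, hx, hy]
      simp
    · intro z t b x hx
      rw [Subsingleton.elim t 0] at *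
      rw [MultilinearMap.map_update_smul, hx]
      simp
  act_comp {T} _ S _ p q a := by
    classical
    have hu : ∀ (z : (Σ t, S t) → P.Free E) (x : Σ t, S t) (v : P.Free E),
        (fun t => P.freeAct E (q t) (fun s => Function.update z x v ⟨t, s⟩)) =
          Function.update (fun t => P.freeAct E (q t) (fun s => z ⟨t, s⟩)) x.1
            (P.freeAct E (q x.1) (Function.update (fun s => z ⟨x.1, s⟩) x.2 v)) := by
      rintro z ⟨t, s⟩ v
      ext t' : 1
      by_cases h : t' = t
      · subst h
        simp only [Function.update_self]
        congr 1
        ext s' : 1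
        by_cases hs : s' = s
        · subst hs; simp
        · simp [hs]
      · simp [h]
    refine pi_span_induction (k := k) (κ := fun _ => P.GenData E)
      (fun _ c => P.gen E c.2.1 c.2.2) (fun _ => P.span_gen E)
      (fun a => P.freeAct E (P.comp S p q) a =
        P.freeAct E p (fun t => P.freeAct E (q t) (fun s => a ⟨t, s⟩))) ?_ ?_ ?_ a
    · intro c
      have h1 : ∀ t, P.freeAct E (q t)
          (fun s => P.gen E (c ⟨t, s⟩).2.1 (c ⟨t, s⟩).2.2) = _ := fun t =>
        P.freeAct_gen E (fun s => Fin (c ⟨t, s⟩).1) (q t) _ (fun s => (c ⟨t, s⟩).2.2)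
      simp only [h1]
      rw [P.freeAct_gen E (fun x => Fin (c x).1), P.freeAct_gen E,
        ← P.comp_assoc S (fun t s => Fin (c ⟨t, s⟩).1) p q (fun t s => (c ⟨t, s⟩).2.1), gen_map]
      rfl
    · intro z t x y hx hy
      simp only [hu] at *
      rw [MultilinearMap.map_update_add, MultilinearMap.map_update_add,
        MultilinearMap.map_update_add, hx, hy]
    · intro z t b x hx
      simp only [hu] at *
      rw [MultilinearMap.map_update_smul, MultilinearMap.map_update_smul,
        MultilinearMap.map_update_smul, hx]

/-- The natural map `E → P{E}` given by the identity operation. -/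
def ι : E →ₗ[k] P.Free E where
  toFun a := P.gen E P.unit (fun _ => a)
  map_add' a b := by
    have hu : ∀ a : E, (fun _ : Fin 1 => a) = Function.update (fun _ => 0) 0 a := by
      intro a; ext i : 1; rw [Subsingleton.elim i 0, Function.update_self]
    rw [hu, hu a, hu b, MultilinearMap.map_update_add]
  map_smul' c a := by
    have hu : ∀ a : E, (fun _ : Fin 1 => a) = Function.update (fun _ => 0) 0 a := by
      intro a; ext i : 1; rw [Subsingleton.elim i 0, Function.update_self]
    rw [hu, hu a, MultilinearMap.map_update_smul, RingHom.id_apply]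

theorem gen_eq_act {S : Type} [Finite S] (p : P.obj S) (a : S → E) :
    P.gen E p a = (P.free E).act p (fun s => P.ι E (a s)) := by
  change _ = P.freeAct E p (fun s => P.gen E P.unit (fun _ => a s))
  rw [P.freeAct_gen E (fun _ => Fin 1)]
  nth_rewrite 1 [← P.comp_unit p]
  rw [gen_map]
  rfl

/-! ### Derivations -/

attribute [local instance] LieRing.ofAssociativeRing

/-- The Lie algebra of derivations of a `P`-algebra. -/
def derivations {A : Type u} [AddCommGroup A] [Module k A] (α : P.Algebra A) :
    LieSubalgebra k (Module.End k A) where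
  carrier := {δ | ∀ (r : ℕ) (p : P.obj (Fin r)) (a : Fin r → A),
    δ (α.act p a) = ∑ i, α.act p (Function.update a i (δ (a i)))}
  zero_mem' r p a := by simp
  add_mem' {δ δ'} h h' r p a := by
    simp [h r p a, h' r p a, MultilinearMap.map_update_add, Finset.sum_add_distrib]
  smul_mem' c δ h r p a := by
    simp [h r p a, MultilinearMap.map_update_smul, Finset.smul_sum]
  lie_mem' {δ δ'} h h' r p a := by
    have key : ∀ δ δ' : Module.End k A, (∀ (r : ℕ) (p : P.obj (Fin r)) (a : Fin r → A),
          δ (α.act p a) = ∑ i, α.act p (Function.update a i (δ (a i)))) →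
        (∀ (r : ℕ) (p : P.obj (Fin r)) (a : Fin r → A),
          δ' (α.act p a) = ∑ i, α.act p (Function.update a i (δ' (a i)))) →
        δ (δ' (α.act p a)) = (∑ i, α.act p (Function.update a i (δ (δ' (a i))))) +
          ∑ i, ∑ j, if j = i then 0 else
            α.act p (Function.update (Function.update a i (δ' (a i))) j (δ (a j))) := by
      intro δ δ' h h'
      rw [h', map_sum, ← Finset.sum_add_distrib]
      refine Finset.sum_congr rfl fun i _ => ?_
      rw [h, ← Finset.add_sum_erase _ _ (Finset.mem_univ i)]
      congr 1
      · simp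
      · rw [← Finset.add_sum_erase Finset.univ _ (Finset.mem_univ i), if_pos rfl, zero_add]
        refine Finset.sum_congr rfl fun j hj => ?_
        have hji := Finset.ne_of_mem_erase hj
        simp [hji]
    rw [LieRing.of_associative_ring_bracket, LinearMap.sub_apply, Module.End.mul_apply,
      Module.End.mul_apply, key δ δ' h h', key δ' δ h' h]
    have hsym : (∑ i, ∑ j, if j = i then 0 else
            α.act p (Function.update (Function.update a i (δ' (a i))) j (δ (a j)))) =
        ∑ i, ∑ j, if j = i then 0 else
            α.act p (Function.update (Function.update a i (δ (a i))) j (δ' (a j))) := by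
      rw [Finset.sum_comm]
      refine Finset.sum_congr rfl fun i _ => Finset.sum_congr rfl fun j _ => ?_
      by_cases hij : i = j
      · simp [hij]
      · rw [if_neg hij, if_neg (Ne.symm hij), Function.update_comm hij]
    rw [hsym, add_sub_add_right_eq_sub, ← Finset.sum_sub_distrib]
    refine Finset.sum_congr rfl fun i _ => ?_
    rw [LinearMap.sub_apply, MultilinearMap.map_update_sub]
    rfl

/-- `W = ⋃_n k^n`, with basis `x_0, x_1, …`. -/
abbrev W (_P : Operad k) : Type u := ℕ →₀ k

/-- `V = P{W}`, the free `P`-algebra on countably many generators. -/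
abbrev V : Type u := P.Free P.W

/-- The generators `x_i` of `V`. -/
def x (i : ℕ) : P.V := P.ι P.W (Finsupp.single i 1)

/-- The Lie algebra `h = ⋃_n h_n`. A derivation in `h_n` acts on `V` by killing `x_i` for `i ≥ n`.
Since every element of `V` lies in the subalgebra generated by finitely many of the `x_i`, the union
consists of the derivations of `V` that kill all but finitely many of the generators. -/
def h : LieSubalgebra k (Module.End k P.V) where
  carrier := {δ | δ ∈ P.derivations (P.free P.W) ∧ ∃ n : ℕ, ∀ i, n ≤ i → δ (P.x i) = 0}
  zero_mem' := ⟨zero_mem _, 0, by simp⟩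
  add_mem' := by
    rintro δ δ' ⟨h, n, hn⟩ ⟨h', m, hm⟩
    refine ⟨add_mem h h', max n m, fun i hi => ?_⟩
    rw [LinearMap.add_apply, hn i (le_of_max_le_left hi), hm i (le_of_max_le_right hi), add_zero]
  smul_mem' := by
    rintro c δ ⟨h, n, hn⟩
    refine ⟨Submodule.smul_mem _ c h, n, fun i hi => ?_⟩
    rw [LinearMap.smul_apply, hn i hi, smul_zero]
  lie_mem' := by
    rintro δ δ' ⟨h, n, hn⟩ ⟨h', m, hm⟩
    refine ⟨LieSubalgebra.lie_mem _ h h', max n m, fun i hi => ?_⟩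
    rw [LieRing.of_associative_ring_bracket, LinearMap.sub_apply, Module.End.mul_apply,
      Module.End.mul_apply, hn i (le_of_max_le_left hi), hm i (le_of_max_le_right hi), map_zero,
      map_zero, sub_zero]

instance : LieRing P.h := LieSubalgebra.lieRing k (Module.End k P.V) P.h

instance : LieAlgebra k P.h := LieSubalgebra.lieAlgebra k (Module.End k P.V) P.h

/-- The tautological representation of `h` on `V`. -/
instance : LieRingModule P.h P.V := LieSubalgebra.lieRingModule P.h

instance : LieModule k P.h P.V := LieSubalgebra.lieModule P.h

theorem h_lie_apply (δ : P.h) (v : P.V) : ⁅δ, v⁆ = (δ : Module.End k P.V) v := rfl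

end Operad

/-! ### Tensor powers and Schur functors of representations of Lie algebras -/

section LieTensor

attribute [local instance] LieRing.ofAssociativeRing

variable {k L M ι : Type*} [Field k] [LieRing L] [LieAlgebra k L] [AddCommGroup M] [Module k M]
  [LieRingModule L M] [LieModule k L M] [Fintype ι] [DecidableEq ι]

variable (k ι) in
/-- The endomorphism `∑ i, 1 ⊗ ⋯ ⊗ f ⊗ ⋯ ⊗ 1` (with `f` in position `i`) of `⨂_{i ∈ ι} M`. -/
def tensorDer (f : Module.End k M) : Module.End k (⨂[k] _ : ι, M) :=
  ∑ i, PiTensorProduct.map (Pi.mulSingle i f)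

theorem tensorDer_tprod (f : Module.End k M) (v : ι → M) :
    tensorDer k ι f (PiTensorProduct.tprod k v) =
      ∑ i, PiTensorProduct.tprod k (Function.update v i (f (v i))) := by
  rw [tensorDer, LinearMap.sum_apply]
  refine Finset.sum_congr rfl fun i _ => ?_
  rw [PiTensorProduct.map_tprod]
  congr 1
  ext j
  by_cases h : j = i
  · subst h; simp
  · simp [h]

theorem tensorDer_add (f g : Module.End k M) :
    tensorDer k ι (f + g) = tensorDer k ι f + tensorDer k ι g := by
  ext v
  simp [tensorDer_tprod, MultilinearMap.map_update_add, Finset.sum_add_distrib]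

theorem tensorDer_smul (c : k) (f : Module.End k M) :
    tensorDer k ι (c • f) = c • tensorDer k ι f := by
  ext v
  simp [tensorDer_tprod, MultilinearMap.map_update_smul, Finset.smul_sum]

theorem tensorDer_comm (f g : Module.End k M) :
    tensorDer k ι (f * g - g * f) =
      tensorDer k ι f * tensorDer k ι g - tensorDer k ι g * tensorDer k ι f := by
  have hs : tensorDer k ι (f * g - g * f) = tensorDer k ι (f * g) - tensorDer k ι (g * f) := by
    rw [eq_sub_iff_add_eq, ← tensorDer_add, sub_add_cancel]
  have key : ∀ f g : Module.End k M, tensorDer k ι f * tensorDer k ι g = tensorDer k ι (f * g) +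
      ∑ i, ∑ j, if i = j then 0 else
        PiTensorProduct.map (Pi.mulSingle i f * Pi.mulSingle j g : ι → Module.End k M) := by
    intro f g
    simp only [tensorDer]
    rw [Finset.sum_mul_sum, ← Finset.sum_add_distrib]
    refine Finset.sum_congr rfl fun i _ => ?_
    rw [← Finset.add_sum_erase _ _ (Finset.mem_univ i)]
    congr 1
    · rw [← PiTensorProduct.map_mul, Pi.mulSingle_mul]
      rfl
    · rw [← Finset.add_sum_erase Finset.univ _ (Finset.mem_univ i), if_pos rfl, zero_add]
      refine Finset.sum_congr rfl fun j hj => ?_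
      rw [if_neg (Finset.ne_of_mem_erase hj).symm, ← PiTensorProduct.map_mul]
      rfl
  rw [hs, key f g, key g f]
  have : ∀ i j : ι, (if j = i then (0 : Module.End k (⨂[k] _ : ι, M)) else
        PiTensorProduct.map (Pi.mulSingle j g * Pi.mulSingle i f : ι → Module.End k M)) =
      if i = j then 0 else
        PiTensorProduct.map (Pi.mulSingle i f * Pi.mulSingle j g : ι → Module.End k M) := by
    intro i j
    by_cases h : i = j
    · simp [h]
    · rw [if_neg h, if_neg (Ne.symm h)]
      congr 1
      exact ((Pi.mulSingle_commute (f := fun _ : ι => Module.End k M) h) f g).eq.symm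
  have hswap : (∑ i, ∑ j, if i = j then (0 : Module.End k (⨂[k] _ : ι, M)) else
        PiTensorProduct.map (Pi.mulSingle i g * Pi.mulSingle j f : ι → Module.End k M)) =
      ∑ i, ∑ j, if i = j then 0 else
        PiTensorProduct.map (Pi.mulSingle i f * Pi.mulSingle j g : ι → Module.End k M) := by
    rw [Finset.sum_comm]
    exact Finset.sum_congr rfl fun i _ => Finset.sum_congr rfl fun j _ => this i j
  rw [hswap]
  abel

/-- The representation of `L` on the tensor power `⨂_{i ∈ ι} M` of a representation `M`:
`x (⨂ v_i) = ∑_i v_1 ⊗ ⋯ ⊗ x v_i ⊗ ⋯`. -/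
instance tensorLieRingModule : LieRingModule L (⨂[k] _ : ι, M) where
  bracket x t := tensorDer k ι (LieModule.toEnd k L M x) t
  add_lie x y t := by rw [map_add, tensorDer_add, LinearMap.add_apply]
  lie_add x s t := map_add _ s t
  leibniz_lie x y t := by
    rw [LieHom.map_lie, LieRing.of_associative_ring_bracket, tensorDer_comm, LinearMap.sub_apply,
      Module.End.mul_apply, Module.End.mul_apply]
    abel

instance tensorLieModule : LieModule k L (⨂[k] _ : ι, M) where
  smul_lie c x t := by
    change tensorDer k ι (LieModule.toEnd k L M (c • x)) t = _
    rw [map_smul, tensorDer_smul, LinearMap.smul_apply]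
    rfl
  lie_smul c x t := map_smul _ c t

theorem lie_tprod (x : L) (v : ι → M) : ⁅x, PiTensorProduct.tprod k v⁆ =
    ∑ i, PiTensorProduct.tprod k (Function.update v i ⁅x, v i⁆) :=
  tensorDer_tprod _ _

theorem lie_tensorPermRep (σ : Equiv.Perm ι) (x : L) (t : ⨂[k] _ : ι, M) :
    Operad.tensorPermRep k ι M σ ⁅x, t⁆ = ⁅x, Operad.tensorPermRep k ι M σ t⁆ := by
  have hσ : ∀ v : ι → M, Operad.tensorPermRep k ι M σ (PiTensorProduct.tprod k v) =
      PiTensorProduct.tprod k (fun i => v (σ.symm i)) := fun v => PiTensorProduct.reindex_tprod σ v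
  induction t using PiTensorProduct.induction_on with
  | smul_tprod c v =>
    rw [lie_smul, map_smul, map_smul, lie_smul, hσ, lie_tprod, lie_tprod, map_sum]
    congr 1
    refine Fintype.sum_equiv σ _ _ fun i => ?_
    rw [hσ]
    congr 1
    ext j
    by_cases h : j = σ i
    · subst h
      simp only [Function.update_self, Equiv.symm_apply_apply]
      exact congrArg (fun j => ⁅x, v j⁆) (σ.symm_apply_apply i).symm
    · rw [Function.update_of_ne h, Function.update_of_ne]
      rintro rfl
      simp at h
  | add s t hs ht => simp only [lie_add, map_add, hs, ht]

end LieTensor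

section Schur

variable (k L M : Type*) [Field k] [LieRing L] [LieAlgebra k L] [AddCommGroup M] [Module k M]
  [LieRingModule L M] [LieModule k L M]

/-- The Young symmetrizer of `μ` as an endomorphism of `M^{⊗ |μ|}` (with the tensor factors labelled
by the cells of `μ`): the sum of all permutations of the cells preserving the rows, times the signed
sum of all permutations preserving the columns. -/
def youngSymmetrizer (μ : YoungDiagram) : (⨂[k] _ : μ.cells, M) →ₗ⁅k, L⁆ (⨂[k] _ : μ.cells, M) where
  toLinearMap :=
    (∑ σ : Equiv.Perm μ.cells with ∀ c, (σ c).1.1 = c.1.1, Operad.tensorPermRep k μ.cells M σ) ∘ₗ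
    (∑ τ : Equiv.Perm μ.cells with ∀ c, (τ c).1.2 = c.1.2,
      (Equiv.Perm.sign τ : ℤ) • Operad.tensorPermRep k μ.cells M τ)
  map_lie' {x t} := by
    simp [lie_tensorPermRep, lie_sum]

/-- The Schur functor `S_μ` applied to a representation `M`: the image of the Young symmetrizer. -/
abbrev schur (μ : YoungDiagram) : LieSubmodule k L (⨂[k] _ : μ.cells, M) :=
  (youngSymmetrizer k L M μ).range

end Schur

/-! ### Polynomial representations -/

namespace Operad

variable {k : Type u} [Field k] (P : Operad k)

/-- A representation of `h` is polynomial if it is a subquotient of a direct sum of tensor powers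
of `V`, that is, a quotient of a subrepresentation of such a direct sum. -/
def IsPolynomial (M : Type u) [AddCommGroup M] [Module k M] [LieRingModule P.h M]
    [LieModule k P.h M] : Prop :=
  ∃ (I : Type u) (d : I → ℕ) (A : LieSubmodule k P.h (⨁ i : I, ⨂[k] _ : Fin (d i), P.V))
    (f : A →ₗ⁅k, P.h⁆ M), Function.Surjective f

/-- Simple objects of the category of polynomial representations of `h`. (Subrepresentations of
polynomial representations are polynomial, so the subobjects are all the subrepresentations.) -/
def IsSimplePolynomial (M : Type u) [AddCommGroup M] [Module k M] [LieRingModule P.h M]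
    [LieModule k P.h M] : Prop :=
  P.IsPolynomial M ∧ LieModule.IsIrreducible k P.h M

/-- Projective objects of the category of polynomial representations of `h`. -/
def IsProjectivePolynomial (M : Type u) [AddCommGroup M] [Module k M] [LieRingModule P.h M]
    [LieModule k P.h M] : Prop :=
  P.IsPolynomial M ∧
    ∀ (X Y : Type u) [AddCommGroup X] [Module k X] [LieRingModule P.h X] [LieModule k P.h X]
      [AddCommGroup Y] [Module k Y] [LieRingModule P.h Y] [LieModule k P.h Y],
      P.IsPolynomial X → P.IsPolynomial Y →
      ∀ (g : X →ₗ⁅k, P.h⁆ Y) (f : M →ₗ⁅k, P.h⁆ Y), Function.Surjective g →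
        ∃ f' : M →ₗ⁅k, P.h⁆ X, ∀ m, g (f' m) = f m

/-- A representation of `h` is indecomposable if it is nonzero and not the direct sum of two nonzero
subrepresentations. -/
def IsIndecomposable (M : Type u) [AddCommGroup M] [Module k M] [LieRingModule P.h M]
    [LieModule k P.h M] : Prop :=
  Nontrivial M ∧ ∀ A B : LieSubmodule k P.h M, IsCompl A B → A = ⊥ ∨ B = ⊥

/-! ### The standard representation `W`, when `P([0]) = 0` and `P([1]) = k` -/

variable {P}

theorem unit_ne_zero (h1 : Module.finrank k (P.obj (Fin 1)) = 1) : P.unit ≠ 0 := by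
  intro h0
  have hz : ∀ p : P.obj (Fin 1), p = 0 := by
    intro p
    have h := P.unit_comp p
    rw [h0] at h
    simpa using h.symm
  have : Subsingleton (P.obj (Fin 1)) := ⟨fun a b => by rw [hz a, hz b]⟩
  rw [Module.finrank_zero_of_subsingleton] at h1
  exact zero_ne_one h1

/-- The identification `P([1]) = k` under which the identity operation corresponds to `1`. -/
def coord (h1 : Module.finrank k (P.obj (Fin 1)) = 1) : P.obj (Fin 1) ≃ₗ[k] k :=
  (LinearEquiv.ofBijective (LinearMap.toSpanSingleton k _ P.unit)
    ⟨smul_left_injective k (unit_ne_zero h1),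
      fun p => (finrank_eq_one_iff_of_nonzero' P.unit (unit_ne_zero h1)).1 h1 p⟩).symm

theorem coord_smul_unit (h1 : Module.finrank k (P.obj (Fin 1)) = 1) (p : P.obj (Fin 1)) :
    coord h1 p • P.unit = p :=
  LinearEquiv.apply_symm_apply (LinearEquiv.ofBijective (LinearMap.toSpanSingleton k _ P.unit)
    ⟨smul_left_injective k (unit_ne_zero h1),
      fun p => (finrank_eq_one_iff_of_nonzero' P.unit (unit_ne_zero h1)).1 h1 p⟩) p

theorem coord_unit (h1 : Module.finrank k (P.obj (Fin 1)) = 1) : coord h1 P.unit = 1 :=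
  smul_left_injective k (unit_ne_zero h1) (by simp [coord_smul_unit])

theorem exists_linearPart (h1 : Module.finrank k (P.obj (Fin 1)) = 1) :
    ∃ L : P.FreePart P.W 1 →ₗ[k] P.W, ∀ p a, L (P.genPart P.W 1 p a) = coord h1 p • a 0 :=
  P.exists_lift_part P.W 1
    { toFun := fun p => MultilinearMap.ofSubsingleton k P.W P.W (0 : Fin 1)
        (coord h1 p • LinearMap.id)
      map_add' := by intro p q; ext a : 1; simp [add_smul]
      map_smul' := by intro c p; ext a : 1; simp [mul_smul] }
    (by
      intro σ p a
      rw [Subsingleton.elim σ (Equiv.refl _), P.map_refl]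
      rfl)

/-- The projection of `V` onto its component `P([1]) ⊗ W = W`. -/
def linearPart (h1 : Module.finrank k (P.obj (Fin 1)) = 1) : P.V →ₗ[k] P.W :=
  Classical.choose (exists_linearPart h1) ∘ₗ DirectSum.component k ℕ (P.FreePart P.W) 1

theorem linearPart_gen_one (h1 : Module.finrank k (P.obj (Fin 1)) = 1) (p : P.obj (Fin 1))
    (a : Fin 1 → P.W) : linearPart h1 (P.gen P.W p a) = coord h1 p • a 0 := by
  rw [gen_fin, linearPart, LinearMap.comp_apply, DirectSum.component.lof_self]
  exact Classical.choose_spec (exists_linearPart h1) p a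

theorem linearPart_gen_of_ne (h1 : Module.finrank k (P.obj (Fin 1)) = 1) {S : Type} [Finite S]
    (hS : Nat.card S ≠ 1) (p : P.obj S) (a : S → P.W) : linearPart h1 (P.gen P.W p a) = 0 := by
  rw [P.gen_apply P.W p (Finite.equivFin S), linearPart, LinearMap.comp_apply,
    DirectSum.component.of, dif_neg hS, map_zero]

theorem gen_one (h1 : Module.finrank k (P.obj (Fin 1)) = 1) (p : P.obj (Fin 1))
    (a : Fin 1 → P.W) : P.gen P.W p a = P.ι P.W (coord h1 p • a 0) := by
  obtain ⟨w, rfl⟩ : ∃ w, a = fun _ => w :=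
    ⟨a 0, funext fun i => congrArg a (Subsingleton.elim i 0)⟩
  have h2 := P.gen_smul P.W (coord h1 p) P.unit (fun _ => w)
  rw [coord_smul_unit] at h2
  rw [map_smul]
  exact h2

theorem linearPart_ι (h1 : Module.finrank k (P.obj (Fin 1)) = 1) (w : P.W) :
    linearPart h1 (P.ι P.W w) = w :=
  (linearPart_gen_one h1 P.unit fun _ => w).trans (by rw [coord_unit, one_smul])

theorem linearPart_act (h0 : Subsingleton (P.obj (Fin 0)))
    (h1 : Module.finrank k (P.obj (Fin 1)) = 1) {r : ℕ} (hr : r ≠ 1) (p : P.obj (Fin r))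
    (v : Fin r → P.V) : linearPart h1 ((P.free P.W).act p v) = 0 := by
  refine pi_span_induction (k := k) (κ := fun _ => P.GenData P.W)
      (fun _ c => P.gen P.W c.2.1 c.2.2) (fun _ => P.span_gen P.W)
      (fun v => linearPart h1 (P.freeAct P.W p v) = 0) ?_ ?_ ?_ v
  · intro c
    rw [P.freeAct_gen P.W (fun t => Fin (c t).1)]
    by_cases hc : ∃ t, (c t).1 = 0
    · obtain ⟨t, ht⟩ := hc
      have hz : (c t).2.1 = 0 := by
        have : ∀ n : ℕ, n = 0 → ∀ q : P.obj (Fin n), q = 0 := by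
          rintro n rfl q; exact Subsingleton.elim _ _
        exact this _ ht _
      rw [(P.comp (fun t => Fin (c t).1) p).map_coord_zero (m := fun t => (c t).2.1) t hz]
      have h2 := P.gen_smul P.W (0 : k) (0 : P.obj (Σ t, Fin (c t).1)) (fun x => (c x.1).2.2 x.2)
      rw [zero_smul, zero_smul] at h2
      rw [h2, map_zero]
    · push Not at hc
      apply linearPart_gen_of_ne
      rw [Nat.card_eq_fintype_card, Fintype.card_sigma]
      simp only [Fintype.card_fin]
      intro h
      have h3 : r ≤ ∑ t, (c t).1 := by
        calc r = ∑ t : Fin r, 1 := by simp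
          _ ≤ _ := Finset.sum_le_sum fun t _ => Nat.one_le_iff_ne_zero.2 (hc t)
      have : r = 0 := by omega
      subst this
      simp at h
  · intro z t x y hx hy
    rw [MultilinearMap.map_update_add, map_add, hx, hy, add_zero]
  · intro z t b x hx
    rw [MultilinearMap.map_update_smul, map_smul, hx, smul_zero]

theorem linearPart_derivation (h0 : Subsingleton (P.obj (Fin 0)))
    (h1 : Module.finrank k (P.obj (Fin 1)) = 1) (δ : P.h) (v : P.V) :
    linearPart h1 ⁅δ, v⁆ = linearPart h1 ⁅δ, P.ι P.W (linearPart h1 v)⁆ := by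
  have hv : v ∈ Submodule.span k
      (Set.range fun c : P.GenData P.W => P.gen P.W c.2.1 c.2.2) := by
    rw [span_gen]; trivial
  induction hv using Submodule.span_induction with
  | mem v hv =>
    obtain ⟨⟨r, p, a⟩, rfl⟩ := hv
    dsimp only
    by_cases hr : r = 1
    · subst hr
      rw [linearPart_gen_one]
      rw [gen_one h1]
    · rw [linearPart_gen_of_ne h1 (by simpa using hr), map_zero, lie_zero, map_zero, gen_eq_act,
        h_lie_apply, δ.2.1 r p, map_sum]
      exact Finset.sum_eq_zero fun i _ => linearPart_act h0 h1 hr p _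
  | zero => simp
  | add x y _ _ hx hy => simp only [lie_add, map_add, hx, hy]
  | smul c x _ hx => simp only [lie_smul, map_smul, hx]

variable (P) in
/-- The space `W` as a representation of `h`, when `P([0]) = 0` and `P([1]) = k`: an element
`δ ∈ h` acts through its degree `0` part, that is, by `W → V → V → W` where the middle map is `δ`
and the last one is the projection onto the degree `1` component of `V`. This is the standard
representation of `gl`, inflated along the quotient `h → gl` by the elements of positive degree. -/
def StdRep (_h0 : Subsingleton (P.obj (Fin 0))) (_h1 : Module.finrank k (P.obj (Fin 1)) = 1) :
    Type u := P.W

variable (h0 : Subsingleton (P.obj (Fin 0))) (h1 : Module.finrank k (P.obj (Fin 1)) = 1)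

instance : AddCommGroup (P.StdRep h0 h1) := inferInstanceAs (AddCommGroup P.W)

instance : Module k (P.StdRep h0 h1) := inferInstanceAs (Module k P.W)

instance : LieRingModule P.h (P.StdRep h0 h1) where
  bracket δ w := linearPart h1 ⁅δ, P.ι P.W w⁆
  add_lie δ δ' w := by rw [add_lie, map_add]; rfl
  lie_add δ w w' := by
    refine (congrArg (fun v => linearPart h1 ⁅δ, v⁆) (map_add (P.ι P.W) w w')).trans ?_
    rw [lie_add, map_add]
    rfl
  leibniz_lie δ δ' w := by
    have h := linearPart_derivation h0 h1 δ ⁅δ', P.ι P.W w⁆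
    have h' := linearPart_derivation h0 h1 δ' ⁅δ, P.ι P.W w⁆
    refine h.symm.trans ?_
    rw [leibniz_lie, map_add, h']
    rfl

instance : LieModule k P.h (P.StdRep h0 h1) where
  smul_lie c δ w := (congrArg (linearPart h1) (smul_lie c δ (P.ι P.W w))).trans (map_smul _ _ _)
  lie_smul c δ w := by
    refine (congrArg (fun v => linearPart h1 ⁅δ, v⁆) (map_smul (P.ι P.W) c w)).trans ?_
    rw [lie_smul, map_smul]
    rfl

end Operad

end

end OperadRep

/-! The argument rests on weights for the commuting Euler derivations `x_i ∂/∂x_i`. Every polynomial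
representation is a sum of weight spaces whose weights are finitely supported functions `ℕ → ℕ`, and
weight vectors lift along surjections (`IsGoodModule.exists_lift`). Call a weight vector multilinear
if its weight takes only the values 0 and 1. Polarisation by the operators `x_j ∂/∂x_i` shows that
every nonzero polynomial representation contains a nonzero multilinear vector
(`IsGoodModule.exists_multilinear`).

For distinct `j_1, …, j_n` the tensor `x_{j_1} ⊗ ⋯ ⊗ x_{j_n}` generates `V^{⊗n}`
(`eq_top_of_tensorGen_mem`), and it can be sent to any vector of its weight in any polynomial `M`
(`IsPolynomial.exists_hom`). So `Hom(V^{⊗n}, M)` is a multilinear weight space of `M`, an exact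
functor of `M`. Hence the tensor powers of `V` are projective, and every polynomial representation
is a quotient of a direct sum of them. Up to this point nothing is assumed of `P([0])` and `P([1])`.

The two assumptions enter by counting degrees. If `P([0]) = 0` there are no nonzero maps `V^{⊗n} →
V^{⊗m}` for `m > n` (`eq_zero_of_card_lt`), and if moreover `P([1]) = k` then `End(V^{⊗n}) = k[S_n]`
(`exists_eq_permHom`). Young's theory then applies: with `e` the Young symmetrizer of `μ`, one has
`e k[S_n] e = k e`, and the two-sided ideals generated by the Young symmetrizers span `k[S_n]`.

Projectives: `S_μ(V)` is a direct summand of a tensor power with `End = k`, so it is projective and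
indecomposable. Conversely, an indecomposable projective `M` is a summand of a sum of tensor powers.
Looking at its multilinear vectors of smallest size `n` gives an endomorphism of `V^{⊗n}` through
`M` which is a nonzero element of `k[S_n]`. Some Young symmetrizer detects it, so the identity of
`S_μ(V)` factors, up to a nonzero scalar, through `M`.

Simples: the multilinear vectors of `S_μ(W)` all have size `|μ|`, and each nonzero one generates
`S_μ(W)`, so `S_μ(W)` is simple. Any simple `M` receives a nonzero map from some `S_μ(V)`. The
kernel of `S_μ(V) → S_μ(W)` has no nonzero multilinear vectors of size `|μ|`, so this map factors
through `S_μ(W)`, and Schur's lemma concludes. -/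

namespace OperadRep

noncomputable section

/-! ### Combinatorics of Young tableaux -/

namespace YoungTableau

open Equiv

/-- The sum of the row indices of the cells of a diagram. -/
def rowIndexSum (μ : YoungDiagram) : ℕ := ∑ c ∈ μ.cells, c.1

variable {X : Type*} [Fintype X] {μ ν : YoungDiagram}

/-- Weigh a cell by its row index minus the length of its column in `ν`; this is negative exactly on
`ν`. The cells (row in `T`, column in `T'`) are distinct, have the same column indices as the cells
of `ν`, and have total row index at most that of `ν`. So their total weight is at most that of `ν`,
which forces them to fill `ν`. Comparing `rowIndexSum` plays the role of the dominance order. -/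
theorem row_col_mem (T : X ≃ μ.cells) (T' : X ≃ ν.cells) (hn : rowIndexSum μ ≤ rowIndexSum ν)
    (hinj : ∀ x y, (T x).1.1 = (T y).1.1 → (T' x).1.2 = (T' y).1.2 → x = y) (x : X) :
    ((T x).1.1, (T' x).1.2) ∈ ν.cells := by
  let φ : X → ℕ × ℕ := fun x => ((T x).1.1, (T' x).1.2)
  have hφ : Function.Injective φ := fun x y h =>
    hinj x y (Prod.ext_iff.1 h).1 (Prod.ext_iff.1 h).2
  let D : Finset (ℕ × ℕ) := Finset.univ.map ⟨φ, hφ⟩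
  let w : ℕ × ℕ → ℤ := fun c => (c.1 : ℤ) - ν.colLen c.2
  have hcell : ∀ {ξ : YoungDiagram} (S : X ≃ ξ.cells) (f : ℕ × ℕ → ℤ),
      ∑ c ∈ ξ.cells, f c = ∑ x, f (S x).1 := by
    intro ξ S f
    rw [← Finset.sum_coe_sort]
    exact (Fintype.sum_equiv S _ _ fun x => rfl).symm
  have hD : ∑ c ∈ D, w c ≤ ∑ c ∈ ν.cells, w c := by
    rw [hcell T' w, Finset.sum_map]
    simp only [w, φ, Function.Embedding.coeFn_mk, Finset.sum_sub_distrib]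
    have h1 := hcell T (fun c => (c.1 : ℤ))
    have h2 := hcell T' (fun c => (c.1 : ℤ))
    rw [← h1, ← h2]
    have : ((∑ c ∈ μ.cells, c.1 : ℕ) : ℤ) ≤ (∑ c ∈ ν.cells, c.1 : ℕ) := by exact_mod_cast hn
    push_cast at this
    linarith
  have h1 : ∑ c ∈ D, w c = ∑ c ∈ D ∩ ν.cells, w c + ∑ c ∈ D \ ν.cells, w c :=
    (Finset.sum_inter_add_sum_sdiff _ _ _).symm
  have h2 : ∑ c ∈ ν.cells, w c = ∑ c ∈ ν.cells ∩ D, w c + ∑ c ∈ ν.cells \ D, w c :=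
    (Finset.sum_inter_add_sum_sdiff _ _ _).symm
  rw [Finset.inter_comm] at h2
  have h3 : 0 ≤ ∑ c ∈ D \ ν.cells, w c := Finset.sum_nonneg fun c hc => by
    have hc := (Finset.mem_sdiff.1 hc).2
    rw [YoungDiagram.mem_cells, show c = (c.1, c.2) from rfl, YoungDiagram.mem_iff_lt_colLen] at hc
    simp only [w]
    omega
  have h4 : ∑ c ∈ ν.cells \ D, w c ≤ ∑ c ∈ ν.cells \ D, (-1 : ℤ) := Finset.sum_le_sum fun c hc => by
    have hc := (Finset.mem_sdiff.1 hc).1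
    rw [YoungDiagram.mem_cells, show c = (c.1, c.2) from rfl, YoungDiagram.mem_iff_lt_colLen] at hc
    simp only [w]
    omega
  rw [Finset.sum_const, nsmul_eq_mul] at h4
  have h5 : (ν.cells \ D).card = 0 := by
    have : (0 : ℤ) ≤ (ν.cells \ D).card := Int.natCast_nonneg _
    have : ((ν.cells \ D).card : ℤ) = 0 := by linarith
    exact_mod_cast this
  have h6 : ν.cells ⊆ D := by
    rwa [Finset.card_eq_zero, Finset.sdiff_eq_empty_iff_subset] at h5
  have h7 : D = ν.cells := by
    refine (Finset.eq_of_subset_of_card_le h6 ?_).symm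
    rw [Finset.card_map, Finset.card_univ, Fintype.card_congr T', Fintype.card_coe]
  have hx : φ x ∈ D := Finset.mem_map_of_mem ⟨φ, hφ⟩ (Finset.mem_univ x)
  have hsub : D ⊆ ν.cells := h7.le
  exact hsub hx

/-- The tableau of shape `ν` which combines the rows of `T` with the columns of `T'`. -/
theorem exists_row_col (T : X ≃ μ.cells) (T' : X ≃ ν.cells) (hn : rowIndexSum μ ≤ rowIndexSum ν)
    (hinj : ∀ x y, (T x).1.1 = (T y).1.1 → (T' x).1.2 = (T' y).1.2 → x = y) :
    ∃ φ : X ≃ ν.cells, ∀ x, (φ x).1 = ((T x).1.1, (T' x).1.2) := by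
  let φ : X → ν.cells := fun x => ⟨_, row_col_mem T T' hn hinj x⟩
  have hφ : Function.Injective φ := fun x y h =>
    hinj x y (congrArg (fun c => c.1.1) h) (congrArg (fun c => c.1.2) h)
  exact ⟨Equiv.ofBijective φ ((Fintype.bijective_iff_injective_and_card φ).2
    ⟨hφ, Fintype.card_congr T'⟩), fun x => rfl⟩

theorem card_row (T : X ≃ μ.cells) (i : ℕ) :
    (Finset.univ.filter fun x => (T x).1.1 = i).card = μ.rowLen i := by
  rw [YoungDiagram.rowLen_eq_card, YoungDiagram.row]
  refine Finset.card_bij (fun x _ => (T x).1) ?_ ?_ ?_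
  · intro x hx
    exact Finset.mem_filter.2 ⟨(T x).2, (Finset.mem_filter.1 hx).2⟩
  · intro x _ y _ h
    exact T.injective (Subtype.ext h)
  · intro c hc
    rw [Finset.mem_filter] at hc
    exact ⟨T.symm ⟨c, hc.1⟩, by simpa using hc.2, by simp⟩

/-- The combined tableau of shape `ν` has the same rows as `T`, so the row lengths of `μ` and `ν`
agree. -/
theorem eq_of_row_col_injective (T : X ≃ μ.cells) (T' : X ≃ ν.cells)
    (hn : rowIndexSum μ ≤ rowIndexSum ν)
    (hinj : ∀ x y, (T x).1.1 = (T y).1.1 → (T' x).1.2 = (T' y).1.2 → x = y) : μ = ν := by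
  obtain ⟨φ, hφ⟩ := exists_row_col T T' hn hinj
  have h : ∀ i, μ.rowLen i = ν.rowLen i := fun i => by
    rw [← card_row T, ← card_row φ]
    simp [hφ]
  ext ⟨i, j⟩
  rw [YoungDiagram.mem_cells, YoungDiagram.mem_cells, YoungDiagram.mem_iff_lt_rowLen,
    YoungDiagram.mem_iff_lt_rowLen, h]

/-! ### Young symmetrizers in the group algebra -/

variable (k : Type*) [Field k] [DecidableEq X]

/-- The sum of the permutations preserving the rows of a tableau. -/
def rowSum (T : X ≃ μ.cells) : MonoidAlgebra k (Perm X) :=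
  ∑ σ : Perm X with ∀ x, (T (σ x)).1.1 = (T x).1.1, MonoidAlgebra.of k _ σ

/-- The signed sum of the permutations preserving the columns of a tableau. -/
def colSum (T : X ≃ μ.cells) : MonoidAlgebra k (Perm X) :=
  ∑ σ : Perm X with ∀ x, (T (σ x)).1.2 = (T x).1.2, (Perm.sign σ : ℤ) • MonoidAlgebra.of k _ σ

/-- The Young symmetrizer of a tableau. -/
def symmetrizer (T : X ≃ μ.cells) : MonoidAlgebra k (Perm X) := rowSum k T * colSum k T

variable {k}

theorem perm_apply_inv {X : Type*} (σ : Perm X) (x : X) : σ (σ⁻¹ x) = x := σ.apply_symm_apply x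

theorem rowSum_mul_of (T : X ≃ μ.cells) {σ : Perm X} (hσ : ∀ x, (T (σ x)).1.1 = (T x).1.1) :
    rowSum k T * MonoidAlgebra.of k _ σ = rowSum k T := by
  rw [rowSum, Finset.sum_mul]
  refine Finset.sum_equiv (Equiv.mulRight σ) ?_ ?_
  · intro τ
    simp only [Finset.mem_filter, Finset.mem_univ, true_and, Equiv.coe_mulRight, Perm.mul_apply]
    refine ⟨fun h x => by rw [h, hσ], fun h x => ?_⟩
    have h1 := h (σ⁻¹ x)
    have h2 := hσ (σ⁻¹ x)
    rw [perm_apply_inv] at h1 h2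
    rw [h1, h2]
  · intro τ _
    rw [← map_mul]
    rfl

theorem sign_smul_sign_smul {M : Type*} [AddCommGroup M] (σ : Perm X) (m : M) :
    (Perm.sign σ : ℤ) • (Perm.sign σ : ℤ) • m = m := by
  rw [smul_smul, ← Units.val_mul, Int.units_mul_self, Units.val_one, one_smul]

theorem of_mul_colSum (T : X ≃ μ.cells) {σ : Perm X} (hσ : ∀ x, (T (σ x)).1.2 = (T x).1.2) :
    MonoidAlgebra.of k _ σ * colSum k T = (Perm.sign σ : ℤ) • colSum k T := by
  rw [colSum, Finset.mul_sum, Finset.smul_sum]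
  refine Finset.sum_equiv (Equiv.mulLeft σ) ?_ ?_
  · intro τ
    simp only [Finset.mem_filter, Finset.mem_univ, true_and, Equiv.coe_mulLeft, Perm.mul_apply, hσ]
  · intro τ _
    rw [mul_smul_comm, ← map_mul, Equiv.coe_mulLeft, Perm.sign_mul, Units.val_mul, mul_smul,
      sign_smul_sign_smul]

variable [CharZero k]

/-- The transposition of `x` and `y` is absorbed by the row sum. Moved past `σ` it becomes a column
transposition of `T'`, which the column sum turns into a sign. The product is thus its own negative.
-/
theorem rowSum_mul_of_mul_colSum_eq_zero (T : X ≃ μ.cells) (T' : X ≃ ν.cells) (σ : Perm X)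
    {x y : X} (hxy : x ≠ y) (h1 : (T x).1.1 = (T y).1.1)
    (h2 : (T' (σ⁻¹ x)).1.2 = (T' (σ⁻¹ y)).1.2) :
    rowSum k T * MonoidAlgebra.of k _ σ * colSum k T' = 0 := by
  have hr : ∀ z, (T (swap x y z)).1.1 = (T z).1.1 := by
    intro z
    rcases eq_or_ne z x with rfl | hx
    · rw [swap_apply_left, h1]
    rcases eq_or_ne z y with rfl | hy
    · rw [swap_apply_right, h1]
    rw [swap_apply_of_ne_of_ne hx hy]
  have hc : ∀ z, (T' (swap (σ⁻¹ x) (σ⁻¹ y) z)).1.2 = (T' z).1.2 := by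
    intro z
    rcases eq_or_ne z (σ⁻¹ x) with rfl | hx
    · rw [swap_apply_left, h2]
    rcases eq_or_ne z (σ⁻¹ y) with rfl | hy
    · rw [swap_apply_right, h2]
    rw [swap_apply_of_ne_of_ne hx hy]
  have hσ : swap x y * σ = σ * swap (σ⁻¹ x) (σ⁻¹ y) := by
    have := mul_swap_eq_swap_mul σ (σ⁻¹ x) (σ⁻¹ y)
    rw [this, perm_apply_inv, perm_apply_inv]
  have key : rowSum k T * MonoidAlgebra.of k _ σ * colSum k T' =
      -(rowSum k T * MonoidAlgebra.of k _ σ * colSum k T') := by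
    conv_lhs => rw [← rowSum_mul_of T hr, mul_assoc (rowSum k T), ← map_mul, hσ, map_mul,
      mul_assoc, mul_assoc, of_mul_colSum T' hc, Perm.sign_swap (fun h => hxy (σ⁻¹.injective h))]
    simp [mul_assoc]
  have h2 : (2 : k) • (rowSum k T * MonoidAlgebra.of k _ σ * colSum k T') = 0 := by
    rw [two_smul]
    nth_rewrite 2 [key]
    exact add_neg_cancel _
  exact (smul_eq_zero.1 h2).resolve_left two_ne_zero

/-- By `eq_of_row_col_injective`, for each `σ` two elements of a common row of `T` lie in a common
column of the translate of `T'` by `σ`. The vanishing is triangular for the order by `rowIndexSum`.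
-/
theorem rowSum_mul_mul_colSum_eq_zero (T : X ≃ μ.cells) (T' : X ≃ ν.cells)
    (hn : rowIndexSum μ ≤ rowIndexSum ν) (hμν : μ ≠ ν) (a : MonoidAlgebra k (Perm X)) :
    rowSum k T * a * colSum k T' = 0 := by
  induction a using MonoidAlgebra.induction_on with
  | of σ =>
    by_contra h
    refine hμν (eq_of_row_col_injective T (σ.symm.trans T') hn fun x y h1 h2 => ?_)
    by_contra hxy
    exact h (rowSum_mul_of_mul_colSum_eq_zero T T' σ hxy h1 h2)
  | add a b ha hb => rw [mul_add, add_mul, ha, hb, add_zero]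
  | smul c a ha => rw [mul_smul_comm, smul_mul_assoc, ha, smul_zero]

theorem exists_rowSum_mul_mul_colSum (T : X ≃ μ.cells) (a : MonoidAlgebra k (Perm X)) :
    ∃ c : k, rowSum k T * a * colSum k T = c • symmetrizer k T := by
  induction a using MonoidAlgebra.induction_on with
  | of σ =>
    by_cases h : ∀ x y, (T x).1.1 = (T y).1.1 → (T (σ⁻¹ x)).1.2 = (T (σ⁻¹ y)).1.2 → x = y
    · obtain ⟨φ, hφ⟩ := exists_row_col T (σ.symm.trans T) le_rfl h
      -- Moves each element within its row of `T` to the column it occupies in the translate of `T`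
      -- by `σ`. Then `r` preserves rows and `r * σ` preserves columns, so `σ = r⁻¹ * (r * σ)` is a
      -- row permutation times a column permutation.
      let r : Perm X := φ.trans T.symm
      have hr : ∀ x, (T (r x)).1.1 = (T x).1.1 := fun x => by simp [r, hφ]
      have hr' : ∀ x, (T (r⁻¹ x)).1.1 = (T x).1.1 := fun x => by
        rw [← hr (r⁻¹ x), perm_apply_inv]
      have hc : ∀ x, (T ((r * σ) x)).1.2 = (T x).1.2 := fun x => by simp [r, hφ]
      have hσ : σ = r⁻¹ * (r * σ) := by group
      refine ⟨((Perm.sign (r * σ) : ℤ) : k), ?_⟩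
      rw [hσ, map_mul, ← mul_assoc, rowSum_mul_of T hr', mul_assoc, of_mul_colSum T hc,
        mul_smul_comm, ← hσ, Int.cast_smul_eq_zsmul]
      rfl
    · push Not at h
      obtain ⟨x, y, h1, h2, hxy⟩ := h
      exact ⟨0, by rw [rowSum_mul_of_mul_colSum_eq_zero T T σ hxy h1 h2, zero_smul]⟩
  | add a b ha hb =>
    obtain ⟨c, hc⟩ := ha
    obtain ⟨d, hd⟩ := hb
    exact ⟨c + d, by rw [mul_add, add_mul, hc, hd, add_smul]⟩
  | smul b a ha =>
    obtain ⟨c, hc⟩ := ha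
    exact ⟨b * c, by rw [mul_smul_comm, smul_mul_assoc, hc, mul_smul]⟩

theorem exists_symmetrizer_mul_mul_symmetrizer (T : X ≃ μ.cells) (a : MonoidAlgebra k (Perm X)) :
    ∃ c : k, symmetrizer k T * a * symmetrizer k T = c • symmetrizer k T := by
  obtain ⟨c, hc⟩ := exists_rowSum_mul_mul_colSum T (colSum k T * a * rowSum k T)
  exact ⟨c, by rw [← hc]; simp only [symmetrizer, mul_assoc]⟩

end YoungTableau


namespace YoungTableau

open Equiv

/-! ### Group algebras of finite groups in characteristic zero -/

section GroupAlgebra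

variable {k G : Type*} [Field k] [Group G] [Fintype G]

theorem trace_mulLeft (a : MonoidAlgebra k G) :
    LinearMap.trace k _ (LinearMap.mulLeft k a) = Fintype.card G * a.coeff 1 := by
  classical
  let b : Module.Basis G k (MonoidAlgebra k G) := ⟨MonoidAlgebra.coeffLinearEquiv k⟩
  have hb : ∀ g, b g = MonoidAlgebra.single g 1 := fun g => rfl
  rw [LinearMap.trace_eq_matrix_trace k b, Matrix.trace]
  have : ∀ g, (LinearMap.toMatrix b b (LinearMap.mulLeft k a)).diag g = a.coeff 1 := by
    intro g
    rw [Matrix.diag_apply, LinearMap.toMatrix_apply, LinearMap.mulLeft_apply, hb]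
    change (a * MonoidAlgebra.single g 1).coeff g = _
    rw [MonoidAlgebra.coeff_mul_single_apply, mul_inv_cancel, mul_one]
  rw [Finset.sum_congr rfl fun g _ => this g, Finset.sum_const, nsmul_eq_mul, Finset.card_univ]

/-- An element of square zero acts nilpotently by left multiplication, hence with trace zero,
whereas the trace is `|G|` times the coefficient of the identity. -/
theorem mul_self_ne_zero_of_coeff_one [CharZero k] {a : MonoidAlgebra k G} (ha : a.coeff 1 ≠ 0) :
    a * a ≠ 0 := by
  intro h
  have hn : IsNilpotent (LinearMap.mulLeft k a) := ⟨2, by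
    rw [LinearMap.pow_mulLeft, pow_two, h, LinearMap.mulLeft_zero_eq_zero]⟩
  have h2 := (LinearMap.isNilpotent_trace_of_isNilpotent hn).eq_zero
  rw [trace_mulLeft] at h2
  exact (mul_ne_zero (Nat.cast_ne_zero.2 Fintype.card_ne_zero) ha) h2

/-- Semisimple rings are von Neumann regular. -/
theorem exists_mul_mul_self {A : Type*} [Ring A] [IsSemisimpleRing A] (a : A) :
    ∃ x, a * x * a = a := by
  obtain ⟨e, he, hI⟩ := IsSemisimpleRing.ideal_eq_span_idempotent (Ideal.span {a})
  have h1 : e ∈ Ideal.span {a} := hI ▸ Ideal.mem_span_singleton_self e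
  have h2 : a ∈ Ideal.span {e} := hI ▸ Ideal.mem_span_singleton_self a
  obtain ⟨x, hx⟩ := Ideal.mem_span_singleton'.1 h1
  obtain ⟨y, hy⟩ := Ideal.mem_span_singleton'.1 h2
  refine ⟨x, ?_⟩
  rw [mul_assoc, hx, ← hy, mul_assoc, he.eq]

theorem coeff_conj_of_mem_center {G : Type*} [Group G] {z : MonoidAlgebra k G}
    (hz : z ∈ Subalgebra.center k (MonoidAlgebra k G)) {g h : G} (hgh : IsConj g h) :
    z.coeff g = z.coeff h := by
  obtain ⟨c, rfl⟩ := isConj_iff.1 hgh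
  have h1 := Subalgebra.mem_center_iff.1 hz (MonoidAlgebra.single c⁻¹ 1)
  have h2 := congrArg (fun y => y.coeff (g * c⁻¹)) h1
  simp only [MonoidAlgebra.coeff_single_mul_apply, MonoidAlgebra.coeff_mul_single_apply] at h2
  simpa [mul_assoc] using h2.symm

/-- Central elements are class functions, so they are determined by their coefficients at
representatives of the conjugacy classes. -/
theorem finrank_center_le :
    Module.finrank k (Subalgebra.center k (MonoidAlgebra k G)) ≤ Nat.card (ConjClasses G) := by
  classical
  have : Fintype (ConjClasses G) := Fintype.ofFinite _
  let F : Subalgebra.center k (MonoidAlgebra k G) →ₗ[k] (ConjClasses G → k) :=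
    { toFun := fun z C => z.1.coeff (Quotient.out C)
      map_add' := fun x y => rfl
      map_smul' := fun c x => rfl }
  have hF : Function.Injective F := by
    intro z z' h
    refine Subtype.ext (MonoidAlgebra.coeff_injective (Finsupp.ext fun g => ?_))
    have h1 : IsConj (Quotient.out (ConjClasses.mk g)) g :=
      Quotient.exact (Quotient.out_eq (ConjClasses.mk g))
    rw [← coeff_conj_of_mem_center z.2 h1, ← coeff_conj_of_mem_center z'.2 h1]
    exact congrFun h _
  refine (LinearMap.finrank_le_finrank_of_injective hF).trans ?_
  rw [Module.finrank_fintype_fun_eq_card, Nat.card_eq_fintype_card]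

end GroupAlgebra

/-! ### Conjugacy classes of permutations and Young diagrams -/

theorem card_ofRowLens (w : List ℕ) (hw : w.SortedGE) :
    (YoungDiagram.ofRowLens w hw).cells.card = w.sum := by
  have : ∀ w : List ℕ, (YoungDiagram.cellsOfRowLens w).card = w.sum := by
    intro w
    induction w with
    | nil => rfl
    | cons a w ih =>
      rw [YoungDiagram.cellsOfRowLens, Finset.card_union_of_disjoint, Finset.card_map, ih]
      · simp
      · rw [Finset.disjoint_left]
        rintro ⟨i, j⟩ h1 h2
        simp only [Finset.mem_product, Finset.mem_singleton] at h1
        rw [h1.1] at h2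
        simp at h2
  exact this w

variable {X : Type*} [Fintype X] [DecidableEq X]

variable (X) in
/-- The Young diagrams with as many cells as `X` has elements. -/
abbrev Shape : Type := {μ : YoungDiagram // μ.cells.card = Fintype.card X}

/-- The diagram of a partition. -/
theorem exists_shape_of_partition {X : Type*} [Fintype X] :
    ∃ F : (Fintype.card X).Partition → Shape X,
    Function.Injective F := by
  have hs : ∀ p : (Fintype.card X).Partition, (p.parts.sort (· ≥ ·)).SortedGE := fun p =>
    (Multiset.pairwise_sort p.parts (· ≥ ·)).sortedGE
  refine ⟨fun p => ⟨YoungDiagram.ofRowLens (p.parts.sort (· ≥ ·)) (hs p), ?_⟩, ?_⟩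
  · rw [card_ofRowLens, ← Multiset.sum_coe, Multiset.sort_eq, p.parts_sum]
  · intro p q h
    have hp : ∀ (p : (Fintype.card X).Partition), ∀ x ∈ p.parts.sort (· ≥ ·), 0 < x :=
      fun p x hx => p.parts_pos ((Multiset.mem_sort _).1 hx)
    have h1 := congrArg (fun s : Shape X => s.1.rowLens) h
    simp only [YoungDiagram.rowLens_ofRowLens_eq_self (hp _)] at h1
    have h2 := congrArg (fun l : List ℕ => (l : Multiset ℕ)) h1
    simp only [Multiset.sort_eq] at h2
    exact Nat.Partition.ext h2

/-- Cycle types separate conjugacy classes. This inequality suffices: the opposite one comes out of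
the linear independence in `one_mem_span_symmetrizer`. -/
theorem card_conjClasses_le [Finite (Shape X)] :
    Nat.card (ConjClasses (Perm X)) ≤ Nat.card (Shape X) := by
  obtain ⟨F, hF⟩ := exists_shape_of_partition (X := X)
  refine Nat.card_le_card_of_injective (fun C : ConjClasses (Perm X) =>
    F (Perm.partition (Quotient.out C))) fun C D h => ?_
  have h1 := Perm.partition_eq_of_isConj.2 (hF h)
  rw [← Quotient.out_eq C, ← Quotient.out_eq D]
  exact Quotient.sound h1

/-! ### Properties of Young symmetrizers -/

variable {k : Type*} [Field k] {μ ν : YoungDiagram}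

/-- A permutation preserving both rows and columns is trivial, so the identity arises only as the
product of two identities. -/
theorem coeff_one_symmetrizer (T : X ≃ μ.cells) : (symmetrizer k T).coeff 1 = 1 := by
  rw [symmetrizer, rowSum, colSum, Finset.sum_mul_sum, MonoidAlgebra.coeff_sum,
    Finset.sum_apply']
  rw [Finset.sum_eq_single 1]
  · rw [MonoidAlgebra.coeff_sum, Finset.sum_apply', Finset.sum_eq_single 1]
    · simp
    · intro τ hτ h
      simp [h]
    · simp
  · intro σ hσ h
    rw [MonoidAlgebra.coeff_sum, Finset.sum_apply']
    refine Finset.sum_eq_zero fun τ hτ => ?_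
    have hne : σ * τ ≠ 1 := by
      intro h1
      refine h ?_
      have hσ' := (Finset.mem_filter.1 hσ).2
      have hτ' := (Finset.mem_filter.1 hτ).2
      ext x
      rw [Perm.one_apply]
      refine T.injective (Subtype.ext (Prod.ext (hσ' x) ?_))
      have h2 := hτ' (σ x)
      rw [mul_eq_one_iff_inv_eq] at h1
      rw [← h1] at h2
      rw [← h2]
      simp
    rw [mul_smul_comm, ← map_mul]
    simp [hne]
  · simp

variable (k) in
/-- The sum of the conjugates of a Young symmetrizer. -/
def centralSum (T : X ≃ μ.cells) : MonoidAlgebra k (Perm X) :=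
  ∑ σ : Perm X, MonoidAlgebra.of k _ σ * symmetrizer k T * MonoidAlgebra.of k _ σ⁻¹

theorem centralSum_mem_center (T : X ≃ μ.cells) :
    centralSum k T ∈ Subalgebra.center k (MonoidAlgebra k (Perm X)) := by
  rw [Subalgebra.mem_center_iff]
  intro b
  induction b using MonoidAlgebra.induction_on with
  | of τ =>
    rw [centralSum, Finset.mul_sum, Finset.sum_mul]
    refine Fintype.sum_equiv (Equiv.mulLeft τ) _ _ fun σ => ?_
    rw [Equiv.coe_mulLeft, mul_inv_rev]
    simp only [mul_assoc, map_mul]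
    rw [← map_mul, inv_mul_cancel, map_one, mul_one]
  | add a b ha hb => rw [mul_add, add_mul, ha, hb]
  | smul c a ha => rw [mul_smul_comm, smul_mul_assoc, ha]

variable [CharZero k]

theorem exists_symmetrizer_mul_self (T : X ≃ μ.cells) :
    ∃ c : k, c ≠ 0 ∧ symmetrizer k T * symmetrizer k T = c • symmetrizer k T := by
  obtain ⟨c, hc⟩ := exists_symmetrizer_mul_mul_symmetrizer (k := k) T 1
  rw [mul_one] at hc
  refine ⟨c, ?_, hc⟩
  rintro rfl
  refine mul_self_ne_zero_of_coeff_one (a := symmetrizer k T) ?_ (by rw [hc, zero_smul])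
  rw [coeff_one_symmetrizer]
  exact one_ne_zero

theorem centralSum_ne_zero (T : X ≃ μ.cells) : centralSum k T ≠ 0 := by
  intro h
  have h1 := congrArg (fun a => a.coeff 1) h
  simp only [centralSum, MonoidAlgebra.coeff_sum, Finset.sum_apply', MonoidAlgebra.of_apply,
    MonoidAlgebra.coeff_mul_single_apply, MonoidAlgebra.coeff_single_mul_apply] at h1
  simp [coeff_one_symmetrizer, Fintype.card_ne_zero] at h1

/-- A central element acts on the symmetrizer by a scalar because `e a e` is a multiple of `e`. If
the scalar were zero, the central sum would kill all conjugates of `e`, hence have square zero; von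
Neumann regularity excludes nonzero central elements of square zero. -/
theorem exists_centralSum_mul_symmetrizer (T : X ≃ μ.cells) :
    ∃ s : k, s ≠ 0 ∧ centralSum k T * symmetrizer k T = s • symmetrizer k T := by
  obtain ⟨c, hc0, hc⟩ := exists_symmetrizer_mul_self (k := k) T
  have hcomm := Subalgebra.mem_center_iff.1 (centralSum_mem_center (k := k) T)
  obtain ⟨s, hs⟩ := exists_symmetrizer_mul_mul_symmetrizer (k := k) T (centralSum k T)
  have hz : centralSum k T * symmetrizer k T = (c⁻¹ * s) • symmetrizer k T := by
    rw [mul_smul, ← hs, hcomm, mul_assoc, hc, mul_smul_comm, inv_smul_smul₀ hc0]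
  refine ⟨c⁻¹ * s, fun h0 => ?_, hz⟩
  rw [h0, zero_smul] at hz
  have h2 : centralSum k T * centralSum k T = 0 := by
    nth_rewrite 2 [centralSum]
    rw [Finset.mul_sum]
    refine Finset.sum_eq_zero fun σ _ => ?_
    rw [← mul_assoc, ← mul_assoc, ← hcomm, mul_assoc (MonoidAlgebra.of k _ σ), hz, mul_zero,
      zero_mul]
  obtain ⟨x, hx⟩ := exists_mul_mul_self (centralSum k T)
  refine centralSum_ne_zero (k := k) T ?_
  rw [← hx, ← hcomm, mul_assoc, h2, mul_zero]

theorem centralSum_mul_symmetrizer_eq_zero (T : X ≃ μ.cells) (T' : X ≃ ν.cells)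
    (hn : rowIndexSum μ ≤ rowIndexSum ν) (hμν : μ ≠ ν) :
    centralSum k T * symmetrizer k T' = 0 := by
  rw [centralSum, Finset.sum_mul]
  refine Finset.sum_eq_zero fun σ _ => ?_
  have h := rowSum_mul_mul_colSum_eq_zero T T' hn hμν
    (colSum k T * MonoidAlgebra.of k _ σ⁻¹ * rowSum k T')
  have h2 : MonoidAlgebra.of k _ σ * symmetrizer k T * MonoidAlgebra.of k _ σ⁻¹ *
      symmetrizer k T' = MonoidAlgebra.of k _ σ * (rowSum k T *
        (colSum k T * MonoidAlgebra.of k _ σ⁻¹ * rowSum k T') * colSum k T') := by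
    simp only [symmetrizer, mul_assoc]
  rw [h2, h, mul_zero]

/-- The two-sided ideals generated by the Young symmetrizers span the group algebra. -/
theorem one_mem_span_symmetrizer : (1 : MonoidAlgebra k (Perm X)) ∈ Submodule.span k
    {a | ∃ (μ : YoungDiagram) (T : X ≃ μ.cells) (x y : MonoidAlgebra k (Perm X)),
      a = x * symmetrizer k T * y} := by
  classical
  have hT : ∀ s : Shape X, Nonempty (X ≃ s.1.cells) := fun s => by
    rw [← Fintype.card_eq, Fintype.card_coe, s.2]
  let T : ∀ s : Shape X, X ≃ s.1.cells := fun s => (hT s).some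
  let z : Shape X → Subalgebra.center k (MonoidAlgebra k (Perm X)) := fun s =>
    ⟨centralSum k (T s), centralSum_mem_center (T s)⟩
  -- Triangularity: among the shapes with nonzero coefficient in a relation, take one of largest
  -- `rowIndexSum` and multiply by its symmetrizer. All other terms vanish, and its own is a nonzero
  -- multiple of the symmetrizer.
  have hli : LinearIndependent k z := by
    rw [linearIndependent_iff']
    intro S f hf
    by_contra hne
    push Not at hne
    let S' := S.filter fun s => f s ≠ 0
    have hS' : S'.Nonempty := by
      obtain ⟨s, hs, h⟩ := hne
      exact ⟨s, Finset.mem_filter.2 ⟨hs, h⟩⟩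
    obtain ⟨t, ht, hmax⟩ := Finset.exists_max_image S' (fun s => rowIndexSum s.1) hS'
    have htS := Finset.mem_filter.1 ht
    have h1 : ∑ s ∈ S, f s • centralSum k (T s) = 0 := by
      have := congrArg Subtype.val hf
      simpa [z] using this
    have h2 := congrArg (fun a => a * symmetrizer k (T t)) h1
    simp only [Finset.sum_mul, zero_mul, smul_mul_assoc] at h2
    obtain ⟨c, hc0, hc⟩ := exists_centralSum_mul_symmetrizer (k := k) (T t)
    rw [Finset.sum_eq_single t] at h2
    · rw [hc, smul_smul] at h2
      have h3 := congrArg (fun a => a.coeff 1) h2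
      simp [coeff_one_symmetrizer, hc0, htS.2] at h3
    · intro s hs hst
      by_cases hfs : f s = 0
      · rw [hfs, zero_smul]
      · rw [centralSum_mul_symmetrizer_eq_zero (T s) (T t)
          (hmax s (Finset.mem_filter.2 ⟨hs, hfs⟩)) (fun h => hst (Subtype.ext h)), smul_zero]
    · intro h
      exact absurd htS.1 h
  have hfin : Finite (Shape X) := hli.finite
  have := Fintype.ofFinite (Shape X)
  -- Shapes ≤ dimension of the centre ≤ conjugacy classes ≤ shapes, so the central sums form a basis
  -- of the centre, which contains `1`.
  have hcard : Fintype.card (Shape X) =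
      Module.finrank k (Subalgebra.center k (MonoidAlgebra k (Perm X))) := by
    refine le_antisymm hli.fintype_card_le_finrank ?_
    rw [← Nat.card_eq_fintype_card]
    exact finrank_center_le.trans card_conjClasses_le
  have hspan := hli.span_eq_top_of_card_eq_finrank' hcard
  have h1 : (1 : Subalgebra.center k (MonoidAlgebra k (Perm X))) ∈
      Submodule.span k (Set.range z) := by rw [hspan]; trivial
  have h2 := Submodule.mem_map_of_mem
    (f := (Subalgebra.center k (MonoidAlgebra k (Perm X))).val.toLinearMap) h1
  rw [Submodule.map_span] at h2
  have h3 : (1 : MonoidAlgebra k (Perm X)) ∈ Submodule.span k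
    ((Subalgebra.center k (MonoidAlgebra k (Perm X))).val.toLinearMap '' Set.range z) := h2
  refine Submodule.span_le.2 ?_ h3
  rintro _ ⟨_, ⟨s, rfl⟩, rfl⟩
  change centralSum k (T s) ∈ Submodule.span k _
  rw [centralSum]
  exact Submodule.sum_mem _ fun σ _ => Submodule.subset_span ⟨s.1, T s, _, _, rfl⟩

/-- Every nonzero element of the group algebra is detected by a Young symmetrizer. -/
theorem exists_symmetrizer_mul_ne_zero {a : MonoidAlgebra k (Perm X)} (ha : a ≠ 0) :
    ∃ (μ : YoungDiagram) (T : X ≃ μ.cells) (x y : MonoidAlgebra k (Perm X)),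
      symmetrizer k T * x * a * y * symmetrizer k T ≠ 0 := by
  by_contra! h
  refine ha ?_
  have h1 : ∀ b ∈ Submodule.span k {a | ∃ (μ : YoungDiagram) (T : X ≃ μ.cells)
      (x y : MonoidAlgebra k (Perm X)), a = x * symmetrizer k T * y}, a * b = 0 := by
    intro b hb
    induction hb using Submodule.span_induction with
    | mem b hb =>
      obtain ⟨μ, T, x, y, rfl⟩ := hb
      -- Regularity writes `a x e` as `a x (e z a x e)`, and the bracket vanishes by assumption. So
      -- `a` annihilates the ideals of all symmetrizers, hence `1`.
      obtain ⟨z, hz⟩ := exists_mul_mul_self (a * x * symmetrizer k T)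
      rw [← mul_assoc, ← mul_assoc, ← hz]
      have := h μ T z x
      simp only [mul_assoc] at this ⊢
      have h3 : symmetrizer k T * (z * (a * (x * (symmetrizer k T * y)))) =
        symmetrizer k T * (z * (a * (x * symmetrizer k T))) * y := by simp only [mul_assoc]
      rw [h3, this, zero_mul, mul_zero, mul_zero]
    | zero => rw [mul_zero]
    | add b c _ _ hb hc => rw [mul_add, hb, hc, add_zero]
    | smul c b _ hb => rw [mul_smul_comm, hb, smul_zero]
  rw [← mul_one a]
  exact h1 1 one_mem_span_symmetrizer

end YoungTableau


namespace Operad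

variable {k : Type u} [Field k] (P : Operad k)

/-! ### Derivations of the free algebra -/

theorem compLinearMap_update_apply {T E F A : Type*} [DecidableEq T] [AddCommGroup E] [Module k E]
    [AddCommGroup F] [Module k F] [AddCommGroup A] [Module k A]
    (f : MultilinearMap k (fun _ : T => F) A) (g D : E →ₗ[k] F) (t : T) (a : T → E) :
    f.compLinearMap (Function.update (fun _ => g) t D) a =
      f (Function.update (fun s => g (a s)) t (D (a t))) := by
  rw [MultilinearMap.compLinearMap_apply]
  congr 1
  ext s
  by_cases h : s = t
  · subst h; simp
  · simp [h]

/-- The sum over `t` of the operation `p` applied to the elements `ι (a_s)`, except for the entry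
at `t`, which is `D (a_t)`. -/
def insertSum {T : Type} [Fintype T] [DecidableEq T] {E A : Type u} [AddCommGroup E] [Module k E]
    [AddCommGroup A] [Module k A] (α : P.Algebra A) (g D : E →ₗ[k] A) :
    P.obj T →ₗ[k] MultilinearMap k (fun _ : T => E) A where
  toFun p := ∑ t, (α.act p).compLinearMap (Function.update (fun _ => g) t D)
  map_add' p q := by
    ext a
    simp [Finset.sum_add_distrib]
  map_smul' c p := by
    ext a
    simp [Finset.smul_sum]

theorem insertSum_apply {T : Type} [Fintype T] [DecidableEq T] {E A : Type u} [AddCommGroup E]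
    [Module k E] [AddCommGroup A] [Module k A] (α : P.Algebra A) (g D : E →ₗ[k] A) (p : P.obj T)
    (a : T → E) : P.insertSum α g D p a =
      ∑ t, α.act p (Function.update (fun s => g (a s)) t (D (a t))) := by
  change (∑ t, (α.act p).compLinearMap (Function.update (fun _ => g) t D)) a = _
  rw [sum_apply]
  exact Finset.sum_congr rfl fun t _ => compLinearMap_update_apply _ g D t a

theorem insertSum_map {T T' : Type} [Fintype T] [DecidableEq T] [Fintype T'] [DecidableEq T']
    {E A : Type u} [AddCommGroup E]
    [Module k E] [AddCommGroup A] [Module k A] (α : P.Algebra A) (g D : E →ₗ[k] A) (e : T ≃ T')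
    (p : P.obj T) (a : T' → E) :
    P.insertSum α g D (P.map e p) a = P.insertSum α g D p (fun t => a (e t)) := by
  rw [insertSum_apply, insertSum_apply]
  refine (Fintype.sum_equiv e _ _ fun t => ?_).symm
  rw [α.act_map]
  congr 1
  ext s
  by_cases h : s = t
  · subst h; simp
  · simp [h]

/-- The derivation of the free algebra which extends a linear map on the generators. -/
theorem exists_derivation (E : Type u) [AddCommGroup E] [Module k E] (D : E →ₗ[k] P.Free E) :
    ∃ δ ∈ P.derivations (P.free E), ∀ a, δ (P.ι E a) = D a := by
  classical
  choose L hL using fun r => P.exists_lift_part E r (P.insertSum (P.free E) (P.ι E) D)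
    (fun σ p a => P.insertSum_map _ _ _ σ p a)
  let δ : P.Free E →ₗ[k] P.Free E := DirectSum.toModule k ℕ _ L
  have hgen : ∀ {S : Type} [Fintype S] [DecidableEq S] (p : P.obj S) (a : S → E),
      δ (P.gen E p a) = P.insertSum (P.free E) (P.ι E) D p a := by
    intro S _ _ p a
    rw [P.gen_apply E p (Finite.equivFin S)]
    simp only [δ, DirectSum.toModule_lof]
    rw [hL, P.insertSum_map]
    simp
  refine ⟨δ, ?_, fun a => ?_⟩
  · intro r p v
    -- The Leibniz rule is an equality of two multilinear maps, so it need only hold on generators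
    -- `q_t(a_t)`. There both sides are sums over the inputs `(t, s)` of the composite operation.
    have : δ.compMultilinearMap ((P.free E).act p) =
        P.insertSum (P.free E) LinearMap.id δ p := by
      refine multilinear_ext_span (κ := fun _ => P.GenData E) (fun _ c => P.gen E c.2.1 c.2.2)
        (fun _ => P.span_gen E) _ _ fun c => ?_
      rw [insertSum_apply, LinearMap.compMultilinearMap_apply]
      change δ (P.freeAct E p _) = _
      rw [P.freeAct_gen E (fun t => Fin (c t).1), hgen, insertSum_apply, Fintype.sum_sigma]
      refine Finset.sum_congr rfl fun t _ => ?_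
      rw [hgen, insertSum_apply]
      have h1 : ∀ u : Fin (c t).1 → P.Free E, Function.update
          (fun s => LinearMap.id (R := k) (P.gen E (c s).2.1 (c s).2.2)) t
            ((P.free E).act (c t).2.1 u) =
          fun t' => (P.free E).act (c t').2.1
            (Function.update (β := fun t' => Fin (c t').1 → P.Free E)
              (fun t' s => P.ι E ((c t').2.2 s)) t u t') := by
        intro u
        ext1 t'
        by_cases h : t' = t
        · subst h; simp
        · simp only [Function.update_of_ne h, LinearMap.id_apply]
          exact P.gen_eq_act E _ _
      let M := ((P.free E).act p).toLinearMap
        (fun s => LinearMap.id (R := k) (P.gen E (c s).2.1 (c s).2.2)) t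
      have hM : ∀ y, ((P.free E).act p) (Function.update
        (fun s => LinearMap.id (R := k) (P.gen E (c s).2.1 (c s).2.2)) t y) = M y := fun y => rfl
      rw [hM, map_sum]
      refine Finset.sum_congr rfl fun s _ => ?_
      rw [← hM, h1, (P.free E).act_comp]
      congr 1
      ext1 t'
      congr 1
      ext1 s'
      by_cases h : t' = t
      · subst h
        by_cases hs : s' = s
        · subst hs; simp
        · simp [hs]
      · simp [h]
    have h2 := congrArg (fun f => f v) this
    simp only [LinearMap.compMultilinearMap_apply, insertSum_apply] at h2
    exact h2
  · change δ (P.gen E P.unit fun _ => a) = _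
    rw [hgen, insertSum_apply]
    simp only [Finset.univ_unique, Finset.sum_singleton, (P.free E).act_unit]
    simp

/-- The derivations of an algebra are derivations for operations with any finite set of inputs. -/
theorem derivation_act {A : Type u} [AddCommGroup A] [Module k A] (α : P.Algebra A)
    {δ : Module.End k A} (hδ : δ ∈ P.derivations α) {T : Type} [Fintype T] [DecidableEq T]
    (p : P.obj T) (a : T → A) :
    δ (α.act p a) = ∑ t, α.act p (Function.update a t (δ (a t))) := by
  let e := Fintype.equivFin T
  have h := hδ _ (P.map e p) (fun i => a (e.symm i))
  have h2 := P.insertSum_map α LinearMap.id δ e p (fun i => a (e.symm i))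
  rw [insertSum_apply, insertSum_apply] at h2
  simp only [LinearMap.id_apply, Equiv.symm_apply_apply] at h2
  rw [← h2, ← h, α.act_map]
  simp

theorem lie_act (δ : P.h) {T : Type} [Fintype T] [DecidableEq T] (p : P.obj T) (a : T → P.V) :
    ⁅δ, (P.free P.W).act p a⁆ = ∑ t, (P.free P.W).act p (Function.update a t ⁅δ, a t⁆) :=
  P.derivation_act _ δ.2.1 p a

theorem exists_elem (i : ℕ) (v : P.V) : ∃ δ : P.h, ∀ w, ⁅δ, P.ι P.W w⁆ = w i • v := by
  obtain ⟨δ, hδ, h⟩ := P.exists_derivation P.W ((Finsupp.lapply i).smulRight v)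
  have h' : ∀ w : P.W, δ (P.ι P.W w) = w i • v := h
  refine ⟨⟨δ, hδ, i + 1, fun j hj => ?_⟩, h'⟩
  rw [x, h', Finsupp.single_eq_of_ne (by omega), zero_smul]

/-- The element of `h` which maps `x_i` to `v` and kills the other generators. -/
def elem (i : ℕ) (v : P.V) : P.h := Classical.choose (P.exists_elem i v)

theorem elem_ι (i : ℕ) (v : P.V) (w : P.W) : ⁅P.elem i v, P.ι P.W w⁆ = w i • v :=
  Classical.choose_spec (P.exists_elem i v) w

theorem elem_x (i j : ℕ) (v : P.V) : ⁅P.elem i v, P.x j⁆ = if j = i then v else 0 := by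
  rw [x, elem_ι, Finsupp.single_apply]
  split_ifs <;> simp

theorem elem_x_self (i : ℕ) (v : P.V) : ⁅P.elem i v, P.x i⁆ = v := by
  rw [elem_x, if_pos rfl]

theorem elem_x_of_ne {i j : ℕ} (h : j ≠ i) (v : P.V) : ⁅P.elem i v, P.x j⁆ = 0 := by
  rw [elem_x, if_neg h]

variable {P} in
theorem V_induction {Q : P.V → Prop}
    (hact : ∀ (r : ℕ) (p : P.obj (Fin r)) (a : Fin r → ℕ),
      Q ((P.free P.W).act p fun i => P.x (a i)))
    (hzero : Q 0) (hadd : ∀ v w, Q v → Q w → Q (v + w)) (hsmul : ∀ (c : k) v, Q v → Q (c • v))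
    (v : P.V) : Q v := by
  have hv : v ∈ Submodule.span k
      (Set.range fun c : P.GenData P.W => P.gen P.W c.2.1 c.2.2) := by
    rw [span_gen]; trivial
  have hsp : Submodule.span k (Set.range fun i : ℕ => Finsupp.single i (1 : k)) = ⊤ := by
    have := (Finsupp.basisSingleOne (R := k) (ι := ℕ)).span_eq
    simpa [Finsupp.coe_basisSingleOne] using this
  induction hv using Submodule.span_induction with
  | mem v hv =>
    obtain ⟨⟨r, p, a⟩, rfl⟩ := hv
    refine pi_span_induction (k := k) (κ := fun _ => ℕ) (fun _ i => Finsupp.single i (1 : k))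
      (fun _ => hsp) (fun a => Q (P.gen P.W p a)) ?_ ?_ ?_ a
    · intro c
      rw [gen_eq_act]
      exact hact r p c
    · intro z t x y hx hy
      rw [MultilinearMap.map_update_add]
      exact hadd _ _ hx hy
    · intro z t c x hx
      rw [MultilinearMap.map_update_smul]
      exact hsmul _ _ hx
  | zero => exact hzero
  | add v w _ _ hv hw => exact hadd _ _ hv hw
  | smul c v _ hv => exact hsmul _ _ hv

variable {P} in
theorem h_ext {δ δ' : P.h} (hx : ∀ i, ⁅δ, P.x i⁆ = ⁅δ', P.x i⁆) : δ = δ' := by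
  refine Subtype.ext (LinearMap.ext fun v => ?_)
  change ⁅δ, v⁆ = ⁅δ', v⁆
  induction v using V_induction with
  | hact r p a => simp only [lie_act, hx]
  | hzero => rw [lie_zero, lie_zero]
  | hadd v w hv hw => rw [lie_add, lie_add, hv, hw]
  | hsmul c v hv => rw [lie_smul, lie_smul, hv]

theorem lie_elem_elem (i j : ℕ) (v w : P.V) : ⁅P.elem i v, P.elem j w⁆ =
    P.elem j ⁅P.elem i v, w⁆ - P.elem i ⁅P.elem j w, v⁆ := by
  refine h_ext fun l => ?_
  rw [lie_lie, sub_lie, P.elem_x j l, P.elem_x i l, P.elem_x j l, P.elem_x i l]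
  split_ifs <;> simp only [lie_zero]

theorem elem_zero (i : ℕ) : P.elem i 0 = 0 := by
  refine h_ext fun l => ?_
  rw [zero_lie, elem_x, ite_self]

theorem elem_ite_lie (q q' : Prop) [Decidable q] [Decidable q'] (hq : q' ↔ q) (i : ℕ) (v w : P.V) :
    ⁅P.elem i (if q then v else 0), w⁆ = (if q' then (1 : k) else 0) • ⁅P.elem i v, w⁆ := by
  by_cases h : q
  · rw [if_pos h, if_pos (hq.2 h), one_smul]
  · rw [if_neg h, if_neg (fun h' => h (hq.1 h')), elem_zero, zero_lie, zero_smul]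

/-- The Euler derivation of the variable `x_i`. -/
abbrev euler (i : ℕ) : P.h := P.elem i (P.x i)

theorem euler_comm (i j : ℕ) : ⁅P.euler i, P.euler j⁆ = 0 := by
  rw [lie_elem_elem, P.elem_x i j, P.elem_x j i]
  by_cases h : i = j
  · subst h
    rw [sub_self]
  · rw [if_neg h, if_neg (Ne.symm h), elem_zero, elem_zero, sub_zero]

/-- The derivation `x_j ∂/∂x_i`. -/
abbrev transfer (i j : ℕ) : P.h := P.elem i (P.x j)

theorem euler_transfer (n i j : ℕ) : ⁅P.euler n, P.transfer i j⁆ =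
    (((if n = j then 1 else 0) - (if n = i then 1 else 0) : k)) • P.transfer i j := by
  rw [lie_elem_elem, P.elem_x n j, P.elem_x i n]
  refine h_ext fun l => ?_
  rw [sub_lie, smul_lie, P.elem_ite_lie _ _ eq_comm, P.elem_ite_lie _ (n = i) Iff.rfl,
    sub_smul]
  congr 1
  · by_cases h : n = j
    · rw [h]
    · rw [if_neg h, zero_smul, zero_smul]
  · by_cases h : n = i
    · rw [h]
    · rw [if_neg h, zero_smul, zero_smul]

theorem transfer_transfer (i j : ℕ) :
    ⁅P.transfer j i, P.transfer i j⁆ = P.euler i - P.euler j := by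
  rw [lie_elem_elem, P.elem_x_self j (P.x i), P.elem_x_self i (P.x j)]

/-- Every element of `V` involves finitely many generators. -/
theorem exists_bound (v : P.V) : ∃ n, ∀ i, n ≤ i → ∀ w, ⁅P.elem i w, v⁆ = 0 := by
  induction v using V_induction with
  | hact r p a =>
    refine ⟨Finset.univ.sup a + 1, fun i hi w => ?_⟩
    rw [lie_act]
    refine Finset.sum_eq_zero fun t _ => ?_
    have : a t ≤ Finset.univ.sup a := Finset.le_sup (Finset.mem_univ t)
    rw [elem_x_of_ne _ (by omega)]
    exact MultilinearMap.map_update_zero _ _ _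
  | hzero => exact ⟨0, fun i _ w => lie_zero _⟩
  | hadd v w hv hw =>
    obtain ⟨n, hn⟩ := hv
    obtain ⟨m, hm⟩ := hw
    refine ⟨max n m, fun i hi u => ?_⟩
    rw [lie_add, hn i (le_of_max_le_left hi), hm i (le_of_max_le_right hi), add_zero]
  | hsmul c v hv =>
    obtain ⟨n, hn⟩ := hv
    exact ⟨n, fun i hi u => by rw [lie_smul, hn i hi, smul_zero]⟩

end Operad


/-! ### Weight vectors for commuting families of endomorphisms -/

namespace Weight

open Polynomial

section Abstract

variable {k : Type*} [Field k] {X Y : Type*} [AddCommGroup X] [Module k X]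
  [AddCommGroup Y] [Module k Y]

/-- `m` is a weight vector of weight `w`. -/
def IsWeight (e : ℕ → Module.End k X) (w : ℕ →₀ ℕ) (m : X) : Prop := ∀ n, e n m = (w n : k) • m

variable (k) in
/-- The polynomial `t (t - 1) ⋯ (t - N + 1)`. -/
def fallingPoly (N : ℕ) : k[X] := ∏ j ∈ Finset.range N, (Polynomial.X - C (j : k))

/-- `m` is a sum of weight vectors, expressed in terms of annihilating polynomials. -/
def IsGood (e : ℕ → Module.End k X) (m : X) : Prop :=
  (∃ n, ∀ i, n ≤ i → e i m = 0) ∧ ∀ i, ∃ N, aeval (e i) (fallingPoly k N) m = 0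

theorem aeval_fallingPoly_of_le {T : Module.End k X} {m : X} {N N' : ℕ} (h : N ≤ N')
    (hm : aeval T (fallingPoly k N) m = 0) : aeval T (fallingPoly k N') m = 0 := by
  obtain ⟨q, hq⟩ : fallingPoly k N ∣ fallingPoly k N' :=
    Finset.prod_dvd_prod_of_subset _ _ _ (Finset.range_subset_range.2 h)
  rw [hq, mul_comm, map_mul, Module.End.mul_apply, hm, map_zero]

theorem aeval_of_eigen {T : Module.End k X} {c : k} {m : X} (h : T m = c • m) (p : k[X]) :
    aeval T p m = p.eval c • m := by
  induction p using Polynomial.induction_on' with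
  | add p q hp hq => rw [map_add, LinearMap.add_apply, hp, hq, eval_add, add_smul]
  | monomial n a =>
    rw [aeval_monomial, Module.End.mul_apply, Module.algebraMap_end_apply, eval_monomial, mul_smul]
    congr 1
    induction n with
    | zero => simp
    | succ n ih => rw [pow_succ, Module.End.mul_apply, h, map_smul, ih, smul_smul, pow_succ']

theorem map_aeval {T : Module.End k X} {T' : Module.End k Y} (g : X →ₗ[k] Y)
    (hg : ∀ x, g (T x) = T' (g x)) (p : k[X]) (x : X) : g (aeval T p x) = aeval T' p (g x) := by
  induction p using Polynomial.induction_on' with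
  | add p q hp hq => simp only [map_add, LinearMap.add_apply, hp, hq]
  | monomial n a =>
    simp only [aeval_monomial, Module.End.mul_apply, Module.algebraMap_end_apply, map_smul]
    congr 1
    induction n generalizing x with
    | zero => simp
    | succ n ih => simp only [pow_succ, Module.End.mul_apply, ih, hg]

variable {e : ℕ → Module.End k X} {e' : ℕ → Module.End k Y}

theorem IsWeight.isGood {w : ℕ →₀ ℕ} {m : X} (h : IsWeight e w m) : IsGood e m := by
  refine ⟨⟨w.support.sup id + 1, fun i hi => ?_⟩, fun i => ⟨w i + 1, ?_⟩⟩
  · have : w i = 0 := by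
      by_contra h0
      have h1 : id i ≤ w.support.sup id := Finset.le_sup (Finsupp.mem_support_iff.2 h0)
      simp only [id] at h1
      omega
    rw [h, this, Nat.cast_zero, zero_smul]
  · rw [aeval_of_eigen (h i), fallingPoly, Finset.prod_range_succ, eval_mul]
    simp

theorem isGood_zero : IsGood e 0 := ⟨⟨0, fun _ _ => map_zero _⟩, fun _ => ⟨0, map_zero _⟩⟩

theorem IsGood.add {m m' : X} (h : IsGood e m) (h' : IsGood e m') : IsGood e (m + m') := by
  obtain ⟨⟨n, hn⟩, hN⟩ := h
  obtain ⟨⟨n', hn'⟩, hN'⟩ := h'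
  refine ⟨⟨max n n', fun i hi => ?_⟩, fun i => ?_⟩
  · rw [map_add, hn i (le_of_max_le_left hi), hn' i (le_of_max_le_right hi), add_zero]
  · obtain ⟨N, hN⟩ := hN i
    obtain ⟨N', hN'⟩ := hN' i
    exact ⟨max N N', by rw [map_add, aeval_fallingPoly_of_le (le_max_left _ _) hN,
      aeval_fallingPoly_of_le (le_max_right _ _) hN', add_zero]⟩

theorem IsGood.smul {m : X} (h : IsGood e m) (c : k) : IsGood e (c • m) := by
  obtain ⟨⟨n, hn⟩, hN⟩ := h
  refine ⟨⟨n, fun i hi => ?_⟩, fun i => ?_⟩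
  · rw [map_smul, hn i hi, smul_zero]
  · obtain ⟨N, hN⟩ := hN i
    exact ⟨N, by rw [map_smul, hN, smul_zero]⟩

theorem IsGood.map {m : X} (h : IsGood e m) (g : X →ₗ[k] Y)
    (hg : ∀ i x, g (e i x) = e' i (g x)) : IsGood e' (g m) := by
  obtain ⟨⟨n, hn⟩, hN⟩ := h
  refine ⟨⟨n, fun i hi => ?_⟩, fun i => ?_⟩
  · rw [← hg, hn i hi, map_zero]
  · obtain ⟨N, hN⟩ := hN i
    exact ⟨N, by rw [← map_aeval g (hg i), hN, map_zero]⟩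

/-- Goodness is phrased by annihilating polynomials, and so passes to subobjects as readily as to
quotients. This is what makes it usable for arbitrary subquotients. -/
theorem isGood_of_injective (g : X →ₗ[k] Y) (hg : ∀ i x, g (e i x) = e' i (g x))
    (hinj : Function.Injective g) {m : X} (h : IsGood e' (g m)) : IsGood e m := by
  obtain ⟨⟨n, hn⟩, hN⟩ := h
  refine ⟨⟨n, fun i hi => hinj ?_⟩, fun i => ?_⟩
  · rw [hg, hn i hi, map_zero]
  · obtain ⟨N, hN⟩ := hN i
    exact ⟨N, hinj (by rw [map_aeval g (hg i), hN, map_zero])⟩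

theorem isGood_of_span {I : Type*} (s : I → X) (hs : ∀ i, IsGood e (s i))
    (hspan : Submodule.span k (Set.range s) = ⊤) (m : X) : IsGood e m := by
  have hm : m ∈ Submodule.span k (Set.range s) := by rw [hspan]; trivial
  induction hm using Submodule.span_induction with
  | mem m hm =>
    obtain ⟨i, rfl⟩ := hm
    exact hs i
  | zero => exact isGood_zero
  | add x y _ _ hx hy => exact hx.add hy
  | smul c x _ hx => exact hx.smul c

theorem commute_aeval {S T : Module.End k X} (h : Commute S T) (p : k[X]) (x : X) :
    S (aeval T p x) = aeval T p (S x) :=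
  map_aeval S (fun y => congrArg (fun f : Module.End k X => f y) h.eq) p x

variable [CharZero k]

/-- Weight vectors lift along maps compatible with the weight operators. -/
theorem exists_isWeight_lift (hcomm : ∀ i j, Commute (e i) (e j)) (g : X →ₗ[k] Y)
    (hg : ∀ i x, g (e i x) = e' i (g x)) {x : X} (hx : IsGood e x) {w : ℕ →₀ ℕ}
    (hw : IsWeight e' w (g x)) : ∃ y, IsWeight e w y ∧ g y = g x := by
  obtain ⟨n₀, hn₀⟩ := hx.1
  set n := max n₀ (w.support.sup id + 1)
  have hwn : ∀ i, n ≤ i → w i = 0 := by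
    intro i hi
    by_contra h0
    have h1 : id i ≤ w.support.sup id := Finset.le_sup (Finsupp.mem_support_iff.2 h0)
    have h2 := (le_max_right n₀ (w.support.sup id + 1)).trans hi
    simp only [id] at h1
    omega
  -- Project onto the required eigenspaces one variable at a time. Finitely many steps suffice,
  -- since from `n` on the operators kill the vector and `w` vanishes.
  have key : ∀ m, ∃ y, IsGood e y ∧ (∀ i < m, e i y = (w i : k) • y) ∧
      (∀ i, n ≤ i → e i y = 0) ∧ g y = g x := by
    intro m
    induction m with
    | zero =>
      exact ⟨x, hx, fun i hi => absurd hi (Nat.not_lt_zero i),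
        fun i hi => hn₀ i ((le_max_left _ _).trans hi), rfl⟩
    | succ m ih =>
      obtain ⟨y, hy, hym, hyn, hgy⟩ := ih
      obtain ⟨N, hN⟩ := hy.2 m
      -- Enlarged so that the eigenvalue `w m` is among the roots `0, …, N' - 1`. These are distinct
      -- in characteristic zero, so the product `q` of the other factors, divided by its value at `w
      -- m`, gives a projection onto the `w m`-eigenspace which fixes `g x`.
      let N' := max N (w m + 1)
      have hN' := aeval_fallingPoly_of_le (le_max_left N (w m + 1)) hN
      have hmem : w m ∈ Finset.range N' :=
        Finset.mem_range.2 (lt_of_lt_of_le (Nat.lt_succ_self _) (le_max_right _ _))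
      let q : k[X] := ∏ j ∈ (Finset.range N').erase (w m), (Polynomial.X - C (j : k))
      have hq : (Polynomial.X - C ((w m : ℕ) : k)) * q = fallingPoly k N' :=
        Finset.mul_prod_erase _ (fun j : ℕ => (Polynomial.X - C (j : k))) hmem
      have hc : q.eval (w m : k) ≠ 0 := by
        rw [eval_prod, Finset.prod_ne_zero_iff]
        intro j hj
        rw [eval_sub, eval_X, eval_C, sub_ne_zero]
        exact fun h => (Finset.ne_of_mem_erase hj) (Nat.cast_injective h).symm
      let f : Module.End k X := (q.eval (w m : k))⁻¹ • aeval (e m) q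
      have hf : ∀ i z, f (e i z) = e i (f z) := by
        intro i z
        simp only [f, LinearMap.smul_apply, map_smul, commute_aeval (hcomm i m)]
      refine ⟨f y, hy.map f hf, fun i hi => ?_, fun i hi => ?_, ?_⟩
      · rcases Nat.lt_succ_iff_lt_or_eq.1 hi with hi | rfl
        · rw [← hf, hym i hi, map_smul]
        · have h1 : aeval (e i) ((Polynomial.X - C ((w i : ℕ) : k)) * q) y = 0 := by
            rw [hq]; exact hN'
          rw [map_mul, map_sub, aeval_X, aeval_C, Module.End.mul_apply, LinearMap.sub_apply,
            Module.algebraMap_end_apply, sub_eq_zero] at h1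
          simp only [f, LinearMap.smul_apply, map_smul, h1]
          rw [smul_comm]
      · rw [← hf, hyn i hi, map_zero]
      · simp only [f, LinearMap.smul_apply, map_smul, map_aeval g (hg m), hgy]
        rw [aeval_of_eigen (hw m), inv_smul_smul₀ hc]
  obtain ⟨y, -, hy1, hy2, hy3⟩ := key n
  refine ⟨y, fun i => ?_, hy3⟩
  rcases lt_or_ge i n with hi | hi
  · exact hy1 i hi
  · rw [hy2 i hi, hwn i hi, Nat.cast_zero, zero_smul]

omit [CharZero k] in
-- Apply the factors `T - 0`, `T - 1`, … in turn; the last nonzero vector before the product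
-- vanishes is an eigenvector.
theorem exists_eigen_of_fallingPoly {T : Module.End k X} {y : X} (hy : y ≠ 0) {N : ℕ}
    (hN : aeval T (fallingPoly k N) y = 0) : ∃ (q : k[X]) (j : ℕ), aeval T q y ≠ 0 ∧
      T (aeval T q y) = (j : k) • aeval T q y := by
  induction N with
  | zero => exact absurd (by simpa [fallingPoly] using hN) hy
  | succ N ih =>
    by_cases h : aeval T (fallingPoly k N) y = 0
    · exact ih h
    · refine ⟨fallingPoly k N, N, h, ?_⟩
      rw [fallingPoly, Finset.prod_range_succ, mul_comm, map_mul, map_sub, aeval_X, aeval_C,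
        Module.End.mul_apply, LinearMap.sub_apply, Module.algebraMap_end_apply, sub_eq_zero] at hN
      exact hN

omit [CharZero k] in
theorem exists_isWeight_ne_zero (hcomm : ∀ i j, Commute (e i) (e j)) {x : X} (hx : IsGood e x)
    (hx0 : x ≠ 0) : ∃ w y, IsWeight e w y ∧ y ≠ 0 := by
  obtain ⟨n, hn⟩ := hx.1
  have key : ∀ m, ∃ (w : ℕ → ℕ) (y : X), IsGood e y ∧ y ≠ 0 ∧ (∀ i < m, e i y = (w i : k) • y) ∧
      (∀ i, n ≤ i → e i y = 0) := by
    intro m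
    induction m with
    | zero => exact ⟨0, x, hx, hx0, fun i hi => absurd hi (Nat.not_lt_zero i), hn⟩
    | succ m ih =>
      obtain ⟨w, y, hy, hy0, hym, hyn⟩ := ih
      obtain ⟨N, hN⟩ := hy.2 m
      obtain ⟨q, j, hq0, hq⟩ := exists_eigen_of_fallingPoly hy0 hN
      refine ⟨Function.update w m j, aeval (e m) q y,
        hy.map (aeval (e m) q) (fun i z => (commute_aeval (hcomm i m) q z).symm), hq0,
        fun i hi => ?_, fun i hi => ?_⟩
      · rcases Nat.lt_succ_iff_lt_or_eq.1 hi with hi | rfl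
        · rw [commute_aeval (hcomm i m), hym i hi, map_smul, Function.update_of_ne hi.ne]
        · rw [hq, Function.update_self]
      · rw [commute_aeval (hcomm i m), hyn i hi, map_zero]
  obtain ⟨w, y, -, hy0, hy1, hy2⟩ := key n
  refine ⟨Finsupp.onFinset (Finset.range n) (fun i => if i < n then w i else 0) ?_, y, ?_, hy0⟩
  · intro i hi
    by_contra h
    exact hi (if_neg (fun h' => h (Finset.mem_range.2 h')))
  · intro i
    rw [Finsupp.onFinset_apply]
    split_ifs with h
    · exact hy1 i h
    · rw [hy2 i (not_lt.1 h), Nat.cast_zero, zero_smul]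

/-- If `X` is spanned by weight vectors, then each weight space is spanned by those of the
given vectors that have this weight. -/
theorem mem_span_of_isWeight {I : Type*} (s : I → X) (w : I → ℕ →₀ ℕ)
    (hs : ∀ i, IsWeight e (w i) (s i)) (hspan : Submodule.span k (Set.range s) = ⊤)
    {w₀ : ℕ →₀ ℕ} {z : X} (hz : IsWeight e w₀ z) :
    z ∈ Submodule.span k (s '' {i | w i = w₀}) := by
  -- Diagonal operators on the free module over `I`, making the map to `X` compatible with the
  -- weight operators. The weight vector lifts to this module, where having weight `w₀` just means
  -- being supported on the indices of that weight.
  let d : ℕ → Module.End k (I →₀ k) := fun n =>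
    Finsupp.linearCombination k fun i => Finsupp.single i (w i n : k)
  have hd : ∀ n f i, d n f i = (w i n : k) * f i := by
    intro n f i
    induction f using Finsupp.induction_linear with
    | zero => simp
    | add f g hf hg => rw [map_add, Finsupp.add_apply, hf, hg, Finsupp.add_apply, mul_add]
    | single j c =>
      simp only [d, Finsupp.linearCombination_single, Finsupp.smul_single, smul_eq_mul]
      by_cases h : j = i
      · subst h; simp [mul_comm]
      · simp [Finsupp.single_eq_of_ne (Ne.symm h)]
  have hcomm : ∀ i j, Commute (d i) (d j) := by
    intro i j
    refine LinearMap.ext fun f => Finsupp.ext fun l => ?_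
    simp only [Module.End.mul_apply, hd]
    ring
  let g := Finsupp.linearCombination k s
  have hg : ∀ n f, g (d n f) = e n (g f) := by
    intro n f
    induction f using Finsupp.induction_linear with
    | zero => simp
    | add f f' hf hf' => simp only [map_add, hf, hf']
    | single j c =>
      simp only [d, g, Finsupp.linearCombination_single, Finsupp.smul_single, smul_eq_mul,
        map_smul, hs j n, smul_smul]
  have hgood : ∀ f, IsGood d f := by
    intro f
    induction f using Finsupp.induction_linear with
    | zero => exact isGood_zero
    | add f f' hf hf' => exact hf.add hf'
    | single j c =>
      refine IsWeight.isGood (w := w j) fun n => Finsupp.ext fun i => ?_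
      rw [hd, Finsupp.smul_apply, smul_eq_mul]
      by_cases h : j = i
      · subst h; rfl
      · simp [Finsupp.single_eq_of_ne (Ne.symm h)]
  have hz' : z ∈ Submodule.span k (Set.range s) := by rw [hspan]; trivial
  obtain ⟨f, hf⟩ := (Finsupp.mem_span_range_iff_exists_finsupp).1 hz'
  have hf' : g f = z := by rw [← hf]; exact Finsupp.linearCombination_apply k f
  obtain ⟨f', hf'w, hgf'⟩ := exists_isWeight_lift hcomm g hg (hgood f) (by rw [hf']; exact hz)
  rw [← hf', ← hgf', Finsupp.mem_span_image_iff_linearCombination]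
  refine ⟨f', ?_, rfl⟩
  rw [Finsupp.mem_supported]
  intro i hi
  rw [Finset.mem_coe, Finsupp.mem_support_iff] at hi
  ext n
  have h := congrArg (fun f => f i) (hf'w n)
  simp only [hd, Finsupp.smul_apply, smul_eq_mul] at h
  exact_mod_cast mul_right_cancel₀ hi h

end Abstract

end Weight


/-! ### Equivariant maps on tensor powers -/

section LieTensorHom

variable {k L M N ι : Type*} [Field k] [LieRing L] [LieAlgebra k L] [AddCommGroup M] [Module k M]
  [LieRingModule L M] [LieModule k L M] [AddCommGroup N] [Module k N]
  [LieRingModule L N] [LieModule k L N] [Fintype ι] [DecidableEq ι]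

/-- A linear map on a tensor power is equivariant if it is so on pure tensors. -/
def tensorHom (F : (⨂[k] _ : ι, M) →ₗ[k] N) (hF : ∀ (x : L) (v : ι → M),
    F ⁅x, PiTensorProduct.tprod k v⁆ = ⁅x, F (PiTensorProduct.tprod k v)⁆) :
    (⨂[k] _ : ι, M) →ₗ⁅k, L⁆ N where
  toLinearMap := F
  map_lie' {x t} := by
    induction t using PiTensorProduct.induction_on with
    | smul_tprod c v =>
      change F ⁅x, c • _⁆ = ⁅x, F (c • _)⁆
      rw [lie_smul, map_smul, map_smul, lie_smul, hF]
    | add s t hs ht =>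
      change F ⁅x, s + t⁆ = ⁅x, F (s + t)⁆
      rw [lie_add, map_add, map_add, lie_add]
      exact congrArg₂ _ hs ht

omit [LieAlgebra k L] [LieModule k L M] [LieModule k L N] in
theorem lieModuleHom_sum_apply {I : Type*} (s : Finset I) (f : I → M →ₗ⁅k, L⁆ N) (m : M) :
    (∑ i ∈ s, f i) m = ∑ i ∈ s, f i m := by
  classical
  induction s using Finset.induction_on with
  | empty => rfl
  | insert i s his ih =>
    rw [Finset.sum_insert his, Finset.sum_insert his, LieModuleHom.add_apply, ih]

end LieTensorHom

/-- Pure tensors of members of a spanning family span the tensor power. -/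
theorem span_tprod_of_span {k E I ι : Type*} [Field k] [AddCommGroup E] [Module k E] [Nonempty I]
    [Finite ι] (g : I → E) (hg : Submodule.span k (Set.range g) = ⊤) :
    Submodule.span k (Set.range fun c : ι → I => PiTensorProduct.tprod k fun i => g (c i)) = ⊤ := by
  classical
  rw [eq_top_iff, ← PiTensorProduct.span_tprod_eq_top, Submodule.span_le]
  rintro _ ⟨v, rfl⟩
  refine pi_span_induction (k := k) (κ := fun _ => I) (fun _ i => g i) (fun _ => hg)
    (fun v => PiTensorProduct.tprod k v ∈ Submodule.span k (Set.range fun c : ι → I =>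
      PiTensorProduct.tprod k fun i => g (c i))) ?_ ?_ ?_ v
  · exact fun c => Submodule.subset_span ⟨c, rfl⟩
  · intro z t x y hx hy
    rw [MultilinearMap.map_update_add]
    exact Submodule.add_mem _ hx hy
  · intro z t c x hx
    rw [MultilinearMap.map_update_smul]
    exact Submodule.smul_mem _ c hx

/-! ### Weights given by families of indices -/

/-- The weight which counts how often each number occurs in a family. -/
def countWeight {ι : Type*} [Fintype ι] (a : ι → ℕ) : ℕ →₀ ℕ := ∑ i, Finsupp.single (a i) 1

theorem countWeight_apply {ι : Type*} [Fintype ι] (a : ι → ℕ) (n : ℕ) :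
    countWeight a n = (Finset.univ.filter fun i => a i = n).card := by
  rw [countWeight, Finsupp.finsetSum_apply, Finset.card_filter]
  exact Finset.sum_congr rfl fun i _ => Finsupp.single_apply

/-- Since `j` is injective all multiplicities are at most one, so `a` is injective too and has the
same image. -/
theorem exists_equiv_of_countWeight_eq {ι κ : Type*} [Fintype ι] [Fintype κ] {a : κ → ℕ}
    {j : ι → ℕ} (hj : Function.Injective j) (h : countWeight a = countWeight j) :
    ∃ b : κ ≃ ι, ∀ s, j (b s) = a s := by
  have h' : ∀ n, (Finset.univ.filter fun i => a i = n).card =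
      (Finset.univ.filter fun i => j i = n).card := fun n => by
    rw [← countWeight_apply, ← countWeight_apply, h]
  have hle : ∀ n, (Finset.univ.filter fun i => j i = n).card ≤ 1 := fun n => by
    rw [Finset.card_le_one]
    intro x hx y hy
    exact hj ((Finset.mem_filter.1 hx).2.trans (Finset.mem_filter.1 hy).2.symm)
  have h1 : ∀ s, ∃ i, j i = a s := fun s => by
    have : 0 < (Finset.univ.filter fun i => j i = a s).card := by
      rw [← h']
      exact Finset.card_pos.2 ⟨s, by simp⟩
    obtain ⟨i, hi⟩ := Finset.card_pos.1 this
    exact ⟨i, (Finset.mem_filter.1 hi).2⟩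
  have h2 : ∀ i, ∃ s, a s = j i := fun i => by
    have : 0 < (Finset.univ.filter fun s => a s = j i).card := by
      rw [h']
      exact Finset.card_pos.2 ⟨i, by simp⟩
    obtain ⟨s, hs⟩ := Finset.card_pos.1 this
    exact ⟨s, (Finset.mem_filter.1 hs).2⟩
  have ha : Function.Injective a := fun s t hst => by
    have := (h' (a t)).le.trans (hle (a t))
    rw [Finset.card_le_one] at this
    exact this s (by simp [hst]) t (by simp)
  choose b hb using h1
  refine ⟨Equiv.ofBijective b ⟨fun s t hst => ha ?_, fun i => ?_⟩, hb⟩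
  · rw [← hb, ← hb, hst]
  · obtain ⟨s, hs⟩ := h2 i
    exact ⟨s, hj ((hb s).trans hs)⟩

namespace Operad

open Weight

variable {k : Type u} [Field k] (P : Operad k)

/-- The action of `h` on the tensor powers of `V`. -/
instance tensorVLieRingModule (ι : Type*) [Fintype ι] [DecidableEq ι] :
    LieRingModule P.h (⨂[k] _ : ι, P.V) := tensorLieRingModule

/-! ### Weight spaces of representations -/

section WeightModules

variable (M : Type u) [AddCommGroup M] [Module k M] [LieRingModule P.h M] [LieModule k P.h M]

/-- The action of the Euler derivations on a representation. -/
def eulerEnd (i : ℕ) : Module.End k M := LieModule.toEnd k P.h M (P.euler i)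

theorem eulerEnd_apply (i : ℕ) (m : M) : P.eulerEnd M i m = ⁅P.euler i, m⁆ := rfl

theorem commute_eulerEnd (i j : ℕ) : Commute (P.eulerEnd M i) (P.eulerEnd M j) := by
  refine LinearMap.ext fun m => ?_
  change ⁅P.euler i, ⁅P.euler j, m⁆⁆ = ⁅P.euler j, ⁅P.euler i, m⁆⁆
  rw [leibniz_lie, euler_comm, zero_lie, zero_add]

/-- Representations which are sums of weight spaces. -/
def IsGoodModule : Prop := ∀ m : M, IsGood (P.eulerEnd M) m

variable {M}

/-- Weight vectors of a representation. -/
def HasWeight (w : ℕ →₀ ℕ) (m : M) : Prop := IsWeight (P.eulerEnd M) w m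

variable {P} {N : Type u} [AddCommGroup N] [Module k N] [LieRingModule P.h N] [LieModule k P.h N]

theorem map_eulerEnd (g : M →ₗ⁅k, P.h⁆ N) (i : ℕ) (x : M) :
    (g : M →ₗ[k] N) (P.eulerEnd M i x) = P.eulerEnd N i ((g : M →ₗ[k] N) x) :=
  g.map_lie _ _

theorem HasWeight.map {w : ℕ →₀ ℕ} {m : M} (h : P.HasWeight w m) (g : M →ₗ⁅k, P.h⁆ N) :
    P.HasWeight w (g m) := fun n =>
  (map_eulerEnd g n m).symm.trans ((congrArg g (h n)).trans (g.map_smul _ _))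

theorem IsGoodModule.of_surjective (hM : P.IsGoodModule M) (g : M →ₗ⁅k, P.h⁆ N)
    (hg : Function.Surjective g) : P.IsGoodModule N := fun n => by
  obtain ⟨m, rfl⟩ := hg n
  exact (hM m).map (g : M →ₗ[k] N) (map_eulerEnd g)

theorem IsGoodModule.of_injective (hN : P.IsGoodModule N) (g : M →ₗ⁅k, P.h⁆ N)
    (hg : Function.Injective g) : P.IsGoodModule M := fun m =>
  isGood_of_injective (g : M →ₗ[k] N) (map_eulerEnd g) hg (hN (g m))

theorem IsGoodModule.exists_lift [CharZero k] (hM : P.IsGoodModule M) (g : M →ₗ⁅k, P.h⁆ N)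
    {w : ℕ →₀ ℕ} {m : M} (h : P.HasWeight w (g m)) : ∃ m', P.HasWeight w m' ∧ g m' = g m :=
  exists_isWeight_lift (P.commute_eulerEnd M) (g : M →ₗ[k] N) (map_eulerEnd g) (hM m) h

theorem isGoodModule_directSum {I : Type*} {X : I → Type u} [∀ i, AddCommGroup (X i)]
    [∀ i, Module k (X i)] [∀ i, LieRingModule P.h (X i)] [∀ i, LieModule k P.h (X i)]
    (hX : ∀ i, P.IsGoodModule (X i)) (m : ⨁ i, X i) :
    IsGood (fun i => LieModule.toEnd k P.h (⨁ i, X i) (P.euler i)) m := by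
  classical
  induction m using DirectSum.induction_on with
  | zero => exact isGood_zero
  | of i x =>
    exact IsGood.map (e := P.eulerEnd (X i)) (hX i x)
      (DirectSum.lieModuleOf k I P.h X i : X i →ₗ[k] ⨁ i, X i)
      fun n y => (DirectSum.lieModuleOf k I P.h X i).map_lie (P.euler n) y
  | add x y hx hy => exact hx.add hy

theorem hasWeight_tprod {ι : Type} [Fintype ι] [DecidableEq ι] {w : ι → ℕ →₀ ℕ} {v : ι → M}
    (h : ∀ i, P.HasWeight (w i) (v i)) :
    P.HasWeight (∑ i, w i) (PiTensorProduct.tprod k v) := by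
  intro n
  rw [eulerEnd_apply, lie_tprod, Finsupp.finsetSum_apply, Nat.cast_sum, Finset.sum_smul]
  refine Finset.sum_congr rfl fun i _ => ?_
  rw [← P.eulerEnd_apply M, h i n, MultilinearMap.map_update_smul, Function.update_eq_self]

end WeightModules

/-! ### Weight vectors in tensor powers of `V` -/

/-- The data of an element `p(x_{a_1}, …, x_{a_r})`. -/
abbrev MonomialData : Type u := Σ r : ℕ, P.obj (Fin r) × (Fin r → ℕ)

instance : Nonempty P.MonomialData := ⟨⟨0, 0, 0⟩⟩

/-- The element `p(x_{a_1}, …, x_{a_r})` of `V`. -/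
def monomial (c : P.MonomialData) : P.V := (P.free P.W).act c.2.1 fun i => P.x (c.2.2 i)

theorem span_monomial : Submodule.span k (Set.range P.monomial) = ⊤ := by
  rw [eq_top_iff]
  rintro v -
  induction v using V_induction with
  | hact r p a => exact Submodule.subset_span ⟨⟨r, p, a⟩, rfl⟩
  | hzero => exact Submodule.zero_mem _
  | hadd v w hv hw => exact Submodule.add_mem _ hv hw
  | hsmul c v hv => exact Submodule.smul_mem _ c hv

theorem hasWeight_monomial (c : P.MonomialData) :
    P.HasWeight (countWeight c.2.2) (P.monomial c) := by
  intro n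
  rw [eulerEnd_apply, monomial, lie_act, countWeight, Finsupp.finsetSum_apply, Nat.cast_sum,
    Finset.sum_smul]
  refine Finset.sum_congr rfl fun i _ => ?_
  rw [elem_x, Finsupp.single_apply]
  by_cases h : c.2.2 i = n
  · subst h
    rw [if_pos rfl, if_pos rfl, Nat.cast_one, one_smul,
      Function.update_eq_self i (fun i => P.x (c.2.2 i))]
  · rw [if_neg h, if_neg h, Nat.cast_zero, zero_smul]
    exact MultilinearMap.map_update_zero _ _ _

section Tensor

variable {ι κ : Type} [Fintype ι] [DecidableEq ι] [Fintype κ] [DecidableEq κ]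

/-- The pure tensor of the elements `p_t(x_{a_{t,1}}, …)`. -/
def tensorMonomial (c : κ → P.MonomialData) : ⨂[k] _ : κ, P.V :=
  PiTensorProduct.tprod k fun t => P.monomial (c t)

omit [DecidableEq κ] in
variable (κ) in
theorem span_tensorMonomial :
    Submodule.span k (Set.range (P.tensorMonomial (κ := κ))) = ⊤ :=
  span_tprod_of_span P.monomial P.span_monomial

theorem hasWeight_tensorMonomial (c : κ → P.MonomialData) :
    P.HasWeight (∑ t, countWeight (c t).2.2) (P.tensorMonomial c) :=
  hasWeight_tprod fun t => P.hasWeight_monomial (c t)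

variable (κ) in
theorem isGoodModule_tensor : P.IsGoodModule (⨂[k] _ : κ, P.V) :=
  isGood_of_span P.tensorMonomial (fun c => (P.hasWeight_tensorMonomial c).isGood)
    (P.span_tensorMonomial κ)

theorem lie_tprod_V (δ : P.h) (v : ι → P.V) : ⁅δ, PiTensorProduct.tprod k v⁆ =
    ∑ i, PiTensorProduct.tprod k (Function.update v i ⁅δ, v i⁆) :=
  lie_tprod δ v

/-- The pure tensor of the generators `x_{j(i)}`. -/
def tensorGen (j : ι → ℕ) : ⨂[k] _ : ι, P.V := PiTensorProduct.tprod k fun i => P.x (j i)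

/-! ### Generation of the tensor powers -/

/-- Replace the factors `x_{a(i)}` by `v i` one at a time, with the derivation that sends `x_{a(i)}`
to `v i` and kills the other generators. No `v i'` involves the variables `x_{a(i)}`, so only the
intended factor contributes. -/
theorem tprod_mem_of_tprod_mem (N : LieSubmodule k P.h (⨂[k] _ : ι, P.V)) {a : ι → ℕ}
    (ha : Function.Injective a) (v : ι → P.V)
    (hv : ∀ i i' w, ⁅P.elem (a i) w, v i'⁆ = 0) (h : P.tensorGen a ∈ N) :
    PiTensorProduct.tprod k v ∈ N := by
  have key : ∀ s : Finset ι,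
      PiTensorProduct.tprod k (s.piecewise v fun i => P.x (a i)) ∈ N := by
    intro s
    induction s using Finset.induction_on with
    | empty => simpa [tensorGen] using h
    | insert i s his ih =>
      have h1 : ⁅P.elem (a i) (v i),
          PiTensorProduct.tprod k (s.piecewise v fun i => P.x (a i))⁆ ∈ N := N.lie_mem ih
      rw [lie_tprod_V, Finset.sum_eq_single i] at h1
      · rw [Finset.piecewise_insert]
        rwa [Finset.piecewise_eq_of_notMem _ _ _ his, elem_x_self] at h1
      · intro l _ hl
        have h0 : ⁅P.elem (a i) (v i), s.piecewise v (fun i => P.x (a i)) l⁆ = 0 := by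
          by_cases hls : l ∈ s
          · rw [Finset.piecewise_eq_of_mem _ _ _ hls, hv]
          · rw [Finset.piecewise_eq_of_notMem _ _ _ hls, elem_x_of_ne _ (fun h' => hl (ha h'))]
        rw [h0]
        exact MultilinearMap.map_update_zero _ _ _
      · exact fun h' => absurd (Finset.mem_univ i) h'
  simpa using key Finset.univ

/-- The entries of an arbitrary pure tensor may involve the variables `x_{j(i)}`. So pass first to
fresh variables, beyond all those occurring in `v` and `j`, and from these to `v`. -/
theorem eq_top_of_tensorGen_mem {j : ι → ℕ} (hj : Function.Injective j)
    (N : LieSubmodule k P.h (⨂[k] _ : ι, P.V)) (h : P.tensorGen j ∈ N) : N = ⊤ := by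
  rw [← LieSubmodule.toSubmodule_eq_top, eq_top_iff, ← PiTensorProduct.span_tprod_eq_top,
    Submodule.span_le]
  rintro _ ⟨v, rfl⟩
  choose b hb using fun i => P.exists_bound (v i)
  let n₀ := Finset.univ.sup b + Finset.univ.sup j + 1
  let a : ι → ℕ := fun i => n₀ + Fintype.equivFin ι i
  have hba : ∀ i i', b i ≤ a i' := fun i i' => by
    have : b i ≤ Finset.univ.sup b := Finset.le_sup (Finset.mem_univ i)
    simp only [a, n₀]
    omega
  have hja : ∀ i i', a i ≠ j i' := fun i i' => by
    have : j i' ≤ Finset.univ.sup j := Finset.le_sup (Finset.mem_univ i')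
    simp only [a, n₀]
    omega
  have ha : Function.Injective a := fun i i' hi =>
    (Fintype.equivFin ι).injective (Fin.ext (Nat.add_left_cancel hi))
  have h1 : P.tensorGen a ∈ N := P.tprod_mem_of_tprod_mem N hj _
    (fun i i' w => P.elem_x_of_ne (hja i' i) w) h
  exact P.tprod_mem_of_tprod_mem N ha v (fun i i' w => hb i' _ (hba i' i) w) h1

variable {P} in
theorem tensor_hom_ext {M : Type u} [AddCommGroup M] [Module k M] [LieRingModule P.h M]
    [LieModule k P.h M] {j : ι → ℕ} (hj : Function.Injective j)
    {f g : (⨂[k] _ : ι, P.V) →ₗ⁅k, P.h⁆ M} (h : f (P.tensorGen j) = g (P.tensorGen j)) :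
    f = g := by
  have h1 : (f - g).ker = ⊤ := P.eq_top_of_tensorGen_mem hj _ (by
    rw [LieModuleHom.mem_ker, LieModuleHom.sub_apply, h, sub_self])
  refine LieModuleHom.ext fun m => ?_
  have h2 : m ∈ (f - g).ker := by rw [h1]; trivial
  rwa [LieModuleHom.mem_ker, LieModuleHom.sub_apply, sub_eq_zero] at h2

/-! ### Substitution maps between tensor powers -/

/-- The multilinear map which sends `v` to the pure tensor of the elements `q_t (v_{b(t, s)})_s`. -/
def substMultilinear {S : κ → Type} [∀ t, Finite (S t)] (q : ∀ t, P.obj (S t))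
    (b : (Σ t, S t) ≃ ι) : MultilinearMap k (fun _ : ι => P.V) (⨂[k] _ : κ, P.V) :=
  have hu : ∀ [DecidableEq ι] (v : ι → P.V) (y : Σ t, S t) (u : P.V) [∀ t, DecidableEq (S t)],
      (fun t => (P.free P.W).act (q t) fun s => Function.update v (b y) u (b ⟨t, s⟩)) =
        Function.update (fun t => (P.free P.W).act (q t) fun s => v (b ⟨t, s⟩)) y.1
          ((P.free P.W).act (q y.1) (Function.update (fun s => v (b ⟨y.1, s⟩)) y.2 u)) := by
    rintro _ v ⟨t, s⟩ u _
    ext1 t'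
    by_cases h : t' = t
    · subst h
      simp only [Function.update_self]
      congr 1
      ext1 s'
      by_cases hs : s' = s
      · subst hs; simp
      · simp [hs]
    · simp [h]
  { toFun := fun v => PiTensorProduct.tprod k fun t =>
      (P.free P.W).act (q t) fun s => v (b ⟨t, s⟩)
    map_update_add' := by
      classical
      intro _ v i x y
      obtain ⟨y', rfl⟩ := b.surjective i
      simp only [hu, MultilinearMap.map_update_add]
    map_update_smul' := by
      classical
      intro _ v i c x
      obtain ⟨y', rfl⟩ := b.surjective i
      simp only [hu, MultilinearMap.map_update_smul] }

omit [Fintype ι] [DecidableEq ι] [Fintype κ] in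
theorem substMultilinear_apply {S : κ → Type} [∀ t, Finite (S t)] (q : ∀ t, P.obj (S t))
    (b : (Σ t, S t) ≃ ι) (v : ι → P.V) : P.substMultilinear q b v =
      PiTensorProduct.tprod k fun t => (P.free P.W).act (q t) fun s => v (b ⟨t, s⟩) := rfl

/-- Grouping the tensor factors into blocks and applying an operation to each block commutes with
`h` by the Leibniz rule. -/
theorem exists_subst {S : κ → Type} [∀ t, Fintype (S t)] [∀ t, DecidableEq (S t)]
    (q : ∀ t, P.obj (S t)) (b : (Σ t, S t) ≃ ι) :
    ∃ f : (⨂[k] _ : ι, P.V) →ₗ⁅k, P.h⁆ (⨂[k] _ : κ, P.V), ∀ v : ι → P.V,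
      f (PiTensorProduct.tprod k v) =
        PiTensorProduct.tprod k fun t => (P.free P.W).act (q t) fun s => v (b ⟨t, s⟩) := by
  refine ⟨tensorHom (PiTensorProduct.lift (P.substMultilinear q b)) ?_, fun v => ?_⟩
  · intro δ v
    rw [lie_tprod, map_sum, PiTensorProduct.lift.tprod, substMultilinear_apply, lie_tprod,
      ← b.sum_comp, Fintype.sum_sigma]
    refine Finset.sum_congr rfl fun t _ => ?_
    rw [lie_act]
    let F := (PiTensorProduct.tprod k (s := fun _ : κ => P.V)).toLinearMap
      (fun t => (P.free P.W).act (q t) fun s => v (b ⟨t, s⟩)) t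
    have hF : ∀ y, PiTensorProduct.tprod k (Function.update
      (fun t => (P.free P.W).act (q t) fun s => v (b ⟨t, s⟩)) t y) = F y := fun y => rfl
    rw [hF, map_sum]
    refine Finset.sum_congr rfl fun s _ => ?_
    rw [← hF, PiTensorProduct.lift.tprod, substMultilinear_apply]
    congr 1
    ext1 t'
    by_cases h : t' = t
    · subst h
      simp only [Function.update_self]
      congr 1
      ext1 s'
      by_cases hs : s' = s
      · subst hs; simp
      · simp [hs]
    · simp [h]
  · exact PiTensorProduct.lift.tprod (φ := P.substMultilinear q b) v

variable [CharZero k]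

/-- A vector of multilinear weight is a combination of monomial tensors using each `x_{j(i)}`
exactly once. The placement of the variables is then a bijection, and `exists_subst` sends the
generator to that monomial. -/
theorem exists_hom_tensor {j : ι → ℕ} (hj : Function.Injective j) {z : ⨂[k] _ : κ, P.V}
    (hz : P.HasWeight (countWeight j) z) :
    ∃ f : (⨂[k] _ : ι, P.V) →ₗ⁅k, P.h⁆ (⨂[k] _ : κ, P.V), f (P.tensorGen j) = z := by
  have h := mem_span_of_isWeight (P.tensorMonomial (κ := κ))
    (fun c => ∑ t, countWeight (c t).2.2) (fun c => P.hasWeight_tensorMonomial c)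
    (P.span_tensorMonomial κ) hz
  clear hz
  induction h using Submodule.span_induction with
  | mem z hz =>
    obtain ⟨c, hc, rfl⟩ := hz
    have h1 : countWeight (fun y : Σ t, Fin (c t).1 => (c y.1).2.2 y.2) = countWeight j := by
      rw [← (show _ = _ from hc), countWeight, Fintype.sum_sigma]
      rfl
    obtain ⟨b, hb⟩ := exists_equiv_of_countWeight_eq hj h1
    obtain ⟨f, hf⟩ := P.exists_subst (fun t => (c t).2.1) b
    refine ⟨f, ?_⟩
    rw [tensorGen, hf]
    simp only [hb]
    rfl
  | zero => exact ⟨0, rfl⟩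
  | add x y _ _ hx hy =>
    obtain ⟨f, rfl⟩ := hx
    obtain ⟨g, rfl⟩ := hy
    exact ⟨f + g, rfl⟩
  | smul a x _ hx =>
    obtain ⟨f, rfl⟩ := hx
    exact ⟨a • f, rfl⟩

end Tensor

/-! ### Polynomial representations -/

variable {P} {M N : Type u} [AddCommGroup M] [Module k M] [LieRingModule P.h M] [LieModule k P.h M]
  [AddCommGroup N] [Module k N] [LieRingModule P.h N] [LieModule k P.h N]

theorem isGoodModule_submodule_directSum {I : Type u} (d : I → ℕ)
    (A : LieSubmodule k P.h (⨁ i : I, ⨂[k] _ : Fin (d i), P.V)) : P.IsGoodModule A := by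
  intro a
  refine isGood_of_injective (X := A) (Y := ⨁ i : I, ⨂[k] _ : Fin (d i), P.V) (e := P.eulerEnd A)
    (e' := fun i => LieModule.toEnd k P.h _ (P.euler i)) A.toSubmodule.subtype
    (fun _ _ => rfl) Subtype.val_injective ?_
  exact isGoodModule_directSum (fun i => P.isGoodModule_tensor (Fin (d i))) a.1

theorem IsPolynomial.isGoodModule (hM : P.IsPolynomial M) : P.IsGoodModule M := by
  obtain ⟨I, d, A, f, hf⟩ := hM
  exact (isGoodModule_submodule_directSum d A).of_surjective f hf

theorem IsPolynomial.of_surjective (hM : P.IsPolynomial M) (g : M →ₗ⁅k, P.h⁆ N)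
    (hg : Function.Surjective g) : P.IsPolynomial N := by
  obtain ⟨I, d, A, f, hf⟩ := hM
  exact ⟨I, d, A, g.comp f, hg.comp hf⟩

theorem isPolynomial_directSum {I : Type u} (d : I → ℕ) :
    P.IsPolynomial (⨁ i : I, ⨂[k] _ : Fin (d i), P.V) :=
  ⟨I, d, ⊤, (⊤ : LieSubmodule k P.h _).incl, fun m => ⟨⟨m, trivial⟩, rfl⟩⟩

/-- The universal property of the tensor powers. Lift `m` to a weight vector of a submodule of a
direct sum of tensor powers, and treat its finitely many components by `exists_hom_tensor`. -/
theorem IsPolynomial.exists_hom [CharZero k] (hM : P.IsPolynomial M) {ι : Type} [Fintype ι]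
    [DecidableEq ι] {j : ι → ℕ} (hj : Function.Injective j) {m : M}
    (hm : P.HasWeight (countWeight j) m) :
    ∃ f : (⨂[k] _ : ι, P.V) →ₗ⁅k, P.h⁆ M, f (P.tensorGen j) = m := by
  classical
  have hgood := hM.isGoodModule
  obtain ⟨I, d, A, g, hg⟩ := hM
  obtain ⟨a₀, rfl⟩ := hg m
  have hA := isGoodModule_submodule_directSum d A
  obtain ⟨a, ha, hga⟩ := hA.exists_lift g hm
  have hc : ∀ i, P.HasWeight (countWeight j) (a.1 i) := fun i =>
    ha.map ((DirectSum.lieModuleComponent k I P.h _ i).comp A.incl)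
  choose f hf using fun i => P.exists_hom_tensor hj (hc i)
  let F : (⨂[k] _ : ι, P.V) →ₗ⁅k, P.h⁆ (⨁ i : I, ⨂[k] _ : Fin (d i), P.V) :=
    ∑ i ∈ DFinsupp.support a.1, (DirectSum.lieModuleOf k I P.h _ i).comp (f i)
  have hF : F (P.tensorGen j) = a.1 := by
    have : F (P.tensorGen j) = ∑ i ∈ DFinsupp.support a.1,
        DirectSum.lieModuleOf k I P.h (fun i => ⨂[k] _ : Fin (d i), P.V) i
          (f i (P.tensorGen j)) := by
      exact lieModuleHom_sum_apply _ _ _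
    rw [this]
    simp only [hf]
    exact DirectSum.sum_support_of a.1
  have hFA : ∀ m, F m ∈ A := by
    intro m
    -- The map lands in `A` because it sends a generator of the source into `A`.
    have h1 : A.comap F = ⊤ := P.eq_top_of_tensorGen_mem hj _ (by
      rw [LieSubmodule.mem_comap, hF]; exact a.2)
    have h2 : m ∈ A.comap F := by rw [h1]; trivial
    exact h2
  refine ⟨g.comp (F.codRestrict A hFA), ?_⟩
  rw [← hga]
  exact congrArg g (Subtype.ext hF)

end Operad


/-! ### Permutations of tensor factors -/

section Permutations

variable {k L M N ι κ : Type*} [Field k] [LieRing L] [LieAlgebra k L] [AddCommGroup M] [Module k M]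
  [LieRingModule L M] [LieModule k L M] [AddCommGroup N] [Module k N]
  [LieRingModule L N] [LieModule k L N] [Fintype ι] [DecidableEq ι] [Fintype κ] [DecidableEq κ]

omit [LieModule k L N] in
theorem tensorHom_ext {f g : (⨂[k] _ : ι, M) →ₗ⁅k, L⁆ N}
    (h : ∀ v : ι → M, f (PiTensorProduct.tprod k v) = g (PiTensorProduct.tprod k v)) : f = g := by
  refine LieModuleHom.ext fun t => ?_
  induction t using PiTensorProduct.induction_on with
  | smul_tprod c v => rw [map_smul, map_smul, h]
  | add s t hs ht => rw [map_add, map_add, hs, ht]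

variable (k L M) in
/-- Relabelling the factors of a tensor power. -/
def reindexHom (e : ι ≃ κ) : (⨂[k] _ : ι, M) →ₗ⁅k, L⁆ (⨂[k] _ : κ, M) :=
  tensorHom (PiTensorProduct.reindex k (fun _ : ι => M) e).toLinearMap (by
    have h1 : ∀ v : ι → M, (PiTensorProduct.reindex k (fun _ : ι => M) e).toLinearMap
        (PiTensorProduct.tprod k v) = PiTensorProduct.tprod k fun i => v (e.symm i) :=
      fun v => PiTensorProduct.reindex_tprod e v
    intro x v
    rw [lie_tprod, map_sum, h1, lie_tprod]
    refine Fintype.sum_equiv e _ _ fun i => ?_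
    rw [h1]
    congr 1
    ext1 j
    by_cases h : j = e i
    · subst h
      simp only [Function.update_self, Equiv.symm_apply_apply]
    · rw [Function.update_of_ne h, Function.update_of_ne]
      rintro rfl
      simp at h)

theorem reindexHom_tprod (e : ι ≃ κ) (v : ι → M) :
    reindexHom k L M e (PiTensorProduct.tprod k v) =
      PiTensorProduct.tprod k fun i => v (e.symm i) :=
  PiTensorProduct.reindex_tprod e v

theorem reindexHom_symm_apply (e : ι ≃ κ) (t : ⨂[k] _ : ι, M) :
    reindexHom k L M e.symm (reindexHom k L M e t) = t := by
  have : (reindexHom k L M e.symm).comp (reindexHom k L M e) = LieModuleHom.id := by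
    refine tensorHom_ext fun v => ?_
    rw [LieModuleHom.comp_apply, reindexHom_tprod, reindexHom_tprod]
    simp
  exact LieModuleHom.congr_fun this t

omit [Fintype ι] [DecidableEq ι] in
theorem tensorPermRep_tprod (σ : Equiv.Perm ι) (v : ι → M) :
    Operad.tensorPermRep k ι M σ (PiTensorProduct.tprod k v) =
      PiTensorProduct.tprod k fun i => v (σ.symm i) :=
  PiTensorProduct.reindex_tprod σ v

variable (L M) in
/-- The action of the group algebra of the permutations of `ι` on a tensor power. -/
def permHom (a : MonoidAlgebra k (Equiv.Perm ι)) : (⨂[k] _ : ι, M) →ₗ⁅k, L⁆ (⨂[k] _ : ι, M) where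
  toLinearMap := (Operad.tensorPermRep k ι M).asAlgebraHom a
  map_lie' {x t} := by
    change (Operad.tensorPermRep k ι M).asAlgebraHom a ⁅x, t⁆ =
      ⁅x, (Operad.tensorPermRep k ι M).asAlgebraHom a t⁆
    induction a using MonoidAlgebra.induction_on with
    | of σ =>
      rw [Representation.asAlgebraHom_of]
      exact lie_tensorPermRep σ x t
    | add a b ha hb => rw [map_add, LinearMap.add_apply, ha, hb, LinearMap.add_apply, lie_add]
    | smul c a ha => rw [map_smul, LinearMap.smul_apply, ha, LinearMap.smul_apply, lie_smul]

theorem permHom_of (σ : Equiv.Perm ι) (v : ι → M) :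
    permHom L M (MonoidAlgebra.of k _ σ) (PiTensorProduct.tprod k v) =
      PiTensorProduct.tprod k fun i => v (σ.symm i) := by
  change (Operad.tensorPermRep k ι M).asAlgebraHom _ _ = _
  rw [Representation.asAlgebraHom_of, tensorPermRep_tprod]

theorem permHom_mul (a b : MonoidAlgebra k (Equiv.Perm ι)) (t : ⨂[k] _ : ι, M) :
    permHom L M (a * b) t = permHom L M a (permHom L M b t) := by
  change (Operad.tensorPermRep k ι M).asAlgebraHom _ _ = _
  rw [map_mul]
  rfl

theorem permHom_one (t : ⨂[k] _ : ι, M) :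
    permHom L M (1 : MonoidAlgebra k (Equiv.Perm ι)) t = t := by
  change (Operad.tensorPermRep k ι M).asAlgebraHom _ _ = _
  rw [map_one]
  rfl

theorem permHom_add (a b : MonoidAlgebra k (Equiv.Perm ι)) (t : ⨂[k] _ : ι, M) :
    permHom L M (a + b) t = permHom L M a t + permHom L M b t := by
  change (Operad.tensorPermRep k ι M).asAlgebraHom _ _ = _
  rw [map_add]
  rfl

theorem permHom_smul (c : k) (a : MonoidAlgebra k (Equiv.Perm ι)) (t : ⨂[k] _ : ι, M) :
    permHom L M (c • a) t = c • permHom L M a t := by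
  change (Operad.tensorPermRep k ι M).asAlgebraHom _ _ = _
  rw [map_smul]
  rfl

theorem permHom_zero (t : ⨂[k] _ : ι, M) :
    permHom L M (0 : MonoidAlgebra k (Equiv.Perm ι)) t = 0 := by
  change (Operad.tensorPermRep k ι M).asAlgebraHom _ _ = _
  rw [map_zero]
  rfl

/-- The Young symmetrizer acts through the group algebra. -/
theorem youngSymmetrizer_apply (μ : YoungDiagram) (t : ⨂[k] _ : μ.cells, M) :
    youngSymmetrizer k L M μ t =
      permHom L M (YoungTableau.symmetrizer k (Equiv.refl μ.cells)) t := by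
  rw [YoungTableau.symmetrizer, permHom_mul]
  have h1 : ∀ t : ⨂[k] _ : μ.cells, M,
      permHom L M (YoungTableau.rowSum k (Equiv.refl μ.cells)) t =
      (∑ σ : Equiv.Perm μ.cells with ∀ c, (σ c).1.1 = c.1.1,
        Operad.tensorPermRep k μ.cells M σ) t := by
    intro t
    change (Operad.tensorPermRep k μ.cells M).asAlgebraHom _ t = _
    rw [YoungTableau.rowSum, map_sum]
    simp only [Representation.asAlgebraHom_of]
    rfl
  have h2 : permHom L M (YoungTableau.colSum k (Equiv.refl μ.cells)) t =
      (∑ τ : Equiv.Perm μ.cells with ∀ c, (τ c).1.2 = c.1.2,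
        (Equiv.Perm.sign τ : ℤ) • Operad.tensorPermRep k μ.cells M τ) t := by
    change (Operad.tensorPermRep k μ.cells M).asAlgebraHom _ t = _
    rw [YoungTableau.colSum, map_sum]
    simp only [map_zsmul, Representation.asAlgebraHom_of]
    rfl
  rw [h1, h2]
  rfl

/-- Transport of a Young symmetrizer along a tableau. -/
theorem permHom_symmetrizer {μ : YoungDiagram} (T : ι ≃ μ.cells) (t : ⨂[k] _ : ι, M) :
    reindexHom k L M T (permHom L M (YoungTableau.symmetrizer k T) t) =
      youngSymmetrizer k L M μ (reindexHom k L M T t) := by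
  have hof : ∀ (σ : Equiv.Perm ι) (t : ⨂[k] _ : ι, M),
      reindexHom k L M T (permHom L M (MonoidAlgebra.of k _ σ) t) =
        permHom L M (MonoidAlgebra.of k _ (T.permCongr σ)) (reindexHom k L M T t) := by
    intro σ t
    have : (reindexHom k L M T).comp (permHom L M (MonoidAlgebra.of k _ σ)) =
        (permHom L M (MonoidAlgebra.of k _ (T.permCongr σ))).comp (reindexHom k L M T) := by
      refine tensorHom_ext fun v => ?_
      rw [LieModuleHom.comp_apply, LieModuleHom.comp_apply, permHom_of, reindexHom_tprod,
        reindexHom_tprod, permHom_of]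
      congr 1
      ext1 i
      simp [Equiv.permCongr_def]
    exact LieModuleHom.congr_fun this t
  let D := MonoidAlgebra.domCongr k k T.permCongrHom
  have hlin : ∀ (a : MonoidAlgebra k (Equiv.Perm ι)) (t : ⨂[k] _ : ι, M),
      reindexHom k L M T (permHom L M a t) =
        permHom L M (D a) (reindexHom k L M T t) := by
    intro a t
    induction a using MonoidAlgebra.induction_on with
    | of σ =>
      rw [hof]
      congr 2
      simp [D, MonoidAlgebra.of_apply]
    | add a b ha hb =>
      rw [permHom_add, map_add, ha, hb, map_add, permHom_add]
    | smul c a ha =>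
      rw [permHom_smul, map_smul, ha, map_smul, permHom_smul]
  rw [youngSymmetrizer_apply, YoungTableau.symmetrizer, YoungTableau.symmetrizer, permHom_mul,
    permHom_mul, hlin, hlin]
  have hr : D (YoungTableau.rowSum k T) = YoungTableau.rowSum k (Equiv.refl μ.cells) := by
    rw [YoungTableau.rowSum, YoungTableau.rowSum, map_sum]
    refine Finset.sum_equiv T.permCongr (fun σ => ?_) fun σ _ => by
      simp [D, MonoidAlgebra.of_apply]
    simp only [Finset.mem_filter, Finset.mem_univ, true_and]
    exact ⟨fun h x => by simpa using h (T.symm x), fun h x => by simpa using h (T x)⟩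
  have hc : D (YoungTableau.colSum k T) = YoungTableau.colSum k (Equiv.refl μ.cells) := by
    rw [YoungTableau.colSum, YoungTableau.colSum, map_sum]
    refine Finset.sum_equiv T.permCongr (fun σ => ?_) fun σ _ => by
      simp [D, MonoidAlgebra.of_apply]
    simp only [Finset.mem_filter, Finset.mem_univ, true_and]
    exact ⟨fun h x => by simpa using h (T.symm x), fun h x => by simpa using h (T x)⟩
  rw [hr, hc]

end Permutations

namespace Operad

open Weight

variable {k : Type u} [Field k] (P : Operad k)

/-! ### Multilinear weight vectors -/

theorem exists_countWeight (w : ℕ →₀ ℕ) : ∃ (n : ℕ) (a : Fin n → ℕ), countWeight a = w := by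
  induction w using Finsupp.induction_linear with
  | zero => exact ⟨0, Fin.elim0, rfl⟩
  | add f g hf hg =>
    obtain ⟨n, a, rfl⟩ := hf
    obtain ⟨m, b, rfl⟩ := hg
    refine ⟨n + m, Fin.append a b, ?_⟩
    simp [countWeight, Fin.sum_univ_add]
  | single i c =>
    refine ⟨c, fun _ => i, ?_⟩
    simp [countWeight]

/-- Stated additively, since subtraction of natural numbers truncates. -/
theorem countWeight_update {ι : Type*} [Fintype ι] [DecidableEq ι] (a : ι → ℕ) (s : ι) (j : ℕ) :
    countWeight (Function.update a s j) + Finsupp.single (a s) 1 =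
      countWeight a + Finsupp.single j 1 := by
  rw [countWeight, countWeight, ← Finset.add_sum_erase _ _ (Finset.mem_univ s),
    ← Finset.add_sum_erase Finset.univ (fun i => Finsupp.single (a i) 1) (Finset.mem_univ s),
    Function.update_self]
  have : ∑ i ∈ Finset.univ.erase s, Finsupp.single (Function.update a s j i) 1 =
      ∑ i ∈ Finset.univ.erase s, Finsupp.single (a i) 1 :=
    Finset.sum_congr rfl fun i hi => by rw [Function.update_of_ne (Finset.ne_of_mem_erase hi)]
  rw [this]
  abel

variable {P} {M N : Type u} [AddCommGroup M] [Module k M] [LieRingModule P.h M] [LieModule k P.h M]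

theorem euler_lie_transfer {w : ℕ →₀ ℕ} {m : M} (hm : P.HasWeight w m) (i j n : ℕ) :
    ⁅P.euler n, ⁅P.transfer i j, m⁆⁆ =
      ((w n : k) + (if n = j then 1 else 0) - (if n = i then 1 else 0)) • ⁅P.transfer i j, m⁆ := by
  have h := hm n
  rw [eulerEnd_apply] at h
  rw [leibniz_lie, euler_transfer, smul_lie, h, lie_smul, ← add_smul]
  congr 1
  ring

variable [CharZero k]

/-- The vector would have weight `-1` in the variable `x_i`, but no product of factors `T - l` with
`l` natural annihilates a nonzero eigenvector of eigenvalue `-1` in characteristic zero. -/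
theorem transfer_lie_eq_zero (hM : P.IsGoodModule M) {w : ℕ →₀ ℕ} {m : M} (hm : P.HasWeight w m)
    {i j : ℕ} (hij : i ≠ j) (hi : w i = 0) : ⁅P.transfer i j, m⁆ = 0 := by
  obtain ⟨N, hN⟩ := (hM ⁅P.transfer i j, m⁆).2 i
  have h := euler_lie_transfer hm i j i
  rw [if_neg hij, if_pos rfl, hi, Nat.cast_zero, add_zero, zero_sub, ← P.eulerEnd_apply M] at h
  rw [aeval_of_eigen h, smul_eq_zero] at hN
  refine hN.resolve_left ?_
  rw [fallingPoly, Polynomial.eval_prod]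
  refine Finset.prod_ne_zero_iff.2 fun l _ => ?_
  rw [Polynomial.eval_sub, Polynomial.eval_X, Polynomial.eval_C, ← neg_add', neg_ne_zero]
  have : ((1 + l : ℕ) : k) ≠ 0 := Nat.cast_ne_zero.2 (by omega)
  push_cast at this
  exact this

/-- An `sl_2` computation: `x_i ∂/∂x_j` kills `m` as `w j = 0`, so applying it after `x_j ∂/∂x_i`
multiplies `m` by `w i - w j = w i`. -/
theorem transfer_lie_ne_zero (hM : P.IsGoodModule M) {w : ℕ →₀ ℕ} {m : M} (hm : P.HasWeight w m)
    (hm0 : m ≠ 0) {i j : ℕ} (hj : w j = 0) (hi : w i ≠ 0) : ⁅P.transfer i j, m⁆ ≠ 0 := by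
  intro h
  have hij : j ≠ i := by rintro rfl; exact hi hj
  have h1 := leibniz_lie (P.transfer j i) (P.transfer i j) m
  have h2 := hm i
  have h3 := hm j
  rw [eulerEnd_apply] at h2 h3
  rw [h, transfer_lie_eq_zero hM hm hij hj, lie_zero, lie_zero, add_zero, transfer_transfer,
    sub_lie, h2, h3, hj, Nat.cast_zero, zero_smul, sub_zero] at h1
  exact (smul_ne_zero (Nat.cast_ne_zero.2 hi) hm0) h1.symm

/-- A nonzero sum of weight spaces contains a nonzero weight vector which is multilinear. -/
theorem IsGoodModule.exists_multilinear (hM : P.IsGoodModule M) [Nontrivial M] :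
    ∃ (n : ℕ) (j : Fin n → ℕ) (m : M), Function.Injective j ∧ P.HasWeight (countWeight j) m ∧
      m ≠ 0 := by
  obtain ⟨x, hx⟩ := exists_ne (0 : M)
  obtain ⟨w, y, hw, hy⟩ := exists_isWeight_ne_zero (P.commute_eulerEnd M) (hM x) hx
  obtain ⟨n, a, rfl⟩ := exists_countWeight w
  -- Polarisation, by induction on the number of coincidences among the indices: one occurrence of a
  -- repeated index is moved to a fresh `j`, which keeps the vector nonzero and adds a value.
  have key : ∀ (d : ℕ) (a : Fin n → ℕ) (y : M), n - (Finset.univ.image a).card = d →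
      P.HasWeight (countWeight a) y → y ≠ 0 → ∃ (j : Fin n → ℕ) (m : M), Function.Injective j ∧
        P.HasWeight (countWeight j) m ∧ m ≠ 0 := by
    intro d
    induction d using Nat.strong_induction_on with
    | _ d ih =>
      intro a y hd hw hy
      by_cases ha : Function.Injective a
      · exact ⟨a, y, ha, hw, hy⟩
      · rw [Function.Injective] at ha
        push Not at ha
        obtain ⟨s, t, hst, hne⟩ := ha
        obtain ⟨j, hj⟩ := Infinite.exists_notMem_finset (Finset.univ.image a)
        have hj' : ∀ i, a i ≠ j := fun i hi =>
          hj (Finset.mem_image.2 ⟨i, Finset.mem_univ i, hi⟩)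
        have hsub : insert j (Finset.univ.image a) ⊆
            Finset.univ.image (Function.update a s j) := by
          intro i hi
          rw [Finset.mem_insert] at hi
          rw [Finset.mem_image]
          rcases hi with rfl | hi
          · exact ⟨s, Finset.mem_univ s, Function.update_self _ _ _⟩
          · obtain ⟨l, -, rfl⟩ := Finset.mem_image.1 hi
            by_cases hl : l = s
            · subst hl
              exact ⟨t, Finset.mem_univ t, by rw [Function.update_of_ne (Ne.symm hne), hst]⟩
            · exact ⟨l, Finset.mem_univ l, by rw [Function.update_of_ne hl]⟩
        have hcard := Finset.card_le_card hsub
        rw [Finset.card_insert_of_notMem hj] at hcard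
        have hle : (Finset.univ.image (Function.update a s j)).card ≤ n := by
          simpa using Finset.card_image_le (s := (Finset.univ : Finset (Fin n)))
            (f := Function.update a s j)
        have hwj : countWeight a j = 0 := by
          rw [countWeight_apply, Finset.card_eq_zero, Finset.filter_eq_empty_iff]
          exact fun i _ => hj' i
        have hws : countWeight a (a s) ≠ 0 := by
          rw [countWeight_apply]
          exact (Finset.card_pos.2 ⟨s, by simp⟩).ne'
        refine ih _ (by omega) (Function.update a s j) ⁅P.transfer (a s) j, y⁆ rfl ?_
          (transfer_lie_ne_zero hM hw hy hwj hws)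
        intro l
        rw [eulerEnd_apply, euler_lie_transfer hw]
        congr 1
        have h1 := congrArg (fun f : ℕ →₀ ℕ => (f l : k)) (countWeight_update a s j)
        simp only [Finsupp.add_apply, Nat.cast_add, Finsupp.single_apply] at h1
        simp only [eq_comm (a := l)]
        push_cast at h1
        rw [← h1]
        ring
  obtain ⟨j, m, h⟩ := key _ a y rfl hw hy
  exact ⟨n, j, m, h⟩

end Operad


/-! ### Direct summands, and independence of permuted tensors -/

section LieModules

variable {k L M N : Type*} [Field k] [LieRing L] [LieAlgebra k L] [AddCommGroup M] [Module k M]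
  [LieRingModule L M] [LieModule k L M] [AddCommGroup N] [Module k N]
  [LieRingModule L N] [LieModule k L N]

omit [LieAlgebra k L] [LieModule k L M] [LieModule k L N] in
theorem nonempty_lieModuleEquiv_of_bijective (f : M →ₗ⁅k, L⁆ N) (hf : Function.Bijective f) :
    Nonempty (M ≃ₗ⁅k, L⁆ N) :=
  let e := LinearEquiv.ofBijective (f : M →ₗ[k] N) hf
  ⟨{ f with
      invFun := e.symm
      left_inv := e.left_inv
      right_inv := e.right_inv }⟩

omit [LieAlgebra k L] [LieModule k L M] in
/-- The projection onto a direct summand. -/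
theorem exists_projection_of_isCompl {A B : LieSubmodule k L M} (h : IsCompl A B) :
    ∃ p : M →ₗ⁅k, L⁆ M, (∀ a ∈ A, p a = a) ∧ ∀ b ∈ B, p b = 0 := by
  have h' : IsCompl A.toSubmodule B.toSubmodule := LieSubmodule.isCompl_toSubmodule.2 h
  let p : M →ₗ[k] M := A.toSubmodule.subtype ∘ₗ Submodule.projectionOnto _ _ h'
  have hA : ∀ a ∈ A, p a = a := fun a ha =>
    congrArg Subtype.val (Submodule.projectionOnto_apply_left h' ⟨a, ha⟩)
  have hB : ∀ b ∈ B, p b = 0 := fun b hb =>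
    congrArg Subtype.val (Submodule.projectionOnto_apply_right h' ⟨b, hb⟩)
  refine ⟨{ p with map_lie' := ?_ }, hA, hB⟩
  intro x m
  obtain ⟨a, ha, b, hb, rfl⟩ := Submodule.mem_sup.1
    (show m ∈ A.toSubmodule ⊔ B.toSubmodule by rw [h'.sup_eq_top]; trivial)
  change p ⁅x, a + b⁆ = ⁅x, p (a + b)⁆
  rw [lie_add, map_add, map_add, hA a ha, hB b hb, hA _ (A.lie_mem ha), hB _ (B.lie_mem hb),
    add_zero, add_zero]

/-- The product of the functionals dual to `v`, permuted by `σ`, takes the value 1 on the tensor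
permuted by `σ` and 0 on every other permutation of it. It therefore reads off the coefficient of
`σ`. -/
theorem eq_zero_of_permHom_tprod {ι : Type*} [Fintype ι] [DecidableEq ι] (v : ι → M)
    (φ : ι → M →ₗ[k] k) (hφ : ∀ i i', φ i (v i') = if i' = i then 1 else 0)
    {a : MonoidAlgebra k (Equiv.Perm ι)} (ha : permHom L M a (PiTensorProduct.tprod k v) = 0) :
    a = 0 := by
  refine MonoidAlgebra.coeff_injective (Finsupp.ext fun σ => ?_)
  let ψ : (⨂[k] _ : ι, M) →ₗ[k] k := PiTensorProduct.lift
    ((MultilinearMap.mkPiAlgebra k ι k).compLinearMap fun i => φ (σ.symm i))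
  have hψ : ∀ b : MonoidAlgebra k (Equiv.Perm ι),
      ψ (permHom L M b (PiTensorProduct.tprod k v)) = b.coeff σ := by
    intro b
    induction b using MonoidAlgebra.induction_on with
    | of τ =>
      rw [permHom_of]
      simp only [ψ]
      rw [PiTensorProduct.lift.tprod, MultilinearMap.compLinearMap_apply,
        MultilinearMap.mkPiAlgebra_apply]
      simp only [hφ, MonoidAlgebra.of_apply, MonoidAlgebra.coeff_single, Finsupp.single_apply]
      by_cases h : τ = σ
      · subst h
        simp
      · rw [if_neg h]
        have : ∃ i, τ.symm i ≠ σ.symm i := by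
          by_contra! h'
          exact h (Equiv.symm_bijective.injective (Equiv.ext h'))
        obtain ⟨i, hi⟩ := this
        exact Finset.prod_eq_zero (Finset.mem_univ i) (if_neg hi)
    | add b c hb hc => rw [permHom_add, map_add, hb, hc]; rfl
    | smul s b hb => rw [permHom_smul, map_smul, hb]; rfl
  rw [← hψ, ha, map_zero]
  rfl

end LieModules

namespace Operad

open Weight

variable {k : Type u} [Field k] (P : Operad k)

/-! ### Projectivity and endomorphisms of the tensor powers of `V` -/

section Tensor

variable {ι κ : Type} [Fintype ι] [DecidableEq ι] [Fintype κ] [DecidableEq κ]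

variable (κ) in
theorem isPolynomial_tensor : P.IsPolynomial (⨂[k] _ : κ, P.V) := by
  let d : PUnit.{u + 1} → ℕ := fun _ => Fintype.card κ
  refine (isPolynomial_directSum (P := P) d).of_surjective
    ((reindexHom k P.h P.V (Fintype.equivFin κ).symm).comp
      (DirectSum.lieModuleComponent k PUnit P.h (fun i => ⨂[k] _ : Fin (d i), P.V) PUnit.unit)) ?_
  intro t
  refine ⟨DirectSum.lieModuleOf k PUnit P.h (fun i => ⨂[k] _ : Fin (d i), P.V) PUnit.unit
    (reindexHom k P.h P.V (Fintype.equivFin κ) t), ?_⟩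
  have h : DirectSum.lieModuleComponent k PUnit P.h (fun i => ⨂[k] _ : Fin (d i), P.V) PUnit.unit
      (DirectSum.lieModuleOf k PUnit P.h (fun i => ⨂[k] _ : Fin (d i), P.V) PUnit.unit
        (reindexHom k P.h P.V (Fintype.equivFin κ) t)) =
      reindexHom k P.h P.V (Fintype.equivFin κ) t :=
    DirectSum.of_eq_same (β := fun i => ⨂[k] _ : Fin (d i), P.V) PUnit.unit _
  exact (congrArg (reindexHom k P.h P.V (Fintype.equivFin κ).symm) h).trans
    (reindexHom_symm_apply _ _)

theorem hasWeight_tensorGen (j : ι → ℕ) : P.HasWeight (countWeight j) (P.tensorGen j) := by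
  refine hasWeight_tprod (w := fun i => Finsupp.single (j i) 1) fun i n => ?_
  rw [eulerEnd_apply, elem_x, Finsupp.single_apply]
  by_cases h : j i = n
  · subst h
    rw [if_pos rfl, if_pos rfl, Nat.cast_one, one_smul]
  · rw [if_neg h, if_neg h, Nat.cast_zero, zero_smul]

variable (ι) in
-- A lift of a map is found by lifting the image of the generator to a vector of the same weight;
-- two maps that agree on the generator are equal.
theorem isProjectivePolynomial_tensor [CharZero k] :
    P.IsProjectivePolynomial (⨂[k] _ : ι, P.V) := by
  refine ⟨P.isPolynomial_tensor ι, ?_⟩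
  intro X Y _ _ _ _ _ _ _ _ hX hY g f hg
  let j : ι → ℕ := fun i => Fintype.equivFin ι i
  have hj : Function.Injective j := fun i i' h => (Fintype.equivFin ι).injective (Fin.ext h)
  obtain ⟨x, hx⟩ := hg (f (P.tensorGen j))
  have hw : P.HasWeight (countWeight j) (g x) := by
    rw [hx]
    exact (P.hasWeight_tensorGen j).map f
  obtain ⟨y, hy, hgy⟩ := hX.isGoodModule.exists_lift g hw
  obtain ⟨f', hf'⟩ := hX.exists_hom hj hy
  have h : g.comp f' = f := tensor_hom_ext hj (by
    rw [LieModuleHom.comp_apply, hf', hgy, hx])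
  exact ⟨f', fun m => LieModuleHom.congr_fun h m⟩

variable {P} (h0 : Subsingleton (P.obj (Fin 0))) (h1 : Module.finrank k (P.obj (Fin 1)) = 1)

include h0 in
theorem monomial_eq_zero {c : P.MonomialData} (hc : c.1 = 0) : P.monomial c = 0 := by
  obtain ⟨r, p, a⟩ := c
  subst hc
  rw [monomial, Subsingleton.elim p 0, map_zero]
  rfl

include h1 in
theorem exists_monomial_eq_smul {c : P.MonomialData} (hc : c.1 = 1) :
    ∃ (s : k) (n : ℕ), P.monomial c = s • P.x n ∧ countWeight c.2.2 = Finsupp.single n 1 := by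
  obtain ⟨r, p, a⟩ := c
  subst hc
  refine ⟨coord h1 p, a 0, ?_, ?_⟩
  · rw [monomial]
    dsimp only
    rw [← coord_smul_unit h1 p, map_smul, coord_smul_unit]
    exact congrArg (coord h1 p • ·) ((P.free P.W).act_unit _)
  · simp [countWeight]

omit [DecidableEq ι] [DecidableEq κ] in
theorem sum_size_eq {c : κ → P.MonomialData} {j : ι → ℕ}
    (hc : ∑ t, countWeight (c t).2.2 = countWeight j) : ∑ t, (c t).1 = Fintype.card ι := by
  have hd : ∀ {ξ : Type} [Fintype ξ] (a : ξ → ℕ),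
      Finsupp.degree (countWeight a) = Fintype.card ξ := by
    intro ξ _ a
    rw [countWeight, map_sum]
    simp
  have h := congrArg Finsupp.degree hc
  rw [map_sum, hd] at h
  simpa [hd] using h

variable [CharZero k]

omit [DecidableEq ι] in
include h0 in
-- A count of degrees: when `P([0]) = 0`, every factor of a nonzero monomial tensor uses at least
-- one variable.
theorem eq_zero_of_card_lt {j : ι → ℕ} (hlt : Fintype.card ι < Fintype.card κ)
    {z : ⨂[k] _ : κ, P.V} (hz : P.HasWeight (countWeight j) z) : z = 0 := by
  have h := mem_span_of_isWeight (P.tensorMonomial (κ := κ))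
    (fun c => ∑ t, countWeight (c t).2.2) (fun c => P.hasWeight_tensorMonomial c)
    (P.span_tensorMonomial κ) hz
  rw [← Submodule.mem_bot k]
  refine Submodule.span_le.2 ?_ h
  rintro _ ⟨c, hc, rfl⟩
  have h2 := sum_size_eq hc
  have : ∃ t, (c t).1 = 0 := by
    by_contra! h3
    have : ∑ t : κ, 1 ≤ ∑ t, (c t).1 :=
      Finset.sum_le_sum fun t _ => Nat.one_le_iff_ne_zero.2 (h3 t)
    simp only [Finset.sum_const, Finset.card_univ, smul_eq_mul, mul_one] at this
    omega
  obtain ⟨t, ht⟩ := this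
  exact MultilinearMap.map_coord_zero _ t (monomial_eq_zero h0 ht)

include h0 h1 in
/-- The multilinear vectors in a tensor power of `V` are the permutations of one of them. -/
theorem exists_permHom_tensorGen {j : ι → ℕ} (hj : Function.Injective j)
    {z : ⨂[k] _ : ι, P.V} (hz : P.HasWeight (countWeight j) z) :
    ∃ a : MonoidAlgebra k (Equiv.Perm ι), permHom P.h P.V a (P.tensorGen j) = z := by
  have h := mem_span_of_isWeight (P.tensorMonomial (κ := ι))
    (fun c => ∑ t, countWeight (c t).2.2) (fun c => P.hasWeight_tensorMonomial c)
    (P.span_tensorMonomial ι) hz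
  clear hz
  induction h using Submodule.span_induction with
  | mem z hz =>
    obtain ⟨c, hc, rfl⟩ := hz
    have h2 := sum_size_eq hc
    by_cases h3 : ∃ t, (c t).1 = 0
    · obtain ⟨t, ht⟩ := h3
      refine ⟨0, ?_⟩
      rw [permHom_zero]
      exact (MultilinearMap.map_coord_zero _ t (monomial_eq_zero h0 ht)).symm
    · push Not at h3
      -- All arities are at least 1 and their sum is the number of factors, so each is exactly 1.
      -- Since `P([1]) = k`, each factor is then a multiple of a generator.
      have h4 : ∀ t ∈ Finset.univ, 1 = (c t).1 :=
        (Finset.sum_eq_sum_iff_of_le fun t _ => Nat.one_le_iff_ne_zero.2 (h3 t)).1 (by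
          rw [h2]; simp)
      choose s n hs hn using fun t => exists_monomial_eq_smul h1 (h4 t (Finset.mem_univ t)).symm
      have h5 : countWeight n = countWeight j := by
        rw [← (show _ = _ from hc), countWeight]
        exact Finset.sum_congr rfl fun t _ => (hn t).symm
      obtain ⟨b, hb⟩ := exists_equiv_of_countWeight_eq hj h5
      refine ⟨(∏ t, s t) • MonoidAlgebra.of k _ b.symm, ?_⟩
      rw [permHom_smul, tensorGen, permHom_of, tensorMonomial]
      simp only [hs, Equiv.symm_symm, hb]
      exact (MultilinearMap.map_smul_univ _ _ _).symm
  | zero => exact ⟨0, permHom_zero _⟩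
  | add x y _ _ hx hy =>
    obtain ⟨a, rfl⟩ := hx
    obtain ⟨b, rfl⟩ := hy
    exact ⟨a + b, permHom_add _ _ _⟩
  | smul c x _ hx =>
    obtain ⟨a, rfl⟩ := hx
    exact ⟨c • a, permHom_smul _ _ _⟩

include h0 h1 in
-- An endomorphism is determined by the image of the generator, which keeps its multilinear weight
-- and is thus a combination of permutations of the generator.
theorem exists_eq_permHom (f : (⨂[k] _ : ι, P.V) →ₗ⁅k, P.h⁆ (⨂[k] _ : ι, P.V)) :
    ∃ a : MonoidAlgebra k (Equiv.Perm ι), f = permHom P.h P.V a := by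
  let j : ι → ℕ := fun i => Fintype.equivFin ι i
  have hj : Function.Injective j := fun i i' h => (Fintype.equivFin ι).injective (Fin.ext h)
  obtain ⟨a, ha⟩ := exists_permHom_tensorGen h0 h1 hj ((P.hasWeight_tensorGen j).map f)
  exact ⟨a, tensor_hom_ext hj ha.symm⟩

omit [CharZero k] in
include h1 in
theorem eq_zero_of_permHom_tensorGen {j : ι → ℕ} (hj : Function.Injective j)
    {a : MonoidAlgebra k (Equiv.Perm ι)} (ha : permHom P.h P.V a (P.tensorGen j) = 0) :
    a = 0 := by
  refine eq_zero_of_permHom_tprod (fun i => P.x (j i))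
    (fun i => (Finsupp.lapply (j i) : P.W →ₗ[k] k) ∘ₗ linearPart h1) (fun i i' => ?_) ha
  simp only [LinearMap.comp_apply, x, linearPart_ι, Finsupp.lapply_apply, Finsupp.single_apply,
    hj.eq_iff]

end Tensor

/-! ### Young symmetrizers acting on the tensor powers of `V` -/

section Schur

variable {P} {μ : YoungDiagram} {S : Type u} [AddCommGroup S] [Module k S] [LieRingModule P.h S]
  [LieModule k P.h S]

/-- A Lie module `S` is cut out of `M^{⊗ μ}` by the Young symmetrizer of `μ`. -/
structure SchurData (P : Operad k) (M S : Type u) [AddCommGroup M] [Module k M]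
    [LieRingModule P.h M] [LieModule k P.h M] [AddCommGroup S] [Module k S] [LieRingModule P.h S]
    [LieModule k P.h S] (μ : YoungDiagram) where
  /-- The projection onto `S`. -/
  proj : (⨂[k] _ : μ.cells, M) →ₗ⁅k, P.h⁆ S
  /-- The inclusion of `S`. -/
  incl : S →ₗ⁅k, P.h⁆ (⨂[k] _ : μ.cells, M)
  proj_surjective : Function.Surjective proj
  incl_injective : Function.Injective incl
  incl_proj : ∀ t, incl (proj t) =
    permHom P.h M (YoungTableau.symmetrizer k (Equiv.refl μ.cells)) t

namespace SchurData

variable {M : Type u} [AddCommGroup M] [Module k M] [LieRingModule P.h M] [LieModule k P.h M]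

variable (P M μ) in
/-- The Schur functor is cut out by the Young symmetrizer. -/
def schur : SchurData P M (OperadRep.schur k P.h M μ) μ where
  proj := (youngSymmetrizer k P.h M μ).codRestrict _
    fun m => (LieModuleHom.mem_range _ _).2 ⟨m, rfl⟩
  incl := (OperadRep.schur k P.h M μ).incl
  proj_surjective := by
    rintro ⟨m, hm⟩
    obtain ⟨t, rfl⟩ := (LieModuleHom.mem_range _ _).1 hm
    exact ⟨t, rfl⟩
  incl_injective := Subtype.val_injective
  incl_proj t := youngSymmetrizer_apply μ t

variable (D : SchurData P M S μ)

theorem exists_proj_incl [CharZero k] : ∃ c : k, c ≠ 0 ∧ ∀ m, D.proj (D.incl m) = c • m := by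
  obtain ⟨c, hc0, hc⟩ :=
    YoungTableau.exists_symmetrizer_mul_self (k := k) (Equiv.refl μ.cells)
  refine ⟨c, hc0, fun m => ?_⟩
  obtain ⟨t, rfl⟩ := D.proj_surjective m
  refine D.incl_injective ?_
  rw [D.incl_proj, D.incl_proj, ← permHom_mul, hc, permHom_smul, map_smul, D.incl_proj]

end SchurData

variable (D : SchurData P P.V S μ)

include D in
theorem SchurData.isProjectivePolynomial [CharZero k] : P.IsProjectivePolynomial S := by
  refine ⟨(P.isPolynomial_tensor μ.cells).of_surjective _ D.proj_surjective, ?_⟩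
  intro X Y _ _ _ _ _ _ _ _ hX hY g f hg
  obtain ⟨c, hc0, hc⟩ := D.exists_proj_incl
  obtain ⟨f₁, hf₁⟩ := (P.isProjectivePolynomial_tensor μ.cells).2 X Y hX hY g
    (f.comp D.proj) hg
  refine ⟨c⁻¹ • f₁.comp D.incl, fun m => ?_⟩
  rw [LieModuleHom.smul_apply, map_smul, LieModuleHom.comp_apply, hf₁, LieModuleHom.comp_apply,
    hc, map_smul, inv_smul_smul₀ hc0]

theorem symmetrizer_ne_zero {X : Type*} [Fintype X] [DecidableEq X] (T : X ≃ μ.cells) :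
    YoungTableau.symmetrizer k T ≠ 0 := fun h => by
  have := YoungTableau.coeff_one_symmetrizer (k := k) T
  rw [h] at this
  exact zero_ne_one this

section

variable (h1 : Module.finrank k (P.obj (Fin 1)) = 1)

include D h1 in
theorem SchurData.nontrivial : Nontrivial S := by
  let j : μ.cells → ℕ := fun i => Fintype.equivFin μ.cells i
  have hj : Function.Injective j := fun i i' h =>
    (Fintype.equivFin μ.cells).injective (Fin.ext h)
  refine ⟨D.proj (P.tensorGen j), 0, fun h => ?_⟩
  have h2 := congrArg D.incl h
  rw [D.incl_proj, map_zero] at h2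
  exact symmetrizer_ne_zero (k := k) _ (eq_zero_of_permHom_tensorGen h1 hj h2)

variable [CharZero k] (h0 : Subsingleton (P.obj (Fin 0)))

include D h0 h1

/-- Carried to the tensor power, an endomorphism of `S` becomes some `a` in the group algebra, and
`e a e` is a multiple of the symmetrizer `e`. -/
theorem SchurData.end_eq_smul (f : S →ₗ⁅k, P.h⁆ S) : ∃ s : k, ∀ m, f m = s • m := by
  obtain ⟨c, hc0, hc⟩ := D.exists_proj_incl
  obtain ⟨a, ha⟩ := exists_eq_permHom h0 h1 (D.incl.comp (f.comp D.proj))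
  have ha' : ∀ t, D.incl (f (D.proj t)) = permHom P.h P.V a t :=
    fun t => LieModuleHom.congr_fun ha t
  obtain ⟨s, hs⟩ := YoungTableau.exists_symmetrizer_mul_mul_symmetrizer (k := k)
    (Equiv.refl μ.cells) a
  refine ⟨c⁻¹ * c⁻¹ * s, fun m => ?_⟩
  obtain ⟨t, rfl⟩ := D.proj_surjective m
  have h2 : (c * c) • f (D.proj t) = s • D.proj t := by
    refine D.incl_injective ?_
    have h3 : (c * c) • f (D.proj t) =
        D.proj (D.incl (f (D.proj (D.incl (D.proj t))))) := by
      rw [hc, hc, map_smul, smul_smul]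
    rw [h3, D.incl_proj, ha', D.incl_proj, ← permHom_mul, ← permHom_mul, hs,
      permHom_smul, map_smul, D.incl_proj]
  rw [← mul_inv, mul_smul, ← h2, inv_smul_smul₀ (mul_ne_zero hc0 hc0)]

/-- The projection onto a summand is a scalar: if it is zero the first summand vanishes, otherwise
the second does. -/
theorem SchurData.isIndecomposable : P.IsIndecomposable S := by
  refine ⟨D.nontrivial h1, fun A B hAB => ?_⟩
  obtain ⟨p, hpA, hpB⟩ := exists_projection_of_isCompl hAB
  obtain ⟨s, hs⟩ := D.end_eq_smul h1 h0 p
  by_cases h : s = 0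
  · left
    rw [LieSubmodule.eq_bot_iff]
    intro a ha
    rw [← hpA a ha, hs, h, zero_smul]
  · right
    rw [LieSubmodule.eq_bot_iff]
    intro b hb
    have := hpB b hb
    rw [hs] at this
    exact (smul_eq_zero.1 this).resolve_left h

end

end Schur

end Operad


/-! ### Maps out of direct sums, and products of Young symmetrizers -/

section DirectSums

variable {k L M I : Type*} [Field k] [LieRing L] [AddCommGroup M] [Module k M] [LieRingModule L M]
  [DecidableEq I] {Y : I → Type*} [∀ i, AddCommGroup (Y i)] [∀ i, Module k (Y i)]
  [∀ i, LieRingModule L (Y i)]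

/-- The homomorphism on a direct sum given by its components. -/
def sumHom (π : ∀ i, Y i →ₗ⁅k, L⁆ M) : (⨁ i, Y i) →ₗ⁅k, L⁆ M where
  toLinearMap := DirectSum.toModule k I M fun i => (π i : Y i →ₗ[k] M)
  map_lie' {x t} := by
    change DirectSum.toModule k I M (fun i => (π i : Y i →ₗ[k] M)) ⁅x, t⁆ =
      ⁅x, DirectSum.toModule k I M (fun i => (π i : Y i →ₗ[k] M)) t⁆
    induction t using DirectSum.induction_on with
    | zero => rw [lie_zero, map_zero, lie_zero]
    | of i t =>
      have h : ⁅x, DirectSum.lof k I Y i t⁆ = DirectSum.lof k I Y i ⁅x, t⁆ :=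
        ((DirectSum.lieModuleOf k I L Y i).map_lie x t).symm
      refine (congrArg _ h).trans ?_
      rw [DirectSum.toModule_lof]
      exact ((π i).map_lie x t).trans (congrArg (fun m => ⁅x, m⁆)
        (DirectSum.toModule_lof k (φ := fun i => (π i : Y i →ₗ[k] M)) i t).symm)
    | add s t hs ht => rw [lie_add, map_add, hs, ht, map_add, lie_add]

theorem sumHom_of (π : ∀ i, Y i →ₗ⁅k, L⁆ M) (i : I) (t : Y i) :
    sumHom π (DirectSum.of Y i t) = π i t :=
  DirectSum.toModule_lof k (φ := fun i => (π i : Y i →ₗ[k] M)) i t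

theorem exists_component_ne_zero (π : ∀ i, Y i →ₗ⁅k, L⁆ M) {x : ⨁ i, Y i}
    (hx : sumHom π x ≠ 0) : ∃ i, π i (x i) ≠ 0 := by
  classical
  by_contra! h
  refine hx ?_
  rw [← DirectSum.sum_support_of x, map_sum]
  exact Finset.sum_eq_zero fun i _ => (sumHom_of π i _).trans (h i)

end DirectSums

theorem youngSymmetrizer_sandwich {k L M ι : Type*} [Field k] [LieRing L] [LieAlgebra k L]
    [AddCommGroup M] [Module k M] [LieRingModule L M] [LieModule k L M] [Fintype ι]
    [DecidableEq ι] {μ : YoungDiagram} (T : ι ≃ μ.cells) (x a y : MonoidAlgebra k (Equiv.Perm ι))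
    (t : ⨂[k] _ : ι, M) :
    youngSymmetrizer k L M μ (reindexHom k L M T (permHom L M x (permHom L M a (permHom L M y
      (reindexHom k L M T.symm (youngSymmetrizer k L M μ (reindexHom k L M T t))))))) =
    reindexHom k L M T (permHom L M
      (YoungTableau.symmetrizer k T * x * a * y * YoungTableau.symmetrizer k T) t) := by
  rw [← permHom_symmetrizer, ← permHom_symmetrizer, reindexHom_symm_apply, permHom_mul,
    permHom_mul, permHom_mul, permHom_mul]

namespace Operad

open Weight

variable {k : Type u} [Field k] {P : Operad k} {M N : Type u} [AddCommGroup M] [Module k M]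
  [LieRingModule P.h M] [LieModule k P.h M] [AddCommGroup N] [Module k N]
  [LieRingModule P.h N] [LieModule k P.h N]

/-! ### Covers of polynomial representations -/

variable [CharZero k]

omit [LieModule k (↥P.h) N] in
/-- A homomorphism to a polynomial representation whose image contains the multilinear vectors is
surjective. -/
theorem IsPolynomial.surjective_of_multilinear (hM : P.IsPolynomial M) (g : N →ₗ⁅k, P.h⁆ M)
    (h : ∀ (n : ℕ) (j : Fin n → ℕ) (m : M), Function.Injective j →
      P.HasWeight (countWeight j) m → ∃ x, g x = m) : Function.Surjective g := by
  by_contra hg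
  -- A nonzero cokernel would contain a nonzero multilinear vector. It lifts to a multilinear vector
  -- of `M`, which lies in the image.
  have hnt : Nontrivial (M ⧸ g.range) := by
    rw [Function.Surjective] at hg
    push Not at hg
    obtain ⟨m, hm⟩ := hg
    refine ⟨LieSubmodule.Quotient.mk m, 0, fun h0 => ?_⟩
    obtain ⟨x, hx⟩ := (LieModuleHom.mem_range _ _).1 ((LieSubmodule.Quotient.mk_eq_zero _).1 h0)
    exact hm x hx
  have hq : Function.Surjective (LieSubmodule.Quotient.mk' g.range) :=
    LieSubmodule.Quotient.surjective_mk' _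
  obtain ⟨n, j, m, hj, hm, hm0⟩ :=
    (hM.isGoodModule.of_surjective _ hq).exists_multilinear
  obtain ⟨y, rfl⟩ := hq m
  obtain ⟨z, hz, hzm⟩ := hM.isGoodModule.exists_lift (LieSubmodule.Quotient.mk' g.range) hm
  refine hm0 ?_
  rw [← hzm]
  exact (LieSubmodule.Quotient.mk_eq_zero _).2 ((LieModuleHom.mem_range _ _).2 (h n j z hj hz))

theorem exists_minimal_multilinear (hM : P.IsPolynomial M) [Nontrivial M] :
    ∃ (n : ℕ) (j : Fin n → ℕ) (m : M), Function.Injective j ∧ P.HasWeight (countWeight j) m ∧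
      m ≠ 0 ∧ ∀ (n' : ℕ) (j' : Fin n' → ℕ) (m' : M), n' < n → Function.Injective j' →
        P.HasWeight (countWeight j') m' → m' = 0 := by
  classical
  have h := hM.isGoodModule.exists_multilinear
  obtain ⟨j, m, hj, hm, hm0⟩ := Nat.find_spec h
  refine ⟨Nat.find h, j, m, hj, hm, hm0, fun n' j' m' hn hj' hm' => ?_⟩
  by_contra h0
  exact Nat.find_min h hn ⟨j', m', hj', hm', h0⟩

/-! ### Classification of the indecomposable projectives -/

/-- Multilinear vectors of minimal size in a projective polynomial representation are detected by
maps through a tensor power of `V`. -/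
theorem IsProjectivePolynomial.exists_factor (h0 : Subsingleton (P.obj (Fin 0)))
    (hM : P.IsProjectivePolynomial M) {n : ℕ} {j : Fin n → ℕ} {m : M}
    (hm : P.HasWeight (countWeight j) m) (hm0 : m ≠ 0)
    (hmin : ∀ (n' : ℕ) (j' : Fin n' → ℕ) (m' : M), n' < n → Function.Injective j' →
      P.HasWeight (countWeight j') m' → m' = 0) :
    ∃ (α : (⨂[k] _ : Fin n, P.V) →ₗ⁅k, P.h⁆ M) (β : M →ₗ⁅k, P.h⁆ (⨂[k] _ : Fin n, P.V)),
      α (β m) ≠ 0 := by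
  -- One tensor power for each multilinear vector of `M`. The resulting sum covers `M`, and
  -- projectivity splits the cover.
  let I := {q : Σ n : ℕ, (Fin n → ℕ) × M //
    Function.Injective q.2.1 ∧ P.HasWeight (countWeight q.2.1) q.2.2}
  let d : I → ℕ := fun q => q.1.1
  have hπ : ∀ q : I, ∃ f : (⨂[k] _ : Fin (d q), P.V) →ₗ⁅k, P.h⁆ M,
      f (P.tensorGen q.1.2.1) = q.1.2.2 := fun q => hM.1.exists_hom q.2.1 q.2.2
  choose π hπ using hπ
  classical
  have hsurj : Function.Surjective (sumHom π) := by
    refine hM.1.surjective_of_multilinear _ fun n j m hj hm => ?_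
    refine ⟨DirectSum.of (fun i => ⨂[k] _ : Fin (d i), P.V) ⟨⟨n, j, m⟩, hj, hm⟩
      (P.tensorGen j), ?_⟩
    rw [sumHom_of]
    exact hπ ⟨⟨n, j, m⟩, hj, hm⟩
  obtain ⟨s, hs⟩ := hM.2 _ M (isPolynomial_directSum d) hM.1 (sumHom π) LieModuleHom.id hsurj
  obtain ⟨q, hq⟩ := exists_component_ne_zero π (x := s m) (fun h => hm0 ((hs m).symm.trans h))
  let γ : M →ₗ⁅k, P.h⁆ (⨂[k] _ : Fin (d q), P.V) :=
    (DirectSum.lieModuleComponent k I P.h (fun i => ⨂[k] _ : Fin (d i), P.V) q).comp s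
  have hγ : π q (γ m) ≠ 0 := hq
  -- More than `n` factors leave no room for a nonzero vector of the weight of `m`.
  have h1 : ¬ n < d q := fun hlt => hγ (by
    rw [eq_zero_of_card_lt h0 (by simpa using hlt) (hm.map γ), map_zero])
  -- With fewer than `n` factors, the generator goes to a multilinear vector smaller than the
  -- minimal size, hence to zero.
  have h2 : ¬ d q < n := fun hlt => hγ (by
    have h3 : π q = 0 := tensor_hom_ext q.2.1 (by
      rw [hπ, hmin _ _ _ hlt q.2.1 q.2.2]
      rfl)
    rw [h3]
    rfl)
  have h3 : d q = n := by omega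
  refine ⟨(π q).comp (reindexHom k P.h P.V (finCongr h3).symm),
    (reindexHom k P.h P.V (finCongr h3)).comp γ, ?_⟩
  rw [LieModuleHom.comp_apply, LieModuleHom.comp_apply, reindexHom_symm_apply]
  exact hγ

omit [LieModule k (↥P.h) N] in
omit [CharZero k] in
-- Since `β ∘ α` is an invertible scalar, `M` is the direct sum of the image of `α` and the kernel
-- of `β`; the image is nonzero, so the kernel vanishes.
theorem IsIndecomposable.bijective (hM : P.IsIndecomposable M) [Nontrivial N]
    (α : N →ₗ⁅k, P.h⁆ M) (β : M →ₗ⁅k, P.h⁆ N) {s : k} (hs : s ≠ 0)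
    (h : ∀ t, β (α t) = s • t) : Function.Bijective β := by
  have hc : IsCompl α.range β.ker := by
    constructor
    · rw [disjoint_iff, LieSubmodule.eq_bot_iff]
      intro m hm
      obtain ⟨h1, h2⟩ := (LieSubmodule.mem_inf _ _ _).1 hm
      obtain ⟨t, rfl⟩ := (LieModuleHom.mem_range _ _).1 h1
      rw [LieModuleHom.mem_ker, h] at h2
      rw [(smul_eq_zero.1 h2).resolve_left hs, map_zero]
    · rw [codisjoint_iff, eq_top_iff]
      intro m _
      have h1 : α (s⁻¹ • β m) ∈ α.range := (LieModuleHom.mem_range _ _).2 ⟨_, rfl⟩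
      have h2 : m - α (s⁻¹ • β m) ∈ β.ker := by
        rw [LieModuleHom.mem_ker, map_sub, h, smul_inv_smul₀ hs, sub_self]
      exact (LieSubmodule.mem_sup _ _ _).2 ⟨_, h1, _, h2, by abel⟩
  have hr : α.range ≠ ⊥ := by
    intro hr
    obtain ⟨t, ht⟩ := exists_ne (0 : N)
    have h1 : α t ∈ α.range := (LieModuleHom.mem_range _ _).2 ⟨t, rfl⟩
    rw [hr, LieSubmodule.mem_bot] at h1
    have h2 := h t
    rw [h1, map_zero] at h2
    exact (smul_ne_zero hs ht) h2.symm
  have hk := (hM.2 _ _ hc).resolve_left hr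
  constructor
  · intro x y hxy
    have h1 : x - y ∈ β.ker := by rw [LieModuleHom.mem_ker, map_sub, hxy, sub_self]
    rw [hk, LieSubmodule.mem_bot] at h1
    exact sub_eq_zero.1 h1
  · intro t
    exact ⟨α (s⁻¹ • t), by rw [h, smul_inv_smul₀ hs]⟩

/-- Sandwiching `a` between `e x` and `y e` gives maps `N → M → N` whose composite is nonzero. It is
a scalar by `SchurData.end_eq_smul`, so `IsIndecomposable.bijective` applies. -/
theorem IsIndecomposable.exists_bijective_of_schurData (h0 : Subsingleton (P.obj (Fin 0)))
    (h1 : Module.finrank k (P.obj (Fin 1)) = 1) (hM : P.IsIndecomposable M) {n : ℕ}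
    (f : (⨂[k] _ : Fin n, P.V) →ₗ⁅k, P.h⁆ M) (β : M →ₗ⁅k, P.h⁆ (⨂[k] _ : Fin n, P.V))
    {a : MonoidAlgebra k (Equiv.Perm (Fin n))} (ha : ∀ t, β (f t) = permHom P.h P.V a t)
    {μ : YoungDiagram} {T : Fin n ≃ μ.cells} {x y : MonoidAlgebra k (Equiv.Perm (Fin n))}
    (hxy : YoungTableau.symmetrizer k T * x * a * y * YoungTableau.symmetrizer k T ≠ 0)
    (D : SchurData P P.V N μ) : ∃ g : M →ₗ⁅k, P.h⁆ N, Function.Bijective g := by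
  obtain ⟨α', hα⟩ : ∃ α' : N →ₗ⁅k, P.h⁆ M, ∀ t, α' t =
      f (permHom P.h P.V y (reindexHom k P.h P.V T.symm (D.incl t))) :=
    ⟨f.comp ((permHom P.h P.V y).comp ((reindexHom k P.h P.V T.symm).comp D.incl)), fun _ => rfl⟩
  obtain ⟨β', hβ⟩ : ∃ β' : M →ₗ⁅k, P.h⁆ N, ∀ m, β' m =
      D.proj (reindexHom k P.h P.V T (permHom P.h P.V x (β m))) :=
    ⟨D.proj.comp ((reindexHom k P.h P.V T).comp ((permHom P.h P.V x).comp β)), fun _ => rfl⟩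
  have hc : ∀ t, D.incl (D.proj t) = youngSymmetrizer k P.h P.V μ t := fun t => by
    rw [D.incl_proj, youngSymmetrizer_apply]
  have h : ∀ t, D.incl (β' (α' (D.proj (reindexHom k P.h P.V T t)))) =
      reindexHom k P.h P.V T (permHom P.h P.V
        (YoungTableau.symmetrizer k T * x * a * y * YoungTableau.symmetrizer k T) t) := by
    intro t
    rw [hα, hβ, hc, hc, ha]
    exact youngSymmetrizer_sandwich T x a y t
  obtain ⟨s, hs⟩ := D.end_eq_smul h1 h0 (β'.comp α')
  have hs' : ∀ t, β' (α' t) = s • t := hs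
  have hs0 : s ≠ 0 := by
    rintro rfl
    have h2 := h (P.tensorGen fun i : Fin n => (i : ℕ))
    rw [hs', zero_smul, map_zero] at h2
    have h3 := congrArg (reindexHom k P.h P.V T.symm) h2
    exact hxy (eq_zero_of_permHom_tensorGen h1 Fin.val_injective
      ((reindexHom_symm_apply T _).symm.trans (h3.symm.trans (map_zero _))))
  have := D.nontrivial h1
  exact ⟨β', hM.bijective α' β' hs0 hs'⟩

theorem IsProjectivePolynomial.exists_equiv_schur (h0 : Subsingleton (P.obj (Fin 0)))
    (h1 : Module.finrank k (P.obj (Fin 1)) = 1) (hM : P.IsProjectivePolynomial M)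
    (hM' : P.IsIndecomposable M) :
    ∃ μ : YoungDiagram, Nonempty (M ≃ₗ⁅k, P.h⁆ OperadRep.schur k P.h P.V μ) := by
  have := hM'.1
  obtain ⟨n, j, m, hj, hm, hm0, hmin⟩ := exists_minimal_multilinear hM.1
  obtain ⟨α, β, hαβ⟩ := hM.exists_factor h0 hm hm0 hmin
  obtain ⟨f, rfl⟩ := hM.1.exists_hom hj hm
  obtain ⟨a, ha⟩ := exists_eq_permHom h0 h1 (β.comp f)
  have ha' : ∀ t, β (f t) = permHom P.h P.V a t := fun t => LieModuleHom.congr_fun ha t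
  -- `m` is the image of the generator under `f`, and `β m ≠ 0`.
  have ha0 : a ≠ 0 := by
    rintro rfl
    rw [ha', permHom_zero, map_zero] at hαβ
    exact hαβ rfl
  obtain ⟨μ, T, x, y, hxy⟩ := YoungTableau.exists_symmetrizer_mul_ne_zero ha0
  obtain ⟨g, hg⟩ := hM'.exists_bijective_of_schurData h0 h1 f β ha' hxy
    (SchurData.schur P μ P.V)
  exact ⟨μ, nonempty_lieModuleEquiv_of_bijective g hg⟩

end Operad


/-! ### Functoriality of tensor powers and Schur's lemma -/

section TensorMap

variable {k L M N ι : Type*} [Field k] [LieRing L] [LieAlgebra k L] [AddCommGroup M] [Module k M]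
  [LieRingModule L M] [LieModule k L M] [AddCommGroup N] [Module k N]
  [LieRingModule L N] [LieModule k L N] [Fintype ι] [DecidableEq ι]

variable (ι) in
/-- The functoriality of tensor powers. -/
def tensorMap (f : M →ₗ⁅k, L⁆ N) : (⨂[k] _ : ι, M) →ₗ⁅k, L⁆ (⨂[k] _ : ι, N) :=
  tensorHom (PiTensorProduct.map fun _ => (f : M →ₗ[k] N)) (by
    intro x v
    rw [lie_tprod, map_sum, PiTensorProduct.map_tprod, lie_tprod]
    refine Finset.sum_congr rfl fun i _ => ?_
    rw [PiTensorProduct.map_tprod]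
    congr 1
    ext1 l
    by_cases h : l = i
    · subst h
      simp
    · simp [h])

theorem tensorMap_tprod (f : M →ₗ⁅k, L⁆ N) (v : ι → M) :
    tensorMap ι f (PiTensorProduct.tprod k v) = PiTensorProduct.tprod k fun i => f (v i) :=
  PiTensorProduct.map_tprod _ v

theorem tensorMap_surjective {f : M →ₗ⁅k, L⁆ N} (hf : Function.Surjective f) :
    Function.Surjective (tensorMap ι f) := by
  intro t
  induction t using PiTensorProduct.induction_on with
  | smul_tprod c v =>
    choose w hw using hf
    exact ⟨c • PiTensorProduct.tprod k fun i => w (v i), by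
      rw [map_smul, tensorMap_tprod]; simp only [hw]⟩
  | add s t hs ht =>
    obtain ⟨s, rfl⟩ := hs
    obtain ⟨t, rfl⟩ := ht
    exact ⟨s + t, map_add _ _ _⟩

theorem tensorMap_permHom (f : M →ₗ⁅k, L⁆ N) (a : MonoidAlgebra k (Equiv.Perm ι))
    (t : ⨂[k] _ : ι, M) : tensorMap ι f (permHom L M a t) = permHom L N a (tensorMap ι f t) := by
  have : (tensorMap ι f).comp (permHom L M a) = (permHom L N a).comp (tensorMap ι f) := by
    refine tensorHom_ext fun v => ?_
    rw [LieModuleHom.comp_apply, LieModuleHom.comp_apply, tensorMap_tprod]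
    induction a using MonoidAlgebra.induction_on with
    | of σ => rw [permHom_of, permHom_of, tensorMap_tprod]
    | add a b ha hb => rw [permHom_add, permHom_add, map_add, ha, hb]
    | smul c a ha => rw [permHom_smul, permHom_smul, map_smul, ha]
  exact LieModuleHom.congr_fun this t

omit [LieAlgebra k L] [LieModule k L M] [LieModule k L N] in
/-- A homomorphism which vanishes on the kernel of a surjection factors through it. -/
theorem exists_factor_of_surjective {A : Type*} [AddCommGroup A] [Module k A] [LieRingModule L A]
    {q : A →ₗ⁅k, L⁆ N} (hq : Function.Surjective q) (g : A →ₗ⁅k, L⁆ M)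
    (h : ∀ a, q a = 0 → g a = 0) : ∃ f : N →ₗ⁅k, L⁆ M, ∀ a, f (q a) = g a := by
  have key : ∀ a b, q a = q b → g a = g b := fun a b hab => by
    rw [← sub_eq_zero, ← map_sub]
    exact h _ (by rw [map_sub, hab, sub_self])
  choose s hs using hq
  refine ⟨{ toFun := fun n => g (s n), map_add' := ?_, map_smul' := ?_, map_lie' := ?_ }, ?_⟩
  · intro x y
    rw [← map_add]
    exact key _ _ (by rw [map_add, hs, hs, hs])
  · intro c x
    rw [RingHom.id_apply, ← map_smul]
    exact key _ _ (by rw [map_smul, hs, hs])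
  · intro x n
    rw [← LieModuleHom.map_lie]
    exact key _ _ (by rw [LieModuleHom.map_lie, hs, hs])
  · intro a
    exact key _ _ (hs _)

omit [LieAlgebra k L] [LieModule k L M] [LieModule k L N] in
/-- Schur's lemma. -/
theorem bijective_of_isIrreducible [LieModule.IsIrreducible k L M] [LieModule.IsIrreducible k L N]
    (f : M →ₗ⁅k, L⁆ N) (hf : ∃ m, f m ≠ 0) : Function.Bijective f := by
  obtain ⟨m, hm⟩ := hf
  have h1 : f.ker = ⊥ := (eq_bot_or_eq_top f.ker).resolve_right fun h => hm (by
    rw [← LieModuleHom.mem_ker, h]; trivial)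
  have h2 : f.range = ⊤ := (eq_bot_or_eq_top f.range).resolve_left fun h => hm (by
    rw [← LieSubmodule.mem_bot (R := k) (L := L), ← h]
    exact (LieModuleHom.mem_range _ _).2 ⟨m, rfl⟩)
  exact ⟨(LieModuleHom.ker_eq_bot f).1 h1, (LieModuleHom.range_eq_top f).1 h2⟩

end TensorMap

namespace Operad

open Weight

variable {k : Type u} [Field k] {P : Operad k} (h0 : Subsingleton (P.obj (Fin 0)))
  (h1 : Module.finrank k (P.obj (Fin 1)) = 1)

/-! ### Tensor powers of the standard representation -/

/-- The projection of `V` onto its linear part, as a map of representations. -/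
def linearHom : P.V →ₗ⁅k, P.h⁆ P.StdRep h0 h1 where
  toLinearMap := (linearPart h1 : P.V →ₗ[k] P.W)
  map_lie' {δ v} := linearPart_derivation h0 h1 δ v

theorem linearHom_surjective : Function.Surjective (linearHom h0 h1) := fun w =>
  ⟨P.ι P.W w, linearPart_ι h1 w⟩

/-- The basis of the standard representation. -/
def stdGen (n : ℕ) : P.StdRep h0 h1 := linearHom h0 h1 (P.x n)

theorem span_stdGen : Submodule.span k (Set.range (stdGen h0 h1)) = ⊤ := by
  have h := (Finsupp.basisSingleOne (R := k) (ι := ℕ)).span_eq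
  have h2 : stdGen h0 h1 = (Finsupp.basisSingleOne (R := k) (ι := ℕ) : ℕ → ℕ →₀ k) := by
    ext1 n
    rw [Finsupp.coe_basisSingleOne]
    exact linearPart_ι h1 _
  rw [h2]
  exact h

variable {ι κ : Type} [Fintype ι] [DecidableEq ι] [Fintype κ] [DecidableEq κ]

theorem eq_zero_of_permHom_stdGen {j : ι → ℕ} (hj : Function.Injective j)
    {a : MonoidAlgebra k (Equiv.Perm ι)}
    (ha : permHom P.h (P.StdRep h0 h1) a
      (PiTensorProduct.tprod k fun i => stdGen h0 h1 (j i)) = 0) : a = 0 := by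
  let φ : ℕ → P.StdRep h0 h1 →ₗ[k] k := fun n => (Finsupp.lapply n : P.W →ₗ[k] k)
  have hφ : ∀ n n', φ n (stdGen h0 h1 n') = if n' = n then 1 else 0 := fun n n' =>
    (congrArg (Finsupp.lapply n : P.W →ₗ[k] k) (linearPart_ι h1 (Finsupp.single n' 1))).trans
      Finsupp.single_apply
  refine eq_zero_of_permHom_tprod (fun i => stdGen h0 h1 (j i)) (fun i => φ (j i))
    (fun i i' => ?_) ha
  rw [hφ]
  simp only [hj.eq_iff]

theorem hasWeight_tprod_stdGen (c : κ → ℕ) : P.HasWeight (countWeight c)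
    (PiTensorProduct.tprod k fun t => stdGen h0 h1 (c t)) := by
  have h := (P.hasWeight_tensorGen c).map (tensorMap κ (linearHom h0 h1))
  rwa [tensorGen, tensorMap_tprod] at h

theorem mem_span_tprod_stdGen [CharZero k] {w : ℕ →₀ ℕ} {z : ⨂[k] _ : κ, P.StdRep h0 h1}
    (hz : P.HasWeight w z) : z ∈ Submodule.span k
      ((fun c : κ → ℕ => PiTensorProduct.tprod k fun t => stdGen h0 h1 (c t)) ''
        {c | countWeight c = w}) :=
  mem_span_of_isWeight _ _ (fun c => hasWeight_tprod_stdGen h0 h1 c)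
    (span_tprod_of_span _ (span_stdGen h0 h1)) hz

omit [DecidableEq ι] in
-- Tensors of basis vectors of `W` contain exactly one variable per factor, so the size of a weight
-- determines the number of factors.
theorem nonempty_equiv_of_hasWeight [CharZero k] {j : ι → ℕ} (hj : Function.Injective j)
    {z : ⨂[k] _ : κ, P.StdRep h0 h1} (hz : P.HasWeight (countWeight j) z) (hz0 : z ≠ 0) :
    Nonempty (κ ≃ ι) := by
  by_contra h
  refine hz0 ?_
  have h2 := mem_span_tprod_stdGen h0 h1 hz
  have h3 : {c : κ → ℕ | countWeight c = countWeight j} = ∅ :=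
    Set.eq_empty_iff_forall_notMem.2 fun c hc =>
      h ⟨(exists_equiv_of_countWeight_eq hj hc).choose⟩
  rw [h3, Set.image_empty, Submodule.span_empty] at h2
  exact (Submodule.mem_bot k).1 h2

theorem exists_permHom_stdGen [CharZero k] {j : ι → ℕ} (hj : Function.Injective j)
    {z : ⨂[k] _ : ι, P.StdRep h0 h1} (hz : P.HasWeight (countWeight j) z) :
    ∃ a : MonoidAlgebra k (Equiv.Perm ι), permHom P.h (P.StdRep h0 h1) a
      (PiTensorProduct.tprod k fun i => stdGen h0 h1 (j i)) = z := by
  have h := mem_span_tprod_stdGen h0 h1 hz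
  clear hz
  induction h using Submodule.span_induction with
  | mem z hz =>
    obtain ⟨c, hc, rfl⟩ := hz
    obtain ⟨b, hb⟩ := exists_equiv_of_countWeight_eq hj hc
    refine ⟨MonoidAlgebra.of k _ b.symm, ?_⟩
    rw [permHom_of]
    simp only [Equiv.symm_symm, hb]
  | zero => exact ⟨0, permHom_zero _⟩
  | add x y _ _ hx hy =>
    obtain ⟨a, rfl⟩ := hx
    obtain ⟨b, rfl⟩ := hy
    exact ⟨a + b, permHom_add _ _ _⟩
  | smul c x _ hx =>
    obtain ⟨a, rfl⟩ := hx
    exact ⟨c • a, permHom_smul _ _ _⟩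

end Operad


/-- Right multiples of an eigenvector of the Young symmetrizer contain the Young symmetrizer. -/
theorem YoungTableau.exists_mul_mul_symmetrizer {k X : Type*} [Field k] [CharZero k] [Fintype X]
    [DecidableEq X] {μ : YoungDiagram} (T : X ≃ μ.cells) {a : MonoidAlgebra k (Equiv.Perm X)}
    (ha : a ≠ 0) {c : k} (hc : c ≠ 0) (hca : symmetrizer k T * a = c • a) :
    ∃ (z : MonoidAlgebra k (Equiv.Perm X)) (s : k), s ≠ 0 ∧
      a * z * symmetrizer k T = s • symmetrizer k T := by
  obtain ⟨z, hz⟩ := exists_mul_mul_self a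
  obtain ⟨s, hs⟩ := exists_symmetrizer_mul_mul_symmetrizer (k := k) T (a * z)
  rw [← mul_assoc, hca, smul_mul_assoc, smul_mul_assoc] at hs
  refine ⟨z, c⁻¹ * s, ?_, by rw [mul_smul, ← hs, inv_smul_smul₀ hc]⟩
  intro h
  -- If the scalar vanished then `a z e = 0`. Multiplying by `a` on the right and using `e a = c a`
  -- and `a z a = a` gives `c a = 0`.
  rw [(mul_eq_zero.1 h).resolve_left (inv_ne_zero hc), zero_smul, smul_eq_zero] at hs
  have h2 := congrArg (· * a) (hs.resolve_left hc)
  simp only [zero_mul] at h2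
  rw [mul_assoc, hca, mul_smul_comm, hz] at h2
  exact smul_ne_zero hc ha h2

namespace Operad

open Weight

variable {k : Type u} [Field k] {P : Operad k} {h0 : Subsingleton (P.obj (Fin 0))}
  {h1 : Module.finrank k (P.obj (Fin 1)) = 1} {S Q M : Type u} [AddCommGroup S] [Module k S]
  [LieRingModule P.h S] [LieModule k P.h S] [AddCommGroup Q] [Module k Q]
  [LieRingModule P.h Q] [LieModule k P.h Q] [AddCommGroup M] [Module k M]
  [LieRingModule P.h M] [LieModule k P.h M] {μ : YoungDiagram}

/-! ### Classification of the simple polynomial representations -/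

theorem tensorMap_tensorGen {ι : Type} [Fintype ι] [DecidableEq ι] (j : ι → ℕ) :
    tensorMap ι (linearHom h0 h1) (P.tensorGen j) =
      PiTensorProduct.tprod k fun i => stdGen h0 h1 (j i) :=
  tensorMap_tprod _ _

section Simple

variable (D : SchurData P (P.StdRep h0 h1) S μ)

include D

/-- The map of the tensor power of `V` onto a Schur functor of the standard representation. -/
theorem SchurData.exists_surjective : ∃ q : (⨂[k] _ : μ.cells, P.V) →ₗ⁅k, P.h⁆ S,
    Function.Surjective q ∧ ∀ t, D.incl (q t) = permHom P.h (P.StdRep h0 h1)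
      (YoungTableau.symmetrizer k (Equiv.refl μ.cells))
      (tensorMap μ.cells (linearHom h0 h1) t) :=
  ⟨D.proj.comp (tensorMap μ.cells (linearHom h0 h1)),
    D.proj_surjective.comp (tensorMap_surjective (linearHom_surjective h0 h1)),
    fun _ => D.incl_proj _⟩

theorem SchurData.isPolynomial : P.IsPolynomial S := by
  obtain ⟨q, hq, -⟩ := D.exists_surjective
  exact (P.isPolynomial_tensor μ.cells).of_surjective q hq

theorem SchurData.nontrivial_std : Nontrivial S := by
  obtain ⟨q, -, hq⟩ := D.exists_surjective
  let j : μ.cells → ℕ := fun i => Fintype.equivFin μ.cells i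
  have hj : Function.Injective j := fun i i' h =>
    (Fintype.equivFin μ.cells).injective (Fin.ext h)
  refine ⟨q (P.tensorGen j), 0, fun h => ?_⟩
  have h2 := hq (P.tensorGen j)
  rw [h, map_zero, tensorMap_tensorGen] at h2
  exact symmetrizer_ne_zero (k := k) _ (eq_zero_of_permHom_stdGen h0 h1 hj h2.symm)

variable [CharZero k]

/-- The symmetrizer multiplies vectors of `S` by `c`. As permuted tensors of distinct basis vectors
are independent, this identity passes from the vector to the group algebra element `a`. -/
theorem SchurData.exists_eigenvector {j : μ.cells → ℕ} (hj : Function.Injective j) {n : S}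
    (hw : P.HasWeight (countWeight j) n) (hn0 : n ≠ 0) :
    ∃ (a : MonoidAlgebra k (Equiv.Perm μ.cells)) (c : k), a ≠ 0 ∧ c ≠ 0 ∧
      YoungTableau.symmetrizer k (Equiv.refl μ.cells) * a = c • a ∧
      permHom P.h (P.StdRep h0 h1) a (PiTensorProduct.tprod k fun i => stdGen h0 h1 (j i)) =
        D.incl n := by
  obtain ⟨a, ha⟩ := exists_permHom_stdGen h0 h1 hj (hw.map D.incl)
  obtain ⟨c, hc0, hc⟩ := D.exists_proj_incl
  refine ⟨a, c, ?_, hc0, ?_, ha⟩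
  · rintro rfl
    rw [permHom_zero, ← map_zero D.incl] at ha
    exact hn0 (D.incl_injective ha).symm
  · rw [← sub_eq_zero]
    refine eq_zero_of_permHom_stdGen h0 h1 hj ?_
    rw [sub_eq_add_neg, ← neg_smul, permHom_add, permHom_mul, permHom_smul, ha, ← D.incl_proj, hc,
      map_smul, neg_smul, add_neg_cancel]

/-- A nonzero weight vector which is multilinear generates the representation. -/
theorem SchurData.eq_top_of_mem (N : LieSubmodule k P.h S) {j : μ.cells → ℕ}
    (hj : Function.Injective j) {n : S} (hn : n ∈ N) (hw : P.HasWeight (countWeight j) n)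
    (hn0 : n ≠ 0) : N = ⊤ := by
  obtain ⟨q, hqs, hq⟩ := D.exists_surjective
  obtain ⟨a, c, ha0, hc0, hca, ha⟩ := D.exists_eigenvector hj hw hn0
  obtain ⟨z, s, hs0, hs⟩ := YoungTableau.exists_mul_mul_symmetrizer _ ha0 hc0 hca
  obtain ⟨f, hf⟩ := D.isPolynomial.exists_hom hj hw
  have hfN : N.comap f = ⊤ := P.eq_top_of_tensorGen_mem hj _ (by
    rw [LieSubmodule.mem_comap, hf]; exact hn)
  have hfa : D.incl.comp f = (permHom P.h (P.StdRep h0 h1) a).comp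
      (tensorMap μ.cells (linearHom h0 h1)) := tensor_hom_ext hj (by
    rw [LieModuleHom.comp_apply, LieModuleHom.comp_apply, hf, tensorMap_tensorGen, ha])
  rw [eq_top_iff]
  intro m _
  obtain ⟨u, rfl⟩ := hqs m
  -- Inside the tensor power of `W` the map `f` is `a`, so precomposing it with `z e` gives `a z e =
  -- s e`, which is `s` times the projection `q`. Hence `N` contains the whole image of `q`.
  have h2 : f (permHom P.h P.V (z * YoungTableau.symmetrizer k (Equiv.refl μ.cells)) u) =
      s • q u := by
    refine D.incl_injective ?_
    refine (LieModuleHom.congr_fun hfa _).trans ?_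
    rw [LieModuleHom.comp_apply, tensorMap_permHom, map_smul, hq]
    refine (permHom_mul _ _ _).symm.trans ?_
    rw [← mul_assoc, hs, permHom_smul]
  have h3 : s • q u ∈ N := by
    rw [← h2, ← LieSubmodule.mem_comap, hfN]
    trivial
  rw [← inv_smul_smul₀ hs0 (q u)]
  exact N.smul_mem _ h3

/-- A nonzero subrepresentation contains a nonzero multilinear vector. It has size `|μ|` because `S`
lies in `W^{⊗|μ|}`, and it generates `S` by `SchurData.eq_top_of_mem`. -/
theorem SchurData.isSimplePolynomial : P.IsSimplePolynomial S := by
  refine ⟨D.isPolynomial, ?_⟩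
  have := D.nontrivial_std
  refine LieModule.IsIrreducible.mk fun N hN => ?_
  have hNt : Nontrivial N := (LieSubmodule.nontrivial_iff_ne_bot k P.h S).2 hN
  have hgood : P.IsGoodModule N :=
    D.isPolynomial.isGoodModule.of_injective N.incl Subtype.val_injective
  obtain ⟨e, j, n, hj, hw, hn0⟩ := hgood.exists_multilinear
  have hw' : P.HasWeight (countWeight j) (n : S) := hw.map N.incl
  have hn0' : (n : S) ≠ 0 := fun h => hn0 (Subtype.ext h)
  obtain ⟨b⟩ := nonempty_equiv_of_hasWeight h0 h1 hj (hw'.map D.incl) (fun h => hn0'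
    (D.incl_injective (h.trans (map_zero _).symm)))
  have hjb : countWeight (j ∘ b) = countWeight j :=
    b.sum_comp fun i => Finsupp.single (j i) 1
  exact D.eq_top_of_mem N (hj.comp b.injective) n.2 (by rw [hjb]; exact hw') hn0'

end Simple

variable [CharZero k]

/-- Write `1` as a combination of elements `x e y` with `e` a Young symmetrizer. If all symmetrizers
acted by zero, every map from a tensor power would kill its generator, and `M` would have no nonzero
multilinear vector. -/
theorem IsPolynomial.exists_hom_schur_ne_zero (hM : P.IsPolynomial M) [Nontrivial M] :
    ∃ (μ : YoungDiagram) (f : (⨂[k] _ : μ.cells, P.V) →ₗ⁅k, P.h⁆ M),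
      ∃ t, f (youngSymmetrizer k P.h P.V μ t) ≠ 0 := by
  obtain ⟨n, j, m, hj, hm, hm0⟩ := hM.isGoodModule.exists_multilinear
  obtain ⟨f, rfl⟩ := hM.exists_hom hj hm
  by_contra! h
  refine hm0 ?_
  have key : ∀ a ∈ Submodule.span k {a | ∃ (μ : YoungDiagram) (T : Fin n ≃ μ.cells)
      (x y : MonoidAlgebra k (Equiv.Perm (Fin n))), a = x * YoungTableau.symmetrizer k T * y},
      f (permHom P.h P.V a (P.tensorGen j)) = 0 := by
    intro a ha
    induction ha using Submodule.span_induction with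
    | mem a ha =>
      obtain ⟨μ, T, x, y, rfl⟩ := ha
      have h2 := h μ ((f.comp (permHom P.h P.V x)).comp (reindexHom k P.h P.V T.symm))
        (reindexHom k P.h P.V T (permHom P.h P.V y (P.tensorGen j)))
      rw [LieModuleHom.comp_apply, LieModuleHom.comp_apply, ← permHom_symmetrizer,
        reindexHom_symm_apply] at h2
      rw [permHom_mul, permHom_mul]
      exact h2
    | zero => rw [permHom_zero, map_zero]
    | add a b _ _ ha hb => rw [permHom_add, map_add, ha, hb, add_zero]
    | smul c a _ ha => rw [permHom_smul, map_smul, ha, smul_zero]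
  have h3 := key 1 YoungTableau.one_mem_span_symmetrizer
  rwa [permHom_one] at h3

/-- A nonzero map from a Schur functor of `V` to a simple representation vanishes on the kernel of
the projection to the corresponding Schur functor of the standard representation. -/
theorem SchurData.eq_zero_of_apply_eq_zero (E : SchurData P P.V Q μ)
    (D : SchurData P (P.StdRep h0 h1) S μ) (hM : P.IsSimplePolynomial M)
    (g : Q →ₗ⁅k, P.h⁆ M) (hg : ∃ x, g x ≠ 0) (q : Q →ₗ⁅k, P.h⁆ S)
    (hq : ∀ x, q x = D.proj (tensorMap μ.cells (linearHom h0 h1) (E.incl x))) (x : Q)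
    (hx : q x = 0) : g x = 0 := by
  by_contra hgx
  obtain ⟨y, hy⟩ := hg
  have := hM.2
  -- If `g` does not vanish on the kernel of `q`, simplicity makes the kernel surject onto `M`. The
  -- image of the generator then lifts to a multilinear vector `κ` of the kernel.
  have htop : (g.comp q.ker.incl).range = ⊤ := (eq_bot_or_eq_top _).resolve_left fun h => hgx (by
    rw [← LieSubmodule.mem_bot (R := k) (L := P.h), ← h]
    exact (LieModuleHom.mem_range _ _).2 ⟨⟨x, LieModuleHom.mem_ker.2 hx⟩, rfl⟩)
  have hsurj : Function.Surjective (g.comp q.ker.incl) := (LieModuleHom.range_eq_top _).1 htop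
  have hQ : P.IsPolynomial Q := (P.isPolynomial_tensor μ.cells).of_surjective _ E.proj_surjective
  have hgood : P.IsGoodModule q.ker :=
    hQ.isGoodModule.of_injective q.ker.incl Subtype.val_injective
  let j : μ.cells → ℕ := fun i => Fintype.equivFin μ.cells i
  have hj : Function.Injective j := fun i i' h =>
    (Fintype.equivFin μ.cells).injective (Fin.ext h)
  obtain ⟨κ₀, hκ₀⟩ := hsurj (g (E.proj (P.tensorGen j)))
  have hw : P.HasWeight (countWeight j) (g.comp q.ker.incl κ₀) := by
    rw [hκ₀]
    exact (P.hasWeight_tensorGen j).map (g.comp E.proj)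
  obtain ⟨κ, hκ, hgκ⟩ := hgood.exists_lift _ hw
  have hqκ : q (κ : Q) = 0 := LieModuleHom.mem_ker.1 κ.2
  obtain ⟨a, ha⟩ := exists_permHom_tensorGen h0 h1 hj (hκ.map (E.incl.comp q.ker.incl))
  have ha' : permHom P.h P.V a (P.tensorGen j) = E.incl (κ : Q) := ha
  -- Passing from `V` to `W` loses nothing on vectors of this weight, since the group algebra acts
  -- freely on the generator of either tensor power. So `q κ = 0` already gives `e a = 0`, whence `κ
  -- = 0`.
  have hca : YoungTableau.symmetrizer k (Equiv.refl μ.cells) * a = 0 := by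
    refine eq_zero_of_permHom_stdGen h0 h1 hj ?_
    rw [permHom_mul, ← tensorMap_tensorGen, ← tensorMap_permHom, ha', ← D.incl_proj, ← hq, hqκ,
      map_zero]
  obtain ⟨c, hc0, hc⟩ := E.exists_proj_incl
  have hκ0 : (κ : Q) = 0 := by
    have h2 : c • E.incl (κ : Q) = 0 := by
      rw [← map_smul, ← hc, E.incl_proj, ← ha', ← permHom_mul, hca, permHom_zero]
    exact E.incl_injective (((smul_eq_zero.1 h2).resolve_left hc0).trans (map_zero _).symm)
  have hgt : g (E.proj (P.tensorGen j)) = 0 := by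
    rw [← hκ₀, ← hgκ, LieModuleHom.comp_apply, LieSubmodule.incl_apply, hκ0, map_zero]
  have hg0 : g.comp E.proj = 0 := tensor_hom_ext hj (by
    rw [LieModuleHom.comp_apply, hgt]
    rfl)
  obtain ⟨t, rfl⟩ := E.proj_surjective y
  exact hy (LieModuleHom.congr_fun hg0 t)

/-- The restriction of `f` to `S_μ(V)` is nonzero and vanishes on the kernel of the surjection onto
`S_μ(W)`. The induced map between simple representations is bijective by Schur's lemma. -/
theorem SchurData.exists_bijective (E : SchurData P P.V Q μ)
    (D : SchurData P (P.StdRep h0 h1) S μ) (hM : P.IsSimplePolynomial M)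
    (f : (⨂[k] _ : μ.cells, P.V) →ₗ⁅k, P.h⁆ M)
    (hf : ∃ t, f (youngSymmetrizer k P.h P.V μ t) ≠ 0) :
    ∃ g : S →ₗ⁅k, P.h⁆ M, Function.Bijective g := by
  obtain ⟨t, ht⟩ := hf
  have hft : (f.comp E.incl) (E.proj t) ≠ 0 := by
    rw [LieModuleHom.comp_apply, E.incl_proj, ← youngSymmetrizer_apply]
    exact ht
  obtain ⟨q, hq⟩ : ∃ q : Q →ₗ⁅k, P.h⁆ S,
      ∀ x, q x = D.proj (tensorMap μ.cells (linearHom h0 h1) (E.incl x)) :=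
    ⟨D.proj.comp ((tensorMap μ.cells (linearHom h0 h1)).comp E.incl), fun _ => rfl⟩
  obtain ⟨c, hc0, hc⟩ := D.exists_proj_incl
  have hqs : Function.Surjective q := by
    intro m
    obtain ⟨t, ht⟩ := tensorMap_surjective (ι := μ.cells) (linearHom_surjective h0 h1) (D.incl m)
    -- The symmetrizer is applied twice on the way, once in each Schur functor, and each application
    -- contributes a factor `c`.
    refine ⟨c⁻¹ • c⁻¹ • E.proj t, ?_⟩
    rw [map_smul, map_smul, hq, E.incl_proj, tensorMap_permHom, ht, ← D.incl_proj, hc, hc,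
      inv_smul_smul₀ hc0, inv_smul_smul₀ hc0]
  obtain ⟨g, hg⟩ := exists_factor_of_surjective hqs (f.comp E.incl)
    (E.eq_zero_of_apply_eq_zero D hM _ ⟨_, hft⟩ q hq)
  have := hM.2
  have := D.isSimplePolynomial.2
  exact ⟨g, bijective_of_isIrreducible g ⟨q (E.proj t), by rw [hg]; exact hft⟩⟩

variable (h0 h1) in
theorem IsSimplePolynomial.exists_equiv_schur (hM : P.IsSimplePolynomial M) :
    ∃ μ : YoungDiagram, Nonempty (M ≃ₗ⁅k, P.h⁆ OperadRep.schur k P.h (P.StdRep h0 h1) μ) := by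
  have := hM.2
  have : Nontrivial M := (LieSubmodule.nontrivial_iff k P.h M).1 inferInstance
  obtain ⟨μ, f, hf⟩ := hM.1.exists_hom_schur_ne_zero
  obtain ⟨g, hg⟩ := (SchurData.schur P μ P.V).exists_bijective
    (SchurData.schur P μ (P.StdRep h0 h1)) hM f hf
  obtain ⟨e⟩ := nonempty_lieModuleEquiv_of_bijective g hg
  exact ⟨μ, ⟨e.symm⟩⟩

end Operad

end

end OperadRep

theorem mainTheorem10 {k : Type u} [Field k] [CharZero k] (P : OperadRep.Operad k)
    (h0 : Subsingleton (P.obj (Fin 0))) (h1 : Module.finrank k (P.obj (Fin 1)) = 1) :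
    ((∀ μ : YoungDiagram,
        P.IsSimplePolynomial (OperadRep.schur k P.h (P.StdRep h0 h1) μ)) ∧
      ∀ (M : Type u) [AddCommGroup M] [Module k M] [LieRingModule P.h M] [LieModule k P.h M],
        P.IsSimplePolynomial M →
          ∃ μ : YoungDiagram, Nonempty (M ≃ₗ⁅k, P.h⁆ OperadRep.schur k P.h (P.StdRep h0 h1) μ)) ∧
    ((∀ μ : YoungDiagram,
        P.IsProjectivePolynomial (OperadRep.schur k P.h P.V μ) ∧
          P.IsIndecomposable (OperadRep.schur k P.h P.V μ)) ∧
      ∀ (M : Type u) [AddCommGroup M] [Module k M] [LieRingModule P.h M] [LieModule k P.h M],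
        P.IsProjectivePolynomial M → P.IsIndecomposable M →
          ∃ μ : YoungDiagram, Nonempty (M ≃ₗ⁅k, P.h⁆ OperadRep.schur k P.h P.V μ)) := by
  exact ⟨⟨fun μ => (OperadRep.Operad.SchurData.schur P μ (P.StdRep h0 h1)).isSimplePolynomial,
      fun M _ _ _ _ hM => hM.exists_equiv_schur h0 h1⟩,
    fun μ => ⟨(OperadRep.Operad.SchurData.schur P μ P.V).isProjectivePolynomial,
      (OperadRep.Operad.SchurData.schur P μ P.V).isIndecomposable h1 h0⟩,
    fun M _ _ _ _ hM hM' => hM.exists_equiv_schur h0 h1 hM'⟩
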